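/- Let $d\ge 1$, $T>0$, $1<p\le\infty$, and let $u:(0,T)\times\mathbb{T}^d\to\mathbb{R}^d$, with $\mathbb{T}^d=\mathbb{R}^d/\mathbb{Z}^d$, satisfy $$u\in\big[L^1(0,T;W^{1,p}(\mathbb{T}^d))\cap L^\infty((0,T)\times\mathbb{T}^d)\big]^d .$$ Write $\operatorname{div}(u)^-=\max(-\operatorname{div}u,0)$. *Regular Lagrangian flow.* $\Phi$ is a regular Lagrangian flow of $u$ if for a.e. $x$ the curve $t\mapsto\Phi(t,x)$ is an absolutely continuous solution on $[0,T]$ of $\partial_t\Phi(t,x)=u(t,\Phi(t,x))$ (for a.e. $t$) with $\Phi(0,x)=x$, and there is a constant $L$ with $\Phi(t,\cdot)_\#\mathscr{L}^d\le L\,\mathscr{L}^d$ for every $t\in[0,T]$. Periodic functions on $\mathbb{R}^d$ are used for functions on $\mathbb{T}^d$, and flows are lifted to $\mathbb{R}^d$, so that $\Phi(t,x)-\Phi_E(t,x)$ below is a vector of $\mathbb{R}^d$ (whose length is at least the distance in $\mathbb{T}^d$). *Euler approximation.* Let $\eta$ be a standard mollifier on $\mathbb{R}^d$ (smooth, nonnegative,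 supported in the closed unit ball, $\int\eta=1$), $\eta_\delta(x)=\delta^{-d}\eta(x/\delta)$, and $u_\delta(t,\cdot)=\eta_\delta*u(t,\cdot)$. Let $\Delta t>0$ be such that $T/\Delta t$ is an integer, and $t_n=n\Delta t$. Put $v=u_\delta$ with $\delta=\sqrt{\Delta t}$ if $p\le d$, and $v=u$ (the representative of $u(t,\cdot)$ that is continuous in $x$) if $p>d$. Define $\Phi_E(0,x)=x$ and, for $t\in[t_n,t_{n+1}]$, $$\Phi_E(t,x)=\Phi_E(t_n,x)+(t-t_n)\,\frac{1}{\Delta t}\int_{t_n}^{t_{n+1}}v(s,\Phi_E(t_n,x))\,ds .$$ **Theorem.** Let $\Phi$ be the regular Lagrangian flow of $u$, and assume that $\operatorname{div}(u)^-\in L^\infty((0,T)\times\mathbb{T}^d)$ if $p\le d$, and $\operatorname{div}(u)^-\in L^1(0,T;L^\infty(\mathbb{T}^d))$ if $p>d$. Then there are constants $C_t$, independent of $\Delta t$, with $C_t\to0$ as $t\to0^+$, such that for every $\Delta t>0$ with $T/\Delta t\in\mathbb{N}$ and $\Delta t\ne1$, and for every $t\in[0,T]$, $$\|\Phi(t,\cdot)-\Phi_E(t,\cdot)\|_{L^p(\mathbb{T}^d)}\le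 C_t\,|\log\Delta t|^{-1}.$$ Moreover, if $p>d$, then the same conclusion holds for a regular Lagrangian flow $\Phi$ of $u$ if one only assumes $\operatorname{div}(u)^-\in L^1(0,T;L^p(\mathbb{T}^d))$. -/

import Mathlib

open MeasureTheory Set Filter Topology
open scoped ENNReal NNReal ContDiff

noncomputable section

/-- The Euclidean space `ℝᵈ`. Functions on the torus `𝕋ᵈ = ℝᵈ / ℤᵈ` are written as `ℤᵈ`-periodic
functions on `ℝᵈ`. -/
abbrev Eucl (d : ℕ) : Type := EuclideanSpace ℝ (Fin d)

/-- `ℤᵈ`-periodic functions on `ℝᵈ`, i.e. functions on the torus. -/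
def ZPeriodic {d : ℕ} {F : Type*} (f : Eucl d → F) : Prop :=
  ∀ i : Fin d, Function.Periodic f (EuclideanSpace.single i (1 : ℝ))

/-- The Lebesgue measure of the torus: Lebesgue measure on the fundamental domain `[0,1)ᵈ`. -/
def torusMeasure (d : ℕ) : Measure (Eucl d) :=
  volume.restrict {x : Eucl d | ∀ i, x i ∈ Ico (0 : ℝ) 1}

/-- The product of Lebesgue measure on `(0,T)` with the Lebesgue measure of the torus. -/
def timeTorusMeasure (d : ℕ) (T : ℝ) : Measure (ℝ × Eucl d) :=
  (volume.restrict (Ioo 0 T)).prod (torusMeasure d)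

/-- `f ∈ L^∞((0,T) × 𝕋ᵈ)`. -/
def MemLinfty {d : ℕ} {F : Type*} [NormedAddCommGroup F] (T : ℝ) (f : ℝ → Eucl d → F) : Prop :=
  MemLp (Function.uncurry f) (⊤ : ℝ≥0∞) (timeTorusMeasure d T)

/-- `f ∈ L¹(0,T; L^q(𝕋ᵈ))`. -/
def MemL1Lq {d : ℕ} {F : Type*} [NormedAddCommGroup F] (T : ℝ) (q : ℝ≥0∞)
    (f : ℝ → Eucl d → F) : Prop :=
  AEStronglyMeasurable (Function.uncurry f) (timeTorusMeasure d T) ∧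
    ∫⁻ t in Ioo 0 T, eLpNorm (f t) q (torusMeasure d) < ⊤

/-- `G` is the weak (distributional) derivative of the vector field `v`:
`∫ (∂_w φ) v = - ∫ φ G w` for all test functions `φ` and all directions `w`. -/
def HasWeakDeriv {d : ℕ} (v : Eucl d → Eucl d) (G : Eucl d → Eucl d →L[ℝ] Eucl d) : Prop :=
  LocallyIntegrable v ∧ LocallyIntegrable G ∧
    ∀ φ : Eucl d → ℝ, ContDiff ℝ ∞ φ → HasCompactSupport φ → ∀ w : Eucl d,
      ∫ x, (fderiv ℝ φ x w) • v x = - ∫ x, φ x • G x w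

/-- `u ∈ [L¹(0,T; W^{1,p}(𝕋ᵈ)) ∩ L^∞((0,T) × 𝕋ᵈ)]ᵈ`, with spatial weak derivative `Du`. -/
structure IsSobolevVelocity {d : ℕ} (T : ℝ) (p : ℝ≥0∞) (u : ℝ → Eucl d → Eucl d)
    (Du : ℝ → Eucl d → Eucl d →L[ℝ] Eucl d) : Prop where
  periodic : ∀ t, ZPeriodic (u t)
  periodic_deriv : ∀ t, ZPeriodic (Du t)
  weakDeriv : ∀ᵐ t ∂volume.restrict (Ioo 0 T), HasWeakDeriv (u t) (Du t)
  memLp : MemL1Lq T p u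
  memLp_deriv : MemL1Lq T p Du
  bounded : MemLinfty T u

/-- The negative part `div(u)⁻ = max (-div u) 0` of the divergence (the trace of `Du`). -/
def negDiv {d : ℕ} (Du : ℝ → Eucl d → Eucl d →L[ℝ] Eucl d) (t : ℝ) (x : Eucl d) : ℝ :=
  max (-∑ i, (Du t x (EuclideanSpace.single i (1 : ℝ))) i) 0

/-- The assumption on the divergence: `div(u)⁻ ∈ L^∞((0,T) × 𝕋ᵈ)` if `p ≤ d`, and
`div(u)⁻ ∈ L¹(0,T; L^∞(𝕋ᵈ))` if `p > d`. -/
def DivergenceAssumption {d : ℕ} (T : ℝ) (p : ℝ≥0∞)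
    (Du : ℝ → Eucl d → Eucl d →L[ℝ] Eucl d) : Prop :=
  (p ≤ (d : ℝ≥0∞) → MemLinfty T (negDiv Du)) ∧
    ((d : ℝ≥0∞) < p → MemL1Lq T ⊤ (negDiv Du))

/-- `Φ` is a regular Lagrangian flow of `u` on `[0,T]`: for a.e. `x` the curve `t ↦ Φ t x` is an
absolutely continuous solution of the differential equation starting at `x`, and the push-forward
of Lebesgue measure under each `Φ t` is at most `L` times Lebesgue measure. (A push-forward only
makes sense for measurable maps, and `Measure.map` has a default value otherwise; hence the second
field.) For a periodic `u`, the flow on the torus is represented by its lift to `ℝᵈ`. -/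
structure IsRegularLagrangianFlow {d : ℕ} (T : ℝ) (u : ℝ → Eucl d → Eucl d)
    (Φ : ℝ → Eucl d → Eucl d) : Prop where
  solves : ∀ᵐ x : Eucl d, Φ 0 x = x ∧ AbsolutelyContinuousOnInterval (fun t => Φ t x) 0 T ∧
    ∀ᵐ t ∂volume.restrict (Ioo 0 T), HasDerivAt (fun s => Φ s x) (u t (Φ t x)) t
  aemeasurable : ∀ t ∈ Icc 0 T, AEMeasurable (Φ t) volume
  compressibility : ∃ L : ℝ≥0, ∀ t ∈ Icc 0 T,
    Measure.map (Φ t) (volume : Measure (Eucl d)) ≤ L • (volume : Measure (Eucl d))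

/-- A standard mollifier: smooth, nonnegative, supported in the closed unit ball, of integral 1. -/
structure IsStandardMollifier {d : ℕ} (η : Eucl d → ℝ) : Prop where
  smooth : ContDiff ℝ ∞ η
  nonneg : ∀ x, 0 ≤ η x
  support : tsupport η ⊆ Metric.closedBall 0 1
  integral : ∫ x, η x = 1

/-- `η_δ ∗ f`, with `η_δ(y) = δ⁻ᵈ η(y / δ)`. -/
def mollify {d : ℕ} (η : Eucl d → ℝ) (δ : ℝ) (f : Eucl d → Eucl d) (x : Eucl d) : Eucl d :=
  ∫ y, ((δ ^ d)⁻¹ * η (δ⁻¹ • y)) • f (x - y)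

open Classical in
/-- The (unique) continuous representative of the a.e.-class of `f`, if there is one. -/
def contRep {d : ℕ} (f : Eucl d → Eucl d) : Eucl d → Eucl d :=
  if h : ∃ g : Eucl d → Eucl d, Continuous g ∧ g =ᵐ[volume] f then h.choose else f

open Classical in
/-- The velocity used by the Euler approximation: the mollification `u_δ(t,·)` if `p ≤ d`, and
`u(t,·)` itself (its continuous representative, as an element of `W^{1,p}`) if `p > d`. -/
def eulerVelocity {d : ℕ} (p : ℝ≥0∞) (η : Eucl d → ℝ) (δ : ℝ) (u : ℝ → Eucl d → Eucl d)
    (t : ℝ) : Eucl d → Eucl d :=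
  if p ≤ (d : ℝ≥0∞) then mollify η δ (u t) else contRep (u t)

/-- The explicit Euler step from time `n h`: the point `y` is moved for a time `τ` with the
velocity `⨍ v(s,y) ds`, averaged over `s` in `(n h, (n+1) h)`. -/
def eulerStep {d : ℕ} (v : ℝ → Eucl d → Eucl d) (h : ℝ) (n : ℕ) (τ : ℝ) (y : Eucl d) : Eucl d :=
  y + τ • ⨍ s in ((n : ℝ) * h)..(((n : ℝ) + 1) * h), v s y

/-- The position at time `n h` of the Euler approximation started from `x`. -/
def eulerNode {d : ℕ} (v : ℝ → Eucl d → Eucl d) (h : ℝ) : ℕ → Eucl d → Eucl d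
  | 0, x => x
  | n + 1, x => eulerStep v h n h (eulerNode v h n x)

/-- The Euler approximation for the velocity `v` with time step `h`: on `[n h, (n+1) h]` it is
`Φ_E(t,x) = Φ_E(n h,x) + (t - n h) ⨍ v(s, Φ_E(n h,x)) ds`. -/
def eulerFlow {d : ℕ} (v : ℝ → Eucl d → Eucl d) (h : ℝ) (t : ℝ) (x : Eucl d) : Eucl d :=
  eulerStep v h ⌊t / h⌋₊ (t - ⌊t / h⌋₊ * h) (eulerNode v h ⌊t / h⌋₊ x)

/-- There are constants `C t` with `C t → 0` as `t → 0`, independent of the time step, such that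
`‖Φ(t,·) - Φ_E(t,·)‖_{L^p(𝕋ᵈ)} ≤ C t |log Δt|⁻¹` for every `t ∈ [0,T]` and every time step `Δt`
that divides `[0,T]` into equal intervals; the mollification scale (for `p ≤ d`) is `√Δt`.
The case `Δt = 1`, where the right-hand side is infinite, is left out. -/
def EulerStabilityEstimate {d : ℕ} (T : ℝ) (p : ℝ≥0∞) (η : Eucl d → ℝ)
    (u Φ : ℝ → Eucl d → Eucl d) : Prop :=
  ∃ C : ℝ → ℝ, Tendsto C (𝓝[>] 0) (𝓝 0) ∧
    ∀ (M : ℕ) (Δt : ℝ), 0 < Δt → M * Δt = T → Δt ≠ 1 → ∀ t ∈ Icc 0 T,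
      eLpNorm (fun x => Φ t x - eulerFlow (eulerVelocity p η (√Δt) u) Δt t x) p (torusMeasure d)
        ≤ ENNReal.ofReal (C t * |Real.log Δt|⁻¹)

end

/-! The proof is a logarithmic Gronwall argument of Crippa–De Lellis type, run along the nodes of
the Euler scheme. Let X be a trajectory of the flow, Y_n the nodes started at the same point, D_n =
|X(nh) − Y_n|, δ = √h, and U a bound for the velocity. One step changes log(1 + D_n/δ) by at most
|D_{n+1} − D_n|/(δ + D_n), and the numerator is at most the integral of |u(s,X_s) − v(s,Y_n)| over
that step. A Lipschitz velocity would make this quotient bounded. For a Sobolev velocity the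
Lipschitz constant is replaced by a maximal function g of Du, and summation gives log(1 + D_n/δ) ≤
C(1+U) ∫ g ds (`log_dist_eulerNode_le`). The L^p norm of the right side in x is bounded uniformly in
h, since the maximal operator is bounded on L^p (`lintegral_dyadicMax_rpow_le`) and g is evaluated
along maps that concentrate volume by at most a fixed factor (`exists_eLpNorm_lintegral_comp_le`).

The difference quotients come from differentiating η_r ∗ v along segments in scale and position. The
derivative of the kernel in such a direction is the divergence of a compactly supported field, so it
falls on the weak derivative.

If p > d, Morrey's inequality bounds the quotient by a maximal function of order q, d < q < p, at X
alone (`exists_sub_contRep_le`). Only the compression of the flow then matters.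

If p ≤ d, the maximal function at Y_n appears as well (`exists_sub_mollify_le_add`), so the nodes
must not concentrate volume. The step map is y + ∫ u_δ with differential I + A, where ‖A‖ ≤ h·CU/δ =
CU√h and tr A ≥ −‖div⁻‖_∞ h. Hence det(I + A) ≥ 1 + tr A − K‖A‖² ≥ 1 − Bh, and the product over at
most T/h steps stays bounded below. This is where δ = √h is used.

Finally the logarithmic bound becomes a rate (`ofReal_le_of_log_le`). Where D_n > h^(1/4), the
logarithm is at least |log h|/4, which is compared with the trivial error 2Ut. Elsewhere the error
is O(h^(1/4)), and interpolation with 2Ut gives O(√t h^(1/8)). Both are o(1)·|log h|⁻¹ as t → 0,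
uniformly in h. -/

/-! ### Maximal function: weak and strong type inequalities. -/

/-- The maximal function over dyadic radii `R / 2 ^ k`. -/
noncomputable def dyadicMax {d : ℕ} (R : ℝ) (f : Eucl d → ℝ≥0∞) (z : Eucl d) : ℝ≥0∞ :=
  ⨆ k : ℕ, (∫⁻ y in Metric.closedBall z (R / 2 ^ k), f y) /
    volume (Metric.closedBall (0 : Eucl d) (R / 2 ^ k))

theorem volume_closedBall_eq {d : ℕ} (x : Eucl d) (r : ℝ) :
    volume (Metric.closedBall x r) = volume (Metric.closedBall (0 : Eucl d) r) :=
  Measure.addHaar_closedBall_center _ _ _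

theorem volume_closedBall_mul {d : ℕ} (x : Eucl d) {c r : ℝ} (hc : 0 ≤ c) (hr : 0 ≤ r) :
    volume (Metric.closedBall x (c * r)) =
      ENNReal.ofReal (c ^ d) * volume (Metric.closedBall (0 : Eucl d) r) := by
  rw [Measure.addHaar_closedBall_mul _ _ hc hr]
  simp

theorem volume_closedBall_ne_top {d : ℕ} (x : Eucl d) (r : ℝ) :
    volume (Metric.closedBall x r) ≠ ⊤ := measure_closedBall_lt_top.ne

theorem volume_closedBall_ne_zero {d : ℕ} (x : Eucl d) {r : ℝ} (hr : 0 < r) :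
    volume (Metric.closedBall x r) ≠ 0 := (Metric.measure_closedBall_pos _ _ hr).ne'

theorem measurable_setLIntegral_closedBall {d : ℕ} {α : Type*} [MeasurableSpace α]
    {F : α → Eucl d → ℝ≥0∞} (hF : Measurable (Function.uncurry F)) (r : ℝ) :
    Measurable fun q : α × Eucl d => ∫⁻ y in Metric.closedBall q.2 r, F q.1 y := by
  have h : ∀ q : α × Eucl d, ∫⁻ y in Metric.closedBall q.2 r, F q.1 y =
      ∫⁻ y, {w : (α × Eucl d) × Eucl d | dist w.2 w.1.2 ≤ r}.indicator
        (fun w => F w.1.1 w.2) (q, y) := by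
    intro q
    rw [← lintegral_indicator Metric.isClosed_closedBall.measurableSet]
    rfl
  simp_rw [h]
  refine Measurable.lintegral_prod_right (Measurable.indicator ?_ ?_)
  · exact hF.comp (by fun_prop : Measurable fun w : (α × Eucl d) × Eucl d => (w.1.1, w.2))
  · exact measurableSet_le (by fun_prop) measurable_const

/-- The supremum is over countably many radii, so it is measurable in the parameter (later the time)
and the centre together. -/
theorem measurable_dyadicMax {d : ℕ} {α : Type*} [MeasurableSpace α]
    {F : α → Eucl d → ℝ≥0∞} (hF : Measurable (Function.uncurry F)) (R : ℝ) :
    Measurable fun q : α × Eucl d => dyadicMax R (F q.1) q.2 :=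
  Measurable.iSup fun k => (measurable_setLIntegral_closedBall hF (R / 2 ^ k)).div_const _

theorem setLIntegral_closedBall_le_dyadicMax {d : ℕ} {R r : ℝ} (hr : 0 < r) (hrR : r ≤ R)
    (f : Eucl d → ℝ≥0∞) (z : Eucl d) :
    ∫⁻ y in Metric.closedBall z r, f y ≤
      ENNReal.ofReal (2 ^ d) * volume (Metric.closedBall (0 : Eucl d) r) * dyadicMax R f z := by
  -- The next larger dyadic radius is at most twice `r`; the factor `2 ^ d` is the resulting growth
  -- of volume.
  obtain ⟨k, hk1, hk2⟩ : ∃ k : ℕ, r ≤ R / 2 ^ k ∧ R / 2 ^ k ≤ 2 * r := by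
    have hR : 0 < R := hr.trans_le hrR
    obtain ⟨k, hk1, hk2⟩ := exists_nat_pow_near (x := R / r) (y := (2 : ℝ))
      (by rwa [le_div_iff₀ hr, one_mul]) (by norm_num)
    refine ⟨k, ?_, ?_⟩
    · rw [le_div_iff₀ (by positivity)]
      rw [le_div_iff₀ hr] at hk1
      linarith
    · rw [div_le_iff₀ (by positivity)]
      rw [div_lt_iff₀ hr, pow_succ] at hk2
      linarith
  have hpos : 0 < R / 2 ^ k := hr.trans_le hk1
  calc ∫⁻ y in Metric.closedBall z r, f y
      ≤ ∫⁻ y in Metric.closedBall z (R / 2 ^ k), f y :=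
        lintegral_mono_set (Metric.closedBall_subset_closedBall hk1)
    _ = volume (Metric.closedBall (0 : Eucl d) (R / 2 ^ k)) *
        ((∫⁻ y in Metric.closedBall z (R / 2 ^ k), f y) /
          volume (Metric.closedBall (0 : Eucl d) (R / 2 ^ k))) := by
        rw [ENNReal.mul_div_cancel (volume_closedBall_ne_zero _ hpos)
          (volume_closedBall_ne_top _ _)]
    _ ≤ volume (Metric.closedBall (0 : Eucl d) (2 * r)) * dyadicMax R f z := by
        gcongr
        exact le_iSup (fun k : ℕ => (∫⁻ y in Metric.closedBall z (R / 2 ^ k), f y) /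
          volume (Metric.closedBall (0 : Eucl d) (R / 2 ^ k))) k
    _ = _ := by rw [volume_closedBall_mul _ (by norm_num) (by positivity)]

theorem mul_volume_dyadicMax_le {d : ℕ} {R : ℝ} (hR : 0 < R) (f : Eucl d → ℝ≥0∞)
    (c : ℝ≥0∞) :
    c * volume {z | c < dyadicMax R f z} ≤ ENNReal.ofReal (4 ^ d) * ∫⁻ y, f y := by
  have hk : ∀ z : Eucl d, ∃ k : ℕ, c < dyadicMax R f z →
      c * volume (Metric.closedBall (0 : Eucl d) (R / 2 ^ k)) ≤
        ∫⁻ y in Metric.closedBall z (R / 2 ^ k), f y := by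
    intro z
    by_cases hz : c < dyadicMax R f z
    · obtain ⟨k, hk⟩ := lt_iSup_iff.1 hz
      exact ⟨k, fun _ => (ENNReal.le_div_iff_mul_le
        (Or.inl (volume_closedBall_ne_zero _ (by positivity)))
        (Or.inl (volume_closedBall_ne_top _ _))).1 hk.le⟩
    · exact ⟨0, fun h => absurd h hz⟩
  choose k hk using hk
  -- Vitali covering: disjoint balls whose fourfold enlargements cover the level set. Any factor
  -- above 3 would do; 4 gives the constant `4 ^ d`.
  obtain ⟨u, hut, hdisj, hcov⟩ :=
    Vitali.exists_disjoint_subfamily_covering_enlargement_closedBall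
      {z | c < dyadicMax R f z} (fun z => z) (fun z => R / 2 ^ k z) R
      (fun z _ => div_le_self hR.le (one_le_pow₀ (by norm_num))) 4 (by norm_num)
  have hcount : u.Countable := hdisj.countable_of_nonempty_interior fun z _ => by
    rw [interior_closedBall _ (by positivity)]
    exact Metric.nonempty_ball.2 (by positivity)
  have hsub : {z | c < dyadicMax R f z} ⊆
      ⋃ b ∈ u, Metric.closedBall b (4 * (R / 2 ^ k b)) := by
    intro z hz
    obtain ⟨b, hb, hzb⟩ := hcov z hz
    exact mem_iUnion₂.2 ⟨b, hb, hzb (Metric.mem_closedBall_self (by positivity))⟩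
  calc c * volume {z | c < dyadicMax R f z}
      ≤ c * ∑' b : u, volume (Metric.closedBall (b : Eucl d) (4 * (R / 2 ^ k b))) := by
        gcongr
        exact (measure_mono hsub).trans (measure_biUnion_le _ hcount _)
    _ = ENNReal.ofReal (4 ^ d) *
        ∑' b : u, c * volume (Metric.closedBall (0 : Eucl d) (R / 2 ^ k b)) := by
        rw [← ENNReal.tsum_mul_left, ← ENNReal.tsum_mul_left]
        congr 1 with b
        rw [volume_closedBall_mul _ (by norm_num) (by positivity)]
        ring
    _ ≤ ENNReal.ofReal (4 ^ d) *
        ∑' b : u, ∫⁻ y in Metric.closedBall (b : Eucl d) (R / 2 ^ k b), f y := by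
        gcongr with b
        exact hk b (hut b.2)
    _ = ENNReal.ofReal (4 ^ d) *
        ∫⁻ y in ⋃ b ∈ u, Metric.closedBall (b : Eucl d) (R / 2 ^ k b), f y := by
        rw [lintegral_biUnion hcount (fun b _ => Metric.isClosed_closedBall.measurableSet) hdisj]
    _ ≤ _ := by gcongr; exact Measure.restrict_le_self

/-- The layer-cake formula for a single number, obtained from the one for functions by taking a
Dirac mass. The value `⊤` is reached by comparison with all finite values. -/
theorem ENNReal.rpow_eq_lintegral_Ioi (a : ℝ≥0∞) {s : ℝ} (hs : 0 < s) :
    a ^ s = ENNReal.ofReal s *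
      ∫⁻ t in Ioi (0 : ℝ), {t : ℝ | ENNReal.ofReal t < a}.indicator
        (fun t => ENNReal.ofReal (t ^ (s - 1))) t := by
  have key : ∀ b : ℝ, 0 ≤ b → (ENNReal.ofReal b) ^ s = ENNReal.ofReal s *
      ∫⁻ t in Ioi (0 : ℝ), {t : ℝ | ENNReal.ofReal t < ENNReal.ofReal b}.indicator
        (fun t => ENNReal.ofReal (t ^ (s - 1))) t := by
    intro b hb
    have h := lintegral_rpow_eq_lintegral_meas_lt_mul (Measure.dirac ()) (f := fun _ => b)
      (Eventually.of_forall fun _ => hb) aemeasurable_const hs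
    simp only [lintegral_dirac] at h
    rw [ENNReal.ofReal_rpow_of_nonneg hb hs.le, h]
    congr 1
    refine setLIntegral_congr_fun measurableSet_Ioi fun t ht => ?_
    have ht' : (0 : ℝ) < t := ht
    by_cases htb : t < b
    · have : ENNReal.ofReal t < ENNReal.ofReal b := (ENNReal.ofReal_lt_ofReal_iff (ht'.trans htb)).2 htb
      simp [htb, indicator, this]
    · have : ¬ ENNReal.ofReal t < ENNReal.ofReal b := fun h =>
        htb ((ENNReal.ofReal_lt_ofReal_iff_of_nonneg ht'.le).1 h)
      simp [htb, indicator, this]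
  rcases eq_or_ne a ⊤ with rfl | ha
  · rw [ENNReal.top_rpow_of_pos hs]
    refine (ENNReal.eq_top_of_forall_nnreal_le fun r => ?_).symm
    have h1 := key ((r : ℝ) ^ s⁻¹) (by positivity)
    rw [ENNReal.ofReal_rpow_of_nonneg (by positivity) hs.le, Real.rpow_inv_rpow r.coe_nonneg hs.ne',
      ENNReal.ofReal_coe_nnreal] at h1
    rw [h1]
    gcongr
    exact le_top
  · have := key a.toReal ENNReal.toReal_nonneg
    rwa [ENNReal.ofReal_toReal ha] at this

theorem dyadicMax_le_add {d : ℕ} {R : ℝ} (hR : 0 < R) {f g : Eucl d → ℝ≥0∞} (c : ℝ≥0∞)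
    (h : ∀ y, f y ≤ c + g y) (z : Eucl d) : dyadicMax R f z ≤ c + dyadicMax R g z := by
  refine iSup_le fun k => ?_
  have h0 := volume_closedBall_ne_zero (0 : Eucl d) (r := R / 2 ^ k) (by positivity)
  calc (∫⁻ y in Metric.closedBall z (R / 2 ^ k), f y) /
        volume (Metric.closedBall (0 : Eucl d) (R / 2 ^ k))
      ≤ (∫⁻ y in Metric.closedBall z (R / 2 ^ k), (c + g y)) /
        volume (Metric.closedBall (0 : Eucl d) (R / 2 ^ k)) := by
        gcongr with y; exact h y
    _ = c + (∫⁻ y in Metric.closedBall z (R / 2 ^ k), g y) /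
        volume (Metric.closedBall (0 : Eucl d) (R / 2 ^ k)) := by
        rw [lintegral_add_left measurable_const, ENNReal.add_div, setLIntegral_const,
          volume_closedBall_eq z, ENNReal.mul_div_cancel_right h0 (volume_closedBall_ne_top _ _)]
    _ ≤ _ := by
        gcongr
        exact le_iSup (fun k : ℕ => (∫⁻ y in Metric.closedBall z (R / 2 ^ k), g y) /
          volume (Metric.closedBall (0 : Eucl d) (R / 2 ^ k))) k

/-- The part of `f` below `t / 2` contributes at most `t / 2` to every average. So the weak type
inequality may be applied at height `t / 2` to the large part of `f` only, which is what makes the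
later integral in `t` converge. -/
theorem volume_lt_dyadicMax_le {d : ℕ} {R : ℝ} (hR : 0 < R) {f : Eucl d → ℝ≥0∞}
    {t : ℝ} (ht : 0 < t) :
    volume {z | ENNReal.ofReal t < dyadicMax R f z} ≤ ENNReal.ofReal (2 * 4 ^ d / t) *
      ∫⁻ y, {y | ENNReal.ofReal t < 2 * f y}.indicator f y := by
  set g := {y | ENNReal.ofReal t < 2 * f y}.indicator f
  have hfg : ∀ y, f y ≤ ENNReal.ofReal (t / 2) + g y := by
    intro y
    by_cases hy : ENNReal.ofReal t < 2 * f y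
    · simp only [g, indicator, mem_ofPred_eq, hy, if_true]
      exact le_add_self
    · simp only [g, indicator, mem_ofPred_eq, hy, if_false, add_zero]
      rw [ENNReal.ofReal_div_of_pos two_pos, ENNReal.le_div_iff_mul_le (by simp) (by simp)]
      simpa [mul_comm] using hy
  have hsub : {z | ENNReal.ofReal t < dyadicMax R f z} ⊆
      {z | ENNReal.ofReal (t / 2) < dyadicMax R g z} := by
    intro z hz
    by_contra hcon
    have h1 : dyadicMax R g z ≤ ENNReal.ofReal (t / 2) := not_lt.1 hcon
    have h2 := (dyadicMax_le_add hR _ hfg z).trans (add_le_add_right h1 (ENNReal.ofReal (t / 2)))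
    rw [← ENNReal.ofReal_add (by positivity) (by positivity), add_halves] at h2
    exact absurd hz (not_lt.2 h2)
  have hw := mul_volume_dyadicMax_le hR g (ENNReal.ofReal (t / 2))
  have ht2 : ENNReal.ofReal (t / 2) ≠ 0 := by simpa using ht
  calc volume {z | ENNReal.ofReal t < dyadicMax R f z}
      ≤ volume {z | ENNReal.ofReal (t / 2) < dyadicMax R g z} := measure_mono hsub
    _ ≤ (ENNReal.ofReal (4 ^ d) * ∫⁻ y, g y) / ENNReal.ofReal (t / 2) := by
        rw [ENNReal.le_div_iff_mul_le (Or.inl ht2) (Or.inl ENNReal.ofReal_ne_top), mul_comm]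
        exact hw
    _ = _ := by
        rw [show 2 * 4 ^ d / t = 4 ^ d / (t / 2) by field_simp,
          ENNReal.ofReal_div_of_pos (show 0 < t / 2 by positivity), ENNReal.div_eq_inv_mul,
          ENNReal.div_eq_inv_mul, mul_assoc]

/-- The strong type `(s, s)` inequality for the maximal function. -/
theorem lintegral_dyadicMax_rpow_le (d : ℕ) {s : ℝ} (hs : 1 < s) :
    ∃ C : ℝ≥0∞, C ≠ ⊤ ∧ ∀ (R : ℝ), 0 < R → ∀ f : Eucl d → ℝ≥0∞, Measurable f →
      ∫⁻ z, dyadicMax R f z ^ s ≤ C * ∫⁻ z, f z ^ s := by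
  -- The factor `s` is from the layer-cake formula, `2 * 4 ^ d` from the truncated weak type bound,
  -- and the last factor from integrating `t ^ (s - 2)` up to `2 * f z`.
  refine ⟨ENNReal.ofReal (s * (2 * 4 ^ d)) * (2 ^ (s - 1) / ENNReal.ofReal (s - 1)), ?_, ?_⟩
  · refine ENNReal.mul_ne_top ENNReal.ofReal_ne_top (ENNReal.div_ne_top ?_ ?_)
    · exact ENNReal.rpow_ne_top_of_nonneg (by linarith) (by simp)
    · simpa using hs
  intro R hR f hf
  have hM : Measurable (dyadicMax R f) := by
    have := (measurable_dyadicMax (α := Unit) (F := fun _ => f)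
      (hf.comp measurable_snd) R).comp (measurable_prodMk_left (x := ()))
    exact this
  have hs0 : 0 < s := by linarith
  have swap : ∀ (w : Eucl d → ℝ≥0∞) (h : Eucl d → ℝ≥0∞) (e : ℝ), Measurable w → Measurable h →
      ∫⁻ z, w z * ∫⁻ t in Ioi (0 : ℝ), {t : ℝ | ENNReal.ofReal t < h z}.indicator
        (fun t => ENNReal.ofReal (t ^ e)) t =
      ∫⁻ t in Ioi (0 : ℝ), ENNReal.ofReal (t ^ e) *
        ∫⁻ z, {z | ENNReal.ofReal t < h z}.indicator w z := by
    intro w h e hw hh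
    have hmeas : Measurable fun q : Eucl d × ℝ => w q.1 *
        {t : ℝ | ENNReal.ofReal t < h q.1}.indicator (fun t => ENNReal.ofReal (t ^ e)) q.2 := by
      refine (hw.comp measurable_fst).mul ?_
      have : Measurable ({q : Eucl d × ℝ | ENNReal.ofReal q.2 < h q.1}.indicator
          (fun q => ENNReal.ofReal (q.2 ^ e))) :=
        Measurable.indicator (by fun_prop) (measurableSet_lt (by fun_prop) (by fun_prop))
      exact this
    have h1 : ∀ z, w z * ∫⁻ t in Ioi (0 : ℝ), {t : ℝ | ENNReal.ofReal t < h z}.indicator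
        (fun t => ENNReal.ofReal (t ^ e)) t =
        ∫⁻ t in Ioi (0 : ℝ), w z * {t : ℝ | ENNReal.ofReal t < h z}.indicator
        (fun t => ENNReal.ofReal (t ^ e)) t := fun z =>
      (lintegral_const_mul _ (Measurable.indicator (by fun_prop)
        (measurableSet_lt (by fun_prop) measurable_const))).symm
    simp_rw [h1]
    rw [lintegral_lintegral_swap hmeas.aemeasurable]
    refine lintegral_congr fun t => ?_
    rw [← lintegral_const_mul _ (hw.indicator (measurableSet_lt measurable_const hh))]
    refine lintegral_congr fun z => ?_
    by_cases hz : ENNReal.ofReal t < h z <;> simp [indicator, hz, mul_comm]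
  calc ∫⁻ z, dyadicMax R f z ^ s
      = ENNReal.ofReal s * ∫⁻ t in Ioi (0 : ℝ), ENNReal.ofReal (t ^ (s - 1)) *
          ∫⁻ z, {z | ENNReal.ofReal t < dyadicMax R f z}.indicator 1 z := by
        rw [← swap 1 _ (s - 1) measurable_one hM, ← lintegral_const_mul']
        · refine lintegral_congr fun z => ?_
          rw [ENNReal.rpow_eq_lintegral_Ioi _ hs0]
          simp
        · exact ENNReal.ofReal_ne_top
    _ ≤ ENNReal.ofReal s * ∫⁻ t in Ioi (0 : ℝ), ENNReal.ofReal (2 * 4 ^ d) *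
          (ENNReal.ofReal (t ^ (s - 1 - 1)) *
          ∫⁻ z, {z | ENNReal.ofReal t < 2 * f z}.indicator f z) := by
        gcongr ENNReal.ofReal s * ?_
        refine setLIntegral_mono' measurableSet_Ioi fun t ht => ?_
        have ht' : (0 : ℝ) < t := ht
        rw [lintegral_indicator_one (measurableSet_lt measurable_const hM)]
        calc _ ≤ ENNReal.ofReal (t ^ (s - 1)) * (ENNReal.ofReal (2 * 4 ^ d / t) *
              ∫⁻ y, {y | ENNReal.ofReal t < 2 * f y}.indicator f y) := by
              gcongr
              exact volume_lt_dyadicMax_le hR ht'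
          _ = _ := by
              rw [← mul_assoc, ← mul_assoc, ← ENNReal.ofReal_mul (by positivity),
                ← ENNReal.ofReal_mul (by positivity), Real.rpow_sub_one ht'.ne' (s - 1)]
              congr 2
              ring
    _ = ENNReal.ofReal (s * (2 * 4 ^ d)) * ∫⁻ z, f z * ∫⁻ t in Ioi (0 : ℝ),
          {t : ℝ | ENNReal.ofReal t < 2 * f z}.indicator
            (fun t => ENNReal.ofReal (t ^ (s - 1 - 1))) t := by
        rw [lintegral_const_mul' _ _ ENNReal.ofReal_ne_top, swap f _ _ hf (hf.const_mul 2),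
          ENNReal.ofReal_mul hs0.le, mul_assoc]
    _ = ENNReal.ofReal (s * (2 * 4 ^ d)) * ∫⁻ z,
          (2 ^ (s - 1) / ENNReal.ofReal (s - 1)) * f z ^ s := by
        congr 1
        refine lintegral_congr fun z => ?_
        have h1 := ENNReal.rpow_eq_lintegral_Ioi (2 * f z) (s := s - 1) (by linarith)
        have h2 : ENNReal.ofReal (s - 1) ≠ 0 := by simpa using hs
        rw [(ENNReal.eq_div_iff h2 ENNReal.ofReal_ne_top).2 h1.symm, ENNReal.mul_rpow_of_nonneg _ _ (by linarith)]
        have h3 : f z ^ s = f z * f z ^ (s - 1) := by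
          conv_lhs => rw [show s = 1 + (s - 1) by ring,
            ENNReal.rpow_add_of_nonneg _ _ zero_le_one (by linarith), ENNReal.rpow_one]
        rw [h3, ENNReal.div_eq_inv_mul, ENNReal.div_eq_inv_mul]
        ring
    _ = _ := by
        rw [lintegral_const_mul _ (hf.pow_const s), mul_assoc]

/-! ### Mollification: derivatives in scale and position. -/

/-- The rescaled mollifier `η_r(z) = r⁻ᵈ η(z / r)`. -/
noncomputable def scaledKernel {d : ℕ} (η : Eucl d → ℝ) (r : ℝ) (z : Eucl d) : ℝ :=
  (r ^ d)⁻¹ * η (r⁻¹ • z)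

section Kernel

variable {d : ℕ} {η : Eucl d → ℝ}

theorem mollify_eq_integral_sub (η : Eucl d → ℝ) (r : ℝ) (v : Eucl d → Eucl d) (x : Eucl d) :
    mollify η r v x = ∫ y, scaledKernel η r (x - y) • v y := by
  rw [mollify, ← integral_sub_left_eq_self _ volume x]
  simp [scaledKernel]

theorem scaledKernel_nonneg (hη : IsStandardMollifier η) {r : ℝ} (hr : 0 < r) (z : Eucl d) :
    0 ≤ scaledKernel η r z :=
  mul_nonneg (by positivity) (hη.nonneg _)

theorem scaledKernel_eq_zero (hη : IsStandardMollifier η) {r : ℝ} (hr : 0 < r) {z : Eucl d}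
    (hz : r < ‖z‖) : scaledKernel η r z = 0 := by
  have : r⁻¹ • z ∉ tsupport η := fun h => by
    have h1 := hη.support h
    rw [mem_closedBall_zero_iff, norm_smul, norm_inv, Real.norm_of_nonneg hr.le,
      inv_mul_le_iff₀ hr, mul_one] at h1
    linarith
  rw [scaledKernel, image_eq_zero_of_notMem_tsupport this, mul_zero]

theorem contDiff_scaledKernel (hη : IsStandardMollifier η) (r : ℝ) :
    ContDiff ℝ ∞ (scaledKernel η r) :=
  contDiff_const.mul (hη.smooth.comp (contDiff_const_smul _))

theorem hasCompactSupport_scaledKernel (hη : IsStandardMollifier η) {r : ℝ} (hr : 0 < r) :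
    HasCompactSupport (scaledKernel η r) :=
  HasCompactSupport.of_support_subset_isCompact (isCompact_closedBall (0 : Eucl d) r)
    fun z hz => by
      by_contra h
      rw [mem_closedBall_zero_iff, not_le] at h
      exact hz (scaledKernel_eq_zero hη hr h)

theorem integral_scaledKernel (hη : IsStandardMollifier η) {r : ℝ} (hr : 0 < r) :
    ∫ z, scaledKernel η r z = 1 := by
  simp only [scaledKernel]
  rw [integral_const_mul, Measure.integral_comp_inv_smul, hη.integral]
  simp [abs_of_pos hr, hr.ne']

theorem contDiffOn_uncurry_scaledKernel (hη : IsStandardMollifier η) :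
    ContDiffOn ℝ 1 (Function.uncurry (scaledKernel η)) (Ioi 0 ×ˢ univ) := by
  have h1 : ∀ q ∈ (Ioi (0 : ℝ) ×ˢ (univ : Set (Eucl d))), q.1 ≠ 0 := fun q hq =>
    (mem_Ioi.1 hq.1).ne'
  have h2 : ContDiff ℝ 1 η := hη.smooth.of_le (by exact_mod_cast le_top)
  have h3 : ContDiffOn ℝ 1 (fun q : ℝ × Eucl d => q.1⁻¹) (Ioi 0 ×ˢ univ) :=
    contDiff_fst.contDiffOn.inv h1
  have h4 : ContDiffOn ℝ 1 (fun q : ℝ × Eucl d => (q.1 ^ d)⁻¹) (Ioi 0 ×ˢ univ) :=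
    (contDiff_fst.pow d).contDiffOn.inv fun q hq => pow_ne_zero _ (h1 q hq)
  exact h4.mul (h2.comp_contDiffOn (h3.smul contDiff_snd.contDiffOn))

theorem differentiableAt_uncurry_scaledKernel (hη : IsStandardMollifier η) {r : ℝ} (hr : 0 < r)
    (z : Eucl d) : DifferentiableAt ℝ (Function.uncurry (scaledKernel η)) (r, z) :=
  ((contDiffOn_uncurry_scaledKernel hη).differentiableOn one_ne_zero).differentiableAt
    ((isOpen_Ioi.prod isOpen_univ).mem_nhds ⟨hr, mem_univ _⟩)

/-- Homogeneity of degree −d turns the scale derivative into a spatial one. The right side is the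
divergence in `z` of the field `scaledKernel η r z • (a - (b / r) • z)`, the form needed for
integration by parts. -/
theorem fderiv_uncurry_scaledKernel (hη : IsStandardMollifier η) {r : ℝ} (hr : 0 < r)
    (z a : Eucl d) (b : ℝ) :
    fderiv ℝ (Function.uncurry (scaledKernel η)) (r, z) (b, a) =
      fderiv ℝ (scaledKernel η r) z (a - (b / r) • z) - d * (b / r) * scaledKernel η r z := by
  have hd : Differentiable ℝ η := hη.smooth.differentiable (by simp)
  have h1 : HasDerivAt (fun t : ℝ => Function.uncurry (scaledKernel η) ((r, z) + t • (b, a)))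
      (fderiv ℝ (Function.uncurry (scaledKernel η)) (r, z) (b, a)) 0 := by
    have := (differentiableAt_uncurry_scaledKernel hη hr z).hasFDerivAt.hasLineDerivAt (b, a)
    exact this
  have hK : ∀ w, fderiv ℝ (scaledKernel η r) z w = (r ^ d)⁻¹ * fderiv ℝ η (r⁻¹ • z) (r⁻¹ • w) := by
    intro w
    have h := ((hd (r⁻¹ • z)).hasFDerivAt.comp z
      ((hasFDerivAt_id z).const_smul r⁻¹)).const_mul (r ^ d)⁻¹
    have h' : HasFDerivAt (scaledKernel η r) _ z := h
    rw [h'.fderiv]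
    simp
  have hl : HasDerivAt (fun t : ℝ => r + t * b) b 0 := by
    simpa using ((hasDerivAt_id (0 : ℝ)).mul_const b).const_add r
  have hz : HasDerivAt (fun t : ℝ => z + t • a) a 0 := by
    simpa using ((hasDerivAt_id (0 : ℝ)).smul_const a).const_add z
  have hinv : HasDerivAt (fun t : ℝ => (r + t * b)⁻¹) (-b / r ^ 2) 0 := by
    simpa using hl.fun_inv (by simpa using hr.ne')
  have hpow : HasDerivAt (fun t : ℝ => ((r + t * b) ^ d)⁻¹) (-(d * (b / r) * (r ^ d)⁻¹)) 0 := by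
    refine ((hl.fun_pow d).fun_inv (pow_ne_zero d (by simpa using hr.ne'))).congr_deriv ?_
    rcases d with _ | d
    · simp
    · simp only [zero_mul, add_zero, Nat.add_sub_cancel]
      field_simp
      ring
  have harg : HasDerivAt (fun t : ℝ => (r + t * b)⁻¹ • (z + t • a))
      (r⁻¹ • (a - (b / r) • z)) 0 := by
    refine (hinv.fun_smul hz).congr_deriv ?_
    simp only [zero_mul, add_zero, zero_smul, smul_sub, smul_smul, neg_div, neg_smul,
      ← sub_eq_add_neg]
    congr 2
    field_simp
  have hη1 : HasDerivAt (fun t : ℝ => η ((r + t * b)⁻¹ • (z + t • a)))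
      (fderiv ℝ η (r⁻¹ • z) (r⁻¹ • (a - (b / r) • z))) 0 := by
    have h := (hd (r⁻¹ • z)).hasFDerivAt
    refine HasFDerivAt.comp_hasDerivAt (0 : ℝ) ?_ harg
    simpa using h
  have h2 : HasDerivAt (fun t : ℝ => Function.uncurry (scaledKernel η) ((r, z) + t • (b, a)))
      _ 0 := hpow.fun_mul hη1
  rw [h1.unique h2, hK]
  simp only [scaledKernel, zero_mul, add_zero, zero_smul]
  ring

theorem fderiv_uncurry_scaledKernel_eq_zero (hη : IsStandardMollifier η) {r : ℝ} (hr : 0 < r)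
    {z : Eucl d} (hz : r < ‖z‖) : fderiv ℝ (Function.uncurry (scaledKernel η)) (r, z) = 0 := by
  have : Function.uncurry (scaledKernel η) =ᶠ[𝓝 (r, z)] fun _ => 0 := by
    have h1 : ∀ᶠ q : ℝ × Eucl d in 𝓝 (r, z), q.1 < ‖q.2‖ :=
      (isOpen_lt continuous_fst continuous_snd.norm).mem_nhds hz
    have h2 : ∀ᶠ q : ℝ × Eucl d in 𝓝 (r, z), 0 < q.1 :=
      (isOpen_lt continuous_const continuous_fst).mem_nhds hr
    filter_upwards [h1, h2] with q hq1 hq2 using scaledKernel_eq_zero hη hq2 hq1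
  rw [this.fderiv_eq]
  simp

theorem continuous_fderiv_uncurry_scaledKernel (hη : IsStandardMollifier η) {r : ℝ}
    (hr : 0 < r) :
    Continuous fun z : Eucl d => fderiv ℝ (Function.uncurry (scaledKernel η)) (r, z) := by
  have h := (contDiffOn_uncurry_scaledKernel hη).continuousOn_fderiv_of_isOpen
    (isOpen_Ioi.prod isOpen_univ) le_rfl
  exact h.comp_continuous (by fun_prop) fun z => ⟨hr, mem_univ _⟩

theorem hasCompactSupport_fderiv_uncurry_scaledKernel (hη : IsStandardMollifier η) {r : ℝ}
    (hr : 0 < r) :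
    HasCompactSupport fun z : Eucl d => fderiv ℝ (Function.uncurry (scaledKernel η)) (r, z) :=
  HasCompactSupport.of_support_subset_isCompact (isCompact_closedBall (0 : Eucl d) r)
    fun z hz => by
      by_contra h
      rw [mem_closedBall_zero_iff, not_le] at h
      exact hz (fderiv_uncurry_scaledKernel_eq_zero hη hr h)

/-- The derivative of the mollification with respect to the scale and the position. -/
theorem exists_hasFDerivAt_mollify (hη : IsStandardMollifier η) {v : Eucl d → Eucl d}
    (hv : LocallyIntegrable v) {r : ℝ} (hr : 0 < r) (x : Eucl d) :
    ∃ D : ℝ × Eucl d →L[ℝ] Eucl d,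
      HasFDerivAt (fun q : ℝ × Eucl d => mollify η q.1 v q.2) D (r, x) ∧
      ∀ w, D w = ∫ y, (fderiv ℝ (Function.uncurry (scaledKernel η)) (r, x - y) w) • v y := by
  set L : Eucl d →L[ℝ] ℝ →L[ℝ] Eucl d := (ContinuousLinearMap.lsmul ℝ ℝ).flip
  have hconv : ∀ q : ℝ × Eucl d, mollify η q.1 v q.2 =
      MeasureTheory.convolution v (scaledKernel η q.1) L volume q.2 := by
    intro q
    rw [mollify_eq_integral_sub, convolution_def]
    rfl
  have h := hasFDerivAt_convolution_right_with_param (μ := volume) L (s := Ioo 0 (r + 1))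
    (k := Metric.closedBall (0 : Eucl d) (r + 1)) isOpen_Ioo (isCompact_closedBall _ _)
    (g := scaledKernel η)
    (fun p z hp hz => by
      rw [mem_closedBall_zero_iff, not_le] at hz
      exact scaledKernel_eq_zero hη hp.1 (hp.2.trans hz)) hv
    ((contDiffOn_uncurry_scaledKernel hη).mono (prod_mono (fun p hp => hp.1) subset_rfl))
    (r, x) ⟨hr, by simp⟩
  refine ⟨_, by simpa only [hconv] using h, fun w => ?_⟩
  have hint := (hasCompactSupport_fderiv_uncurry_scaledKernel hη hr).convolutionExists_right
    (μ := volume) (L.precompR (ℝ × Eucl d)) hv (continuous_fderiv_uncurry_scaledKernel hη hr) x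
  rw [convolution_def]
  exact ContinuousLinearMap.integral_apply hint w

/-- The differentiated kernel is minus the divergence in `y` of a smooth compactly supported field.
Each component of that field is a test function for the weak derivative. -/
theorem integral_fderiv_uncurry_scaledKernel (hη : IsStandardMollifier η) {v : Eucl d → Eucl d}
    {G : Eucl d → Eucl d →L[ℝ] Eucl d} (hv : HasWeakDeriv v G) {r : ℝ} (hr : 0 < r)
    (x a : Eucl d) (b : ℝ) :
    ∫ y, (fderiv ℝ (Function.uncurry (scaledKernel η)) (r, x - y) (b, a)) • v y =
      ∫ y, scaledKernel η r (x - y) • G y (a - (b / r) • (x - y)) := by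
  set e : Fin d → Eucl d := fun i => EuclideanSpace.single i (1 : ℝ)
  -- The components of the field `scaledKernel η r (x - y) • (a - (b / r) • (x - y))`.
  set φ : Fin d → Eucl d → ℝ := fun i y => scaledKernel η r (x - y) * (a i - b / r * (x - y) i)
  have hKs := contDiff_scaledKernel hη r
  have hφs : ∀ i, ContDiff ℝ ∞ (φ i) := fun i => by
    refine (hKs.comp (contDiff_const.sub contDiff_id)).mul ?_
    have : ContDiff ℝ ∞ fun y : Eucl d => (x - y) i :=
      (EuclideanSpace.proj (𝕜 := ℝ) i).contDiff.comp (contDiff_const.sub contDiff_id)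
    exact contDiff_const.sub (contDiff_const.mul this)
  have hφc : ∀ i, HasCompactSupport (φ i) := fun i => by
    have h1 : HasCompactSupport fun y => scaledKernel η r (x - y) :=
      (hasCompactSupport_scaledKernel hη hr).comp_homeomorph (Homeomorph.subLeft x)
    exact h1.mul_right
  have hφd : ∀ i y, fderiv ℝ (φ i) y (e i) =
      -(fderiv ℝ (scaledKernel η r) (x - y) (e i) * (a i - b / r * (x - y) i)) +
        scaledKernel η r (x - y) * (b / r) := by
    intro i y
    have h0 : HasFDerivAt (fun y : Eucl d => x - y) (-ContinuousLinearMap.id ℝ (Eucl d)) y :=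
      (hasFDerivAt_id y).const_sub x
    have h1 := ((hKs.differentiable (by simp)) (x - y)).hasFDerivAt.comp y h0
    have h2 := ((EuclideanSpace.proj (𝕜 := ℝ) i).hasFDerivAt.comp y h0).const_mul (b / r)
    have h3 : HasFDerivAt (φ i) _ y := h1.mul (h2.const_sub (a i))
    rw [h3.fderiv]
    simp [e]
    ring
  have hsum : ∀ y, fderiv ℝ (Function.uncurry (scaledKernel η)) (r, x - y) (b, a) =
      -∑ i, fderiv ℝ (φ i) y (e i) := by
    intro y
    have hw : ∀ w : Eucl d, w = ∑ i, w i • e i := fun w => by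
      have := (EuclideanSpace.basisFun (Fin d) ℝ).sum_repr w
      simpa [e] using this.symm
    rw [fderiv_uncurry_scaledKernel hη hr]
    conv_lhs => rw [hw (a - (b / r) • (x - y))]
    simp only [hφd, map_sum, map_smul, Finset.sum_add_distrib, Finset.sum_neg_distrib,
      Finset.sum_const, Finset.card_univ, Fintype.card_fin, PiLp.sub_apply, PiLp.smul_apply,
      smul_eq_mul, nsmul_eq_mul, mul_comm]
    ring
  have hint1 : ∀ i, Integrable fun y => (fderiv ℝ (φ i) y (e i)) • v y := fun i => by
    refine hv.1.integrable_smul_left_of_hasCompactSupport ?_ ?_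
    · exact ((hφs i).continuous_fderiv (by simp)).clm_apply continuous_const
    · exact (hφc i).fderiv_apply ℝ (e i)
  have hint2 : ∀ i, Integrable fun y => φ i y • G y (e i) := fun i => by
    have h1 : Integrable fun y => φ i y • G y :=
      hv.2.1.integrable_smul_left_of_hasCompactSupport (hφs i).continuous (hφc i)
    exact h1.apply_continuousLinearMap (e i)
  calc ∫ y, (fderiv ℝ (Function.uncurry (scaledKernel η)) (r, x - y) (b, a)) • v y
      = ∫ y, -∑ i, (fderiv ℝ (φ i) y (e i)) • v y := by
        refine integral_congr_ae (Eventually.of_forall fun y => ?_)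
        simp only [hsum, neg_smul, Finset.sum_smul]
    _ = -∑ i, ∫ y, (fderiv ℝ (φ i) y (e i)) • v y := by
        rw [integral_neg, integral_finsetSum _ fun i _ => hint1 i]
    _ = ∑ i, ∫ y, φ i y • G y (e i) := by
        rw [← Finset.sum_neg_distrib]
        refine Finset.sum_congr rfl fun i _ => ?_
        rw [hv.2.2 (φ i) (hφs i) (hφc i) (e i), neg_neg]
    _ = ∫ y, ∑ i, φ i y • G y (e i) := (integral_finsetSum _ fun i _ => hint2 i).symm
    _ = _ := by
        refine integral_congr_ae (Eventually.of_forall fun y => ?_)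
        have hw : a - (b / r) • (x - y) = ∑ i, (a i - b / r * (x - y) i) • e i := by
          have := (EuclideanSpace.basisFun (Fin d) ℝ).sum_repr (a - (b / r) • (x - y))
          simpa [e] using this.symm
        simp only [hw, map_sum, map_smul, Finset.smul_sum, smul_smul, φ]

end Kernel

/-! ### Difference quotients of mollifications and the maximal function. -/

section Pointwise

variable {d : ℕ} {η : Eucl d → ℝ}

theorem IsStandardMollifier.exists_bound (hη : IsStandardMollifier η) :
    ∃ H : ℝ, 0 < H ∧ ∀ z, η z ≤ H := by
  have hc : HasCompactSupport η :=
    (isCompact_closedBall (0 : Eucl d) 1).of_isClosed_subset (isClosed_tsupport η) hη.support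
  obtain ⟨H, hH⟩ := hc.exists_bound_of_continuous hη.smooth.continuous
  exact ⟨max H 1, by positivity, fun z => (le_abs_self _).trans ((hH z).trans (le_max_left _ _))⟩

/-- On the support of the kernel `‖x - y‖ ≤ r`, so the vector inserted in `G y` has norm at most
`‖a‖ + |b|`, and the kernel is at most `H / r ^ d`. -/
theorem enorm_integral_scaledKernel_le (hη : IsStandardMollifier η) {H : ℝ} (hH0 : 0 < H)
    (hH : ∀ z, η z ≤ H) (G : Eucl d → Eucl d →L[ℝ] Eucl d) {r : ℝ} (hr : 0 < r)
    (x a : Eucl d) (b : ℝ) :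
    ‖∫ y, scaledKernel η r (x - y) • G y (a - (b / r) • (x - y))‖ₑ ≤
      ENNReal.ofReal (H * (‖a‖ + |b|) / r ^ d) * ∫⁻ y in Metric.closedBall x r, ‖G y‖ₑ := by
  refine (enorm_integral_le_lintegral_enorm _).trans ?_
  rw [← lintegral_const_mul' _ _ ENNReal.ofReal_ne_top,
    ← lintegral_indicator Metric.isClosed_closedBall.measurableSet]
  refine lintegral_mono fun y => ?_
  by_cases hy : y ∈ Metric.closedBall x r
  · rw [indicator_of_mem hy]
    rw [Metric.mem_closedBall, dist_eq_norm, norm_sub_rev] at hy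
    rw [← ofReal_norm, ← ofReal_norm, ← ENNReal.ofReal_mul (by positivity)]
    refine ENNReal.ofReal_le_ofReal ?_
    rw [norm_smul, Real.norm_of_nonneg (scaledKernel_nonneg hη hr _)]
    have h1 : scaledKernel η r (x - y) ≤ H / r ^ d := by
      rw [scaledKernel, div_eq_inv_mul]
      gcongr
      exact hH _
    have h2 : ‖a - (b / r) • (x - y)‖ ≤ ‖a‖ + |b| := by
      refine (norm_sub_le _ _).trans ?_
      gcongr
      rw [norm_smul, norm_div, Real.norm_of_nonneg hr.le, Real.norm_eq_abs, div_mul_eq_mul_div]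
      rw [div_le_iff₀ hr]
      gcongr
    calc scaledKernel η r (x - y) * ‖G y (a - (b / r) • (x - y))‖
        ≤ H / r ^ d * (‖G y‖ * (‖a‖ + |b|)) := by
          gcongr
          exact (G y).le_opNorm_of_le h2
      _ = _ := by ring
  · rw [Metric.mem_closedBall, dist_eq_norm, norm_sub_rev, not_le] at hy
    simp [scaledKernel_eq_zero hη hr hy]

/-- The derivative of the mollification of a weakly differentiable function along a line in
scale and position. -/
theorem hasDerivAt_mollify_line (hη : IsStandardMollifier η) {H : ℝ} (hH0 : 0 < H)
    (hH : ∀ z, η z ≤ H) {v : Eucl d → Eucl d} {G : Eucl d → Eucl d →L[ℝ] Eucl d}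
    (hv : HasWeakDeriv v G) (x a : Eucl d) (r b t : ℝ) (hr : 0 < r + t * b) :
    ∃ D : Eucl d, HasDerivAt (fun t : ℝ => mollify η (r + t * b) v (x + t • a)) D t ∧
      ‖D‖ₑ ≤ ENNReal.ofReal (H * (‖a‖ + |b|) / (r + t * b) ^ d) *
        ∫⁻ y in Metric.closedBall (x + t • a) (r + t * b), ‖G y‖ₑ := by
  obtain ⟨D, hD, hD'⟩ := exists_hasFDerivAt_mollify hη hv.1 hr (x + t • a)
  refine ⟨D (b, a), ?_, ?_⟩
  · have h1 : HasDerivAt (fun t : ℝ => (r + t * b, x + t • a)) (b, a) t := by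
      refine HasDerivAt.prodMk ?_ ?_
      · simpa using ((hasDerivAt_id t).mul_const b).const_add r
      · simpa using ((hasDerivAt_id t).smul_const a).const_add x
    exact HasFDerivAt.comp_hasDerivAt (f := fun t : ℝ => (r + t * b, x + t • a)) t hD h1
  · rw [hD', integral_fderiv_uncurry_scaledKernel hη hv hr]
    exact enorm_integral_scaledKernel_le hη hH0 hH G hr _ _ _

theorem volume_closedBall_eq_mul {r : ℝ} (hr : 0 ≤ r) (x : Eucl d) :
    volume (Metric.closedBall x r) =
      ENNReal.ofReal (r ^ d) * volume (Metric.closedBall (0 : Eucl d) 1) := by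
  have := volume_closedBall_mul x hr (zero_le_one (α := ℝ))
  rwa [mul_one] at this

theorem setLIntegral_le_rpow_mul {α : Type*} [MeasurableSpace α] {μ : Measure α}
    {W : α → ℝ≥0∞} (hW : Measurable W) (A : Set α) {q : ℝ} (hq : 1 ≤ q) :
    ∫⁻ y in A, W y ∂μ ≤ (∫⁻ y in A, W y ^ q ∂μ) ^ (1 / q) * μ A ^ (1 - 1 / q) := by
  have := eLpNorm'_le_eLpNorm'_mul_rpow_measure_univ (f := W) (μ := μ.restrict A) one_pos hq
    hW.aestronglyMeasurable
  simpa [eLpNorm'] using this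

/-- The maximal function of order `q`. -/
noncomputable def maxPow {d : ℕ} (R q : ℝ) (W : Eucl d → ℝ≥0∞) (z : Eucl d) : ℝ≥0∞ :=
  dyadicMax R (fun y => W y ^ q) z ^ (1 / q)

theorem setLIntegral_rpow_closedBall_le {R q : ℝ} (hq : 1 ≤ q) {r : ℝ} (hr : 0 < r)
    (hrR : r ≤ R) (W : Eucl d → ℝ≥0∞) (z : Eucl d) :
    (∫⁻ y in Metric.closedBall z r, W y ^ q) ^ (1 / q) ≤
      (ENNReal.ofReal (2 ^ d) * volume (Metric.closedBall (0 : Eucl d) r)) ^ (1 / q) *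
        maxPow R q W z := by
  rw [maxPow, ← ENNReal.mul_rpow_of_nonneg _ _ (by positivity)]
  gcongr
  exact setLIntegral_closedBall_le_dyadicMax hr hrR _ z

/-- Hölder's inequality on the ball: the powers of its volume recombine to exponent 1, and `2 ^ (d /
q) ≤ 2 ^ d`. -/
theorem setLIntegral_closedBall_le_maxPow {R q : ℝ} (hq : 1 ≤ q) {r : ℝ} (hr : 0 < r)
    (hrR : r ≤ R) {W : Eucl d → ℝ≥0∞} (hW : Measurable W) (z : Eucl d) :
    ∫⁻ y in Metric.closedBall z r, W y ≤
      ENNReal.ofReal (2 ^ d) * volume (Metric.closedBall (0 : Eucl d) r) * maxPow R q W z := by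
  set V := volume (Metric.closedBall (0 : Eucl d) r)
  have hV0 : V ≠ 0 := volume_closedBall_ne_zero _ hr
  have hVt : V ≠ ⊤ := volume_closedBall_ne_top _ _
  have hq' : 1 / q ≤ 1 := by rw [div_le_one (by linarith)]; exact hq
  calc ∫⁻ y in Metric.closedBall z r, W y
      ≤ (∫⁻ y in Metric.closedBall z r, W y ^ q) ^ (1 / q) * V ^ (1 - 1 / q) := by
        have := setLIntegral_le_rpow_mul (μ := volume) hW (Metric.closedBall z r) hq
        rwa [volume_closedBall_eq z] at this
    _ ≤ ((ENNReal.ofReal (2 ^ d) * V) ^ (1 / q) * maxPow R q W z) * V ^ (1 - 1 / q) := by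
        gcongr
        exact setLIntegral_rpow_closedBall_le hq hr hrR W z
    _ = ENNReal.ofReal (2 ^ d) ^ (1 / q) * (V ^ (1 / q) * V ^ (1 - 1 / q)) * maxPow R q W z := by
        rw [ENNReal.mul_rpow_of_nonneg _ _ (by positivity)]
        ring
    _ ≤ _ := by
        rw [← ENNReal.rpow_add _ _ hV0 hVt, add_sub_cancel, ENNReal.rpow_one]
        gcongr
        refine (ENNReal.rpow_le_rpow_of_exponent_le ?_ hq').trans_eq (ENNReal.rpow_one _)
        rw [ENNReal.one_le_ofReal]
        exact one_le_pow₀ (by norm_num)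

/-- Mollifications at comparable points and scales differ by at most a multiple of the scale
times the maximal function of the weak derivative. -/
theorem exists_mollify_sub_mollify_le (hη : IsStandardMollifier η) :
    ∃ C : ℝ, 0 < C ∧ ∀ (v : Eucl d → Eucl d) (G : Eucl d → Eucl d →L[ℝ] Eucl d)
      (W : Eucl d → ℝ≥0∞) (R q r r₀ : ℝ) (y z : Eucl d), HasWeakDeriv v G → Measurable W →
      1 ≤ q → 0 < r₀ → r₀ ≤ r → 2 * r ≤ R → dist y z ≤ r →
      (∀ᵐ x, x ∈ Metric.closedBall z (2 * r) → ‖G x‖ₑ ≤ W x) →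
      ‖mollify η r v y - mollify η r₀ v z‖ₑ ≤ ENNReal.ofReal (C * r) * maxPow R q W z := by
  obtain ⟨H, hH0, hH⟩ := hη.exists_bound
  set V := (volume (Metric.closedBall (0 : Eucl d) 1)).toReal
  have hV : ENNReal.ofReal V = volume (Metric.closedBall (0 : Eucl d) 1) :=
    ENNReal.ofReal_toReal (volume_closedBall_ne_top _ _)
  have hV0 : 0 < V := ENNReal.toReal_pos (volume_closedBall_ne_zero _ one_pos)
    (volume_closedBall_ne_top _ _)
  -- `H` bounds the mollifier, 2 comes from `‖y - z‖ + |r - r₀| ≤ 2 * r`, one `2 ^ d` from doubling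
  -- the ball and the other from passing to dyadic radii.
  refine ⟨H * 2 * (2 ^ d * 2 ^ d * V), by positivity, ?_⟩
  intro v G W R q r r₀ y z hv hW hq hr₀ hr hR hyz hG
  have hrpos : 0 < r := hr₀.trans_le hr
  rcases eq_or_ne (maxPow R q W z) ⊤ with htop | htop
  · rw [htop, ENNReal.mul_top (by simpa using by positivity)]
    exact le_top
  have hpos : ∀ t ∈ Icc (0 : ℝ) 1, 0 < r₀ + t * (r - r₀) := fun t ht => by
    nlinarith [mul_nonneg ht.1 (sub_nonneg.2 hr)]
  choose! D hD1 hD2 using fun t (ht : t ∈ Icc (0 : ℝ) 1) =>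
    hasDerivAt_mollify_line hη hH0 hH hv z (y - z) r₀ (r - r₀) t (hpos t ht)
  have hbound : ∀ t ∈ Ico (0 : ℝ) 1,
      ‖D t‖ ≤ H * 2 * (2 ^ d * 2 ^ d * V) * r * (maxPow R q W z).toReal := by
    intro t ht
    have ht' : t ∈ Icc (0 : ℝ) 1 := ⟨ht.1, ht.2.le⟩
    set ρ := r₀ + t * (r - r₀) with hρ
    have hρ0 : 0 < ρ := hpos t ht'
    have hρr : ρ ≤ r := by nlinarith [ht'.2]
    have htr : t * r ≤ ρ := by nlinarith [ht'.2]
    -- Along the segment in scale and position the centre has moved from `z` by at most `t * r ≤ ρ`.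
    -- All averages are therefore controlled by balls around `z`, and only the maximal function at
    -- `z` appears.
    have hsub : Metric.closedBall (z + t • (y - z)) ρ ⊆ Metric.closedBall z (2 * ρ) := by
      refine Metric.closedBall_subset_closedBall' ?_
      rw [dist_eq_norm, add_sub_cancel_left, norm_smul, Real.norm_of_nonneg ht.1, ← dist_eq_norm]
      nlinarith [mul_le_mul_of_nonneg_left hyz ht.1]
    have h1 : ∫⁻ x in Metric.closedBall (z + t • (y - z)) ρ, ‖G x‖ₑ ≤
        ENNReal.ofReal (2 ^ d * 2 ^ d * V * ρ ^ d) * maxPow R q W z := by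
      calc ∫⁻ x in Metric.closedBall (z + t • (y - z)) ρ, ‖G x‖ₑ
          ≤ ∫⁻ x in Metric.closedBall z (2 * ρ), ‖G x‖ₑ := lintegral_mono_set hsub
        _ ≤ ∫⁻ x in Metric.closedBall z (2 * ρ), W x := by
            refine setLIntegral_mono_ae hW.aemeasurable ?_
            filter_upwards [hG] with x hx hxz
            exact hx (Metric.closedBall_subset_closedBall (show 2 * ρ ≤ 2 * r by linarith) hxz)
        _ ≤ _ := setLIntegral_closedBall_le_maxPow (R := R) hq (by positivity) (by linarith) hW z
        _ = _ := by
            rw [volume_closedBall_eq_mul (by positivity), ← hV, ← ENNReal.ofReal_mul (by positivity),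
              ← ENNReal.ofReal_mul (by positivity)]
            congr 2
            rw [mul_pow]
            ring
    have h2 : ‖D t‖ₑ ≤ ENNReal.ofReal (H * 2 * (2 ^ d * 2 ^ d * V) * r) * maxPow R q W z := by
      calc ‖D t‖ₑ ≤ ENNReal.ofReal (H * (‖y - z‖ + |r - r₀|) / ρ ^ d) *
            (ENNReal.ofReal (2 ^ d * 2 ^ d * V * ρ ^ d) * maxPow R q W z) := by
            refine (hD2 t ht').trans ?_
            gcongr
        _ = ENNReal.ofReal (H * (‖y - z‖ + |r - r₀|) * (2 ^ d * 2 ^ d * V)) *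
            maxPow R q W z := by
            rw [← mul_assoc, ← ENNReal.ofReal_mul (by positivity)]
            congr 2
            field_simp
        _ ≤ _ := by
            gcongr ENNReal.ofReal ?_ * _
            rw [← dist_eq_norm, abs_of_nonneg (sub_nonneg.2 hr)]
            have : dist y z + (r - r₀) ≤ 2 * r := by linarith
            calc H * (dist y z + (r - r₀)) * (2 ^ d * 2 ^ d * V)
                ≤ H * (2 * r) * (2 ^ d * 2 ^ d * V) := by gcongr
              _ = _ := by ring
    rw [← toReal_enorm]
    refine (ENNReal.toReal_mono (ENNReal.mul_ne_top ENNReal.ofReal_ne_top htop) h2).trans_eq ?_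
    rw [ENNReal.toReal_mul, ENNReal.toReal_ofReal (by positivity)]
  have hfin := norm_image_sub_le_of_norm_deriv_le_segment_01'
    (fun t ht => (hD1 t ht).hasDerivWithinAt) hbound
  simp only [one_mul, zero_mul, one_smul, zero_smul, add_zero, add_sub_cancel] at hfin
  rw [← ofReal_norm, ← ENNReal.ofReal_toReal htop, ← ENNReal.ofReal_mul (by positivity)]
  exact ENNReal.ofReal_le_ofReal hfin

/-- Mollifications at one point and different scales, for a weak derivative in `L^q`, `q > d`. -/
theorem exists_mollify_scale_le (hη : IsStandardMollifier η) {q : ℝ} (hq1 : 1 ≤ q)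
    (hqd : (d : ℝ) < q) :
    ∃ C : ℝ, 0 < C ∧ ∀ (v : Eucl d → Eucl d) (G : Eucl d → Eucl d →L[ℝ] Eucl d)
      (W : Eucl d → ℝ≥0∞) (K : ℝ≥0∞) (r r₀ : ℝ) (y : Eucl d), HasWeakDeriv v G → Measurable W →
      0 < r₀ → r₀ ≤ r → (∀ᵐ x, x ∈ Metric.closedBall y r → ‖G x‖ₑ ≤ W x) →
      (∫⁻ x in Metric.closedBall y r, W x ^ q) ^ (1 / q) ≤ K →
      ‖mollify η r v y - mollify η r₀ v y‖ₑ ≤ ENNReal.ofReal (C * r ^ (1 - d / q)) * K := by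
  obtain ⟨H, hH0, hH⟩ := hη.exists_bound
  set V := (volume (Metric.closedBall (0 : Eucl d) 1)).toReal
  have hV : ENNReal.ofReal V = volume (Metric.closedBall (0 : Eucl d) 1) :=
    ENNReal.ofReal_toReal (volume_closedBall_ne_top _ _)
  have hV0 : 0 < V := ENNReal.toReal_pos (volume_closedBall_ne_zero _ one_pos)
    (volume_closedBall_ne_top _ _)
  have hq0 : 0 < q := by linarith
  set α := 1 - d / q with hα
  have hα0 : 0 < α := by rw [hα, sub_pos, div_lt_one hq0]; exact hqd
  refine ⟨H * V ^ (1 - 1 / q) / α, by positivity, ?_⟩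
  intro v G W K r r₀ y hv hW hr₀ hr hG hK
  have hrpos : 0 < r := hr₀.trans_le hr
  rcases eq_or_ne K ⊤ with htop | htop
  · rw [htop, ENNReal.mul_top (by simpa using by positivity)]
    exact le_top
  -- Only the scale varies here. The derivative is at most a multiple of `s ^ (-d)` times the
  -- integral of `W` over a ball of radius `s`; by Hölder this is of order `s ^ (α - 1)`, integrable
  -- at 0 because `q > d`.
  choose! D hD1 hD2 using fun s (hs : 0 < s) =>
    hasDerivAt_mollify_line hη hH0 hH hv y 0 0 1 s (by simpa using hs)
  simp only [smul_zero, add_zero, zero_add, mul_one, norm_zero, abs_one] at hD1 hD2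
  set A := H * V ^ (1 - 1 / q) * K.toReal
  have hbound : ∀ s ∈ Ico r₀ r, ‖D s‖ ≤ A * s ^ (α - 1) := by
    intro s hs
    have hs0 : 0 < s := hr₀.trans_le hs.1
    have hsub : Metric.closedBall y s ⊆ Metric.closedBall y r :=
      Metric.closedBall_subset_closedBall hs.2.le
    have h1 : ∫⁻ x in Metric.closedBall y s, ‖G x‖ₑ ≤
        K * ENNReal.ofReal ((s ^ d * V) ^ (1 - 1 / q)) := by
      calc ∫⁻ x in Metric.closedBall y s, ‖G x‖ₑ
          ≤ ∫⁻ x in Metric.closedBall y s, W x := by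
            refine setLIntegral_mono_ae hW.aemeasurable ?_
            filter_upwards [hG] with x hx hxz using hx (hsub hxz)
        _ ≤ (∫⁻ x in Metric.closedBall y s, W x ^ q) ^ (1 / q) *
            volume (Metric.closedBall y s) ^ (1 - 1 / q) :=
            setLIntegral_le_rpow_mul hW _ hq1
        _ ≤ _ := by
            have hq' : 1 / q ≤ 1 := by rw [div_le_one hq0]; exact hq1
            rw [volume_closedBall_eq_mul hs0.le, ← hV, ← ENNReal.ofReal_mul (by positivity),
              ENNReal.ofReal_rpow_of_nonneg (by positivity) (by linarith)]
            gcongr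
            refine le_trans ?_ hK
            gcongr
    have h2 := (hD2 s hs0).trans (mul_le_mul_right h1 _)
    rw [← toReal_enorm]
    refine (ENNReal.toReal_mono (by finiteness) h2).trans_eq ?_
    rw [ENNReal.toReal_mul, ENNReal.toReal_mul, ENNReal.toReal_ofReal (by positivity),
      ENNReal.toReal_ofReal (by positivity), Real.mul_rpow (by positivity) hV0.le,
      ← Real.rpow_natCast, ← Real.rpow_mul hs0.le]
    have h3 : s ^ (α - 1) = s ^ (d * (1 - 1 / q)) / s ^ (d : ℝ) := by
      rw [← Real.rpow_sub hs0]
      congr 1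
      rw [hα]
      ring
    rw [h3]
    ring
  -- Comparison with the primitive of `A * s ^ (α - 1)` that vanishes at `r₀`.
  have hfin := image_norm_le_of_norm_deriv_right_le_deriv_boundary'
    (f := fun s => mollify η s v y - mollify η r₀ v y) (f' := D) (a := r₀) (b := r)
    (B := fun s => A * ((s ^ α - r₀ ^ α) / α)) (B' := fun s => A * s ^ (α - 1))
    (fun s hs => ((hD1 s (hr₀.trans_le hs.1)).sub_const _).continuousAt.continuousWithinAt)
    (fun s hs => ((hD1 s (hr₀.trans_le hs.1)).sub_const _).hasDerivWithinAt)
    (by simp)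
    (fun s hs => ((((Real.hasDerivAt_rpow_const (Or.inl (hr₀.trans_le hs.1).ne')).sub_const
      _).div_const α).const_mul A).continuousAt.continuousWithinAt)
    (fun s hs => by
      have := ((((Real.hasDerivAt_rpow_const (p := α) (Or.inl (hr₀.trans_le hs.1).ne')).sub_const
        (r₀ ^ α)).div_const α).const_mul A).hasDerivWithinAt (s := Ici s)
      rwa [mul_div_cancel_left₀ _ hα0.ne'] at this)
    hbound (right_mem_Icc.2 hr)
  rw [← ofReal_norm, ← ENNReal.ofReal_toReal htop, ← ENNReal.ofReal_mul (by positivity)]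
  refine ENNReal.ofReal_le_ofReal (hfin.trans ?_)
  have : 0 ≤ r₀ ^ α := by positivity
  calc A * ((r ^ α - r₀ ^ α) / α) ≤ A * (r ^ α / α) := by gcongr; linarith
    _ = _ := by ring

/-- **Morrey's inequality**, one-sided form, in terms of mollifications. -/
theorem exists_mollify_scale_le_maxPow (hη : IsStandardMollifier η) {q : ℝ} (hq1 : 1 ≤ q)
    (hqd : (d : ℝ) < q) :
    ∃ C : ℝ, 0 < C ∧ ∀ (v : Eucl d → Eucl d) (G : Eucl d → Eucl d →L[ℝ] Eucl d)
      (W : Eucl d → ℝ≥0∞) (R r r₀ : ℝ) (y z : Eucl d), HasWeakDeriv v G → Measurable W →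
      0 < r₀ → r₀ ≤ r → 2 * r ≤ R → dist y z ≤ r →
      (∀ᵐ x, x ∈ Metric.closedBall z (2 * r) → ‖G x‖ₑ ≤ W x) →
      ‖mollify η r v y - mollify η r₀ v y‖ₑ ≤ ENNReal.ofReal (C * r) * maxPow R q W z := by
  obtain ⟨C, hC0, hC⟩ := exists_mollify_scale_le hη hq1 hqd
  set V := (volume (Metric.closedBall (0 : Eucl d) 1)).toReal
  have hV : ENNReal.ofReal V = volume (Metric.closedBall (0 : Eucl d) 1) :=
    ENNReal.ofReal_toReal (volume_closedBall_ne_top _ _)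
  have hV0 : 0 < V := ENNReal.toReal_pos (volume_closedBall_ne_zero _ one_pos)
    (volume_closedBall_ne_top _ _)
  have hq0 : 0 < q := by linarith
  refine ⟨C * (2 ^ d * 2 ^ d * V) ^ (1 / q), by positivity, ?_⟩
  intro v G W R r r₀ y z hv hW hr₀ hr hR hyz hG
  have hrpos : 0 < r := hr₀.trans_le hr
  have hsub : Metric.closedBall y r ⊆ Metric.closedBall z (2 * r) :=
    Metric.closedBall_subset_closedBall' (by linarith)
  -- The ball around `y` lies in the doubled ball around `z`. The power `r ^ (d / q)` gained here
  -- completes `r ^ (1 - d / q)` to `r`.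
  have hK : (∫⁻ x in Metric.closedBall y r, W x ^ q) ^ (1 / q) ≤
      ENNReal.ofReal ((2 ^ d * 2 ^ d * V) ^ (1 / q) * r ^ (d / q)) * maxPow R q W z := by
    calc (∫⁻ x in Metric.closedBall y r, W x ^ q) ^ (1 / q)
        ≤ (∫⁻ x in Metric.closedBall z (2 * r), W x ^ q) ^ (1 / q) := by gcongr
      _ ≤ _ := setLIntegral_rpow_closedBall_le hq1 (by positivity) hR W z
      _ = _ := by
          rw [volume_closedBall_eq_mul (by positivity), ← hV, ← ENNReal.ofReal_mul (by positivity),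
            ← ENNReal.ofReal_mul (by positivity), ENNReal.ofReal_rpow_of_nonneg (by positivity)
            (by positivity)]
          congr 2
          rw [show (2 : ℝ) ^ d * ((2 * r) ^ d * V) = (2 ^ d * 2 ^ d * V) * r ^ d by rw [mul_pow]; ring,
            Real.mul_rpow (by positivity) (by positivity), ← Real.rpow_natCast r d,
            ← Real.rpow_mul hrpos.le, mul_one_div]
  refine (hC v G W _ r r₀ y hv hW hr₀ hr (hG.mono fun x hx hxy => hx (hsub hxy)) hK).trans_eq ?_
  rw [← mul_assoc, ← ENNReal.ofReal_mul (by positivity)]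
  congr 2
  calc C * r ^ (1 - d / q) * ((2 ^ d * 2 ^ d * V) ^ (1 / q) * r ^ (d / q))
      = C * (2 ^ d * 2 ^ d * V) ^ (1 / q) * (r ^ (1 - d / q) * r ^ (d / q)) := by ring
    _ = _ := by rw [← Real.rpow_add hrpos, sub_add_cancel, Real.rpow_one]

end Pointwise

/-! ### Convergence of mollifications and the continuous representative. -/

section Convergence

variable {d : ℕ} {η : Eucl d → ℝ}

theorem mollify_congr_ae {v w : Eucl d → Eucl d} (h : v =ᵐ[volume] w) (η : Eucl d → ℝ) (r : ℝ)
    (x : Eucl d) : mollify η r v x = mollify η r w x := by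
  rw [mollify_eq_integral_sub, mollify_eq_integral_sub]
  refine integral_congr_ae ?_
  filter_upwards [h] with y hy
  rw [hy]

theorem integrable_scaledKernel_sub (hη : IsStandardMollifier η) {r : ℝ} (hr : 0 < r)
    (x : Eucl d) : Integrable fun y => scaledKernel η r (x - y) :=
  ((contDiff_scaledKernel hη r).continuous.integrable_of_hasCompactSupport
    (hasCompactSupport_scaledKernel hη hr)).comp_sub_left x

theorem integral_scaledKernel_sub (hη : IsStandardMollifier η) {r : ℝ} (hr : 0 < r)
    (x : Eucl d) : ∫ y, scaledKernel η r (x - y) = 1 := by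
  rw [integral_sub_left_eq_self (scaledKernel η r) volume x, integral_scaledKernel hη hr]

theorem integrable_scaledKernel_smul (hη : IsStandardMollifier η) {r : ℝ} (hr : 0 < r)
    {v : Eucl d → Eucl d} (hv : LocallyIntegrable v) (x : Eucl d) :
    Integrable fun y => scaledKernel η r (x - y) • v y := by
  refine hv.integrable_smul_left_of_hasCompactSupport ?_ ?_
  · exact (contDiff_scaledKernel hη r).continuous.comp (continuous_const.sub continuous_id)
  · exact (hasCompactSupport_scaledKernel hη hr).comp_homeomorph (Homeomorph.subLeft x)

theorem mollify_sub_const (hη : IsStandardMollifier η) {r : ℝ} (hr : 0 < r)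
    {v : Eucl d → Eucl d} (hv : LocallyIntegrable v) (x a : Eucl d) :
    mollify η r v x - a = ∫ y, scaledKernel η r (x - y) • (v y - a) := by
  simp_rw [smul_sub]
  rw [integral_sub (integrable_scaledKernel_smul hη hr hv x)
    ((integrable_scaledKernel_sub hη hr x).smul_const a), integral_smul_const,
    integral_scaledKernel_sub hη hr, one_smul, mollify_eq_integral_sub]

theorem norm_integral_scaledKernel_smul_le (hη : IsStandardMollifier η) {r : ℝ} (hr : 0 < r)
    {w : Eucl d → Eucl d} {x : Eucl d} {c : ℝ}
    (h : ∀ᵐ y, y ∈ Metric.closedBall x r → ‖w y‖ ≤ c) :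
    ‖∫ y, scaledKernel η r (x - y) • w y‖ ≤ c := by
  have h1 := norm_integral_le_of_norm_le (f := fun y => scaledKernel η r (x - y) • w y)
    ((integrable_scaledKernel_sub hη hr x).mul_const c) (by
      filter_upwards [h] with y hy
      rw [norm_smul, Real.norm_of_nonneg (scaledKernel_nonneg hη hr _)]
      by_cases hxy : y ∈ Metric.closedBall x r
      · exact mul_le_mul_of_nonneg_left (hy hxy) (scaledKernel_nonneg hη hr _)
      · rw [Metric.mem_closedBall, dist_eq_norm, norm_sub_rev, not_le] at hxy
        simp [scaledKernel_eq_zero hη hr hxy])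
  rwa [integral_mul_const, integral_scaledKernel_sub hη hr, one_mul] at h1

theorem norm_mollify_le (hη : IsStandardMollifier η) {r : ℝ} (hr : 0 < r)
    {v : Eucl d → Eucl d} {c : ℝ} (h : ∀ᵐ y, ‖v y‖ ≤ c) (x : Eucl d) :
    ‖mollify η r v x‖ ≤ c := by
  rw [mollify_eq_integral_sub]
  exact norm_integral_scaledKernel_smul_le hη hr (h.mono fun y hy _ => hy)

theorem tendsto_half_pow : Tendsto (fun k : ℕ => ((1 : ℝ) / 2) ^ k) atTop (𝓝[>] 0) :=
  tendsto_pow_atTop_nhdsWithin_zero_of_lt_one (by norm_num) (by norm_num)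

theorem tendsto_mollify_of_continuous (hη : IsStandardMollifier η) {v : Eucl d → Eucl d}
    (hv : Continuous v) (x : Eucl d) :
    Tendsto (fun k : ℕ => mollify η ((1 / 2) ^ k) v x) atTop (𝓝 (v x)) := by
  rw [Metric.tendsto_nhds]
  intro ε hε
  obtain ⟨δ, hδ, hvδ⟩ := Metric.continuousAt_iff.1 (hv.continuousAt (x := x)) (ε / 2) (half_pos hε)
  have := tendsto_half_pow.mono_right nhdsWithin_le_nhds
  filter_upwards [this.eventually (gt_mem_nhds hδ)] with k hk
  rw [dist_eq_norm, mollify_sub_const hη (by positivity) hv.locallyIntegrable]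
  refine (norm_integral_scaledKernel_smul_le hη (by positivity) (c := ε / 2)
    (Eventually.of_forall fun y hy => ?_)).trans_lt (half_lt_self hε)
  rw [← dist_eq_norm]
  exact (hvδ ((Metric.mem_closedBall.1 hy).trans_lt hk)).le

/-- The kernel is at most `H / r ^ d` on a ball of volume `r ^ d * V`. The error is then at most `H
* V` times the mean oscillation, which vanishes at Lebesgue points. -/
theorem ae_tendsto_mollify (hη : IsStandardMollifier η) {v : Eucl d → Eucl d}
    (hv : LocallyIntegrable v) :
    ∀ᵐ x, Tendsto (fun k : ℕ => mollify η ((1 / 2) ^ k) v x) atTop (𝓝 (v x)) := by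
  obtain ⟨H, hH0, hH⟩ := hη.exists_bound
  filter_upwards [IsUnifLocDoublingMeasure.ae_tendsto_average_norm_sub volume hv 1] with x hx
  have h1 := hx (l := atTop) (fun _ : ℕ => x) (fun k => (1 / 2) ^ k) tendsto_half_pow
    (Eventually.of_forall fun k => Metric.mem_closedBall_self (by positivity))
  set V := (volume (Metric.closedBall (0 : Eucl d) 1)).toReal
  rw [tendsto_iff_norm_sub_tendsto_zero]
  refine squeeze_zero (fun _ => norm_nonneg _) (fun k => ?_)
    (by simpa only [mul_zero] using h1.const_mul (H * V))
  set r : ℝ := (1 / 2) ^ k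
  have hr : 0 < r := by positivity
  have hi : IntegrableOn (fun y => ‖v y - v x‖) (Metric.closedBall x r) :=
    ((hv.integrableOn_isCompact (isCompact_closedBall x r)).sub
      (integrableOn_const (measure_closedBall_lt_top.ne))).norm
  rw [mollify_sub_const hη hr hv]
  have hvol : volume.real (Metric.closedBall x r) = r ^ d * V := by
    rw [measureReal_def, volume_closedBall_eq_mul hr.le, ENNReal.toReal_mul,
      ENNReal.toReal_ofReal (by positivity)]
  have hV0 : 0 < V := ENNReal.toReal_pos (volume_closedBall_ne_zero _ one_pos)
    (volume_closedBall_ne_top _ _)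
  calc ‖∫ y, scaledKernel η r (x - y) • (v y - v x)‖
      ≤ ∫ y, (Metric.closedBall x r).indicator (fun y => H / r ^ d * ‖v y - v x‖) y := by
        refine norm_integral_le_of_norm_le ?_ (Eventually.of_forall fun y => ?_)
        · rw [integrable_indicator_iff Metric.isClosed_closedBall.measurableSet]
          exact hi.const_mul _
        · rw [norm_smul, Real.norm_of_nonneg (scaledKernel_nonneg hη hr _)]
          by_cases hy : y ∈ Metric.closedBall x r
          · rw [indicator_of_mem hy, scaledKernel, div_eq_inv_mul]
            gcongr
            exact hH _
          · rw [indicator_of_notMem hy]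
            rw [Metric.mem_closedBall, dist_eq_norm, norm_sub_rev, not_le] at hy
            simp [scaledKernel_eq_zero hη hr hy]
    _ = H * V * ⨍ y in Metric.closedBall x r, ‖v y - v x‖ := by
        rw [integral_indicator Metric.isClosed_closedBall.measurableSet, integral_const_mul,
          setAverage_eq, hvol, smul_eq_mul]
        field_simp

theorem contRep_spec {f g : Eucl d → Eucl d} (hg : Continuous g) (hgf : g =ᵐ[volume] f) :
    Continuous (contRep f) ∧ contRep f =ᵐ[volume] f := by
  have h : ∃ g : Eucl d → Eucl d, Continuous g ∧ g =ᵐ[volume] f := ⟨g, hg, hgf⟩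
  rw [contRep, dif_pos h]
  exact h.choose_spec

theorem continuous_mollify (hη : IsStandardMollifier η) {v : Eucl d → Eucl d}
    (hv : LocallyIntegrable v) {r : ℝ} (hr : 0 < r) : Continuous (mollify η r v) := by
  refine continuous_iff_continuousAt.2 fun x => ?_
  obtain ⟨D, hD, -⟩ := exists_hasFDerivAt_mollify hη hv hr x
  exact ContinuousAt.comp (f := fun x : Eucl d => (r, x)) hD.continuousAt (by fun_prop)

/-- A function with weak derivative in `L^q`, `q > d`, has a continuous representative. -/
theorem contRep_spec_of_hasWeakDeriv (hη : IsStandardMollifier η) {q : ℝ} (hq1 : 1 ≤ q)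
    (hqd : (d : ℝ) < q) {v : Eucl d → Eucl d} {G : Eucl d → Eucl d →L[ℝ] Eucl d}
    (hv : HasWeakDeriv v G) {W : Eucl d → ℝ≥0∞} (hW : Measurable W)
    (hG : ∀ᵐ x, ‖G x‖ₑ ≤ W x)
    (hint : ∀ m : ℕ, ∫⁻ x in Metric.closedBall 0 m, W x ^ q ≠ ⊤) :
    Continuous (contRep v) ∧ contRep v =ᵐ[volume] v := by
  obtain ⟨C, hC0, hC⟩ := exists_mollify_scale_le hη hq1 hqd
  set f : ℕ → Eucl d → Eucl d := fun k => mollify η ((1 / 2) ^ k) v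
  have hα : 0 < 1 - d / q := by rw [sub_pos, div_lt_one (by linarith)]; exact hqd
  set K : ℕ → ℝ≥0∞ := fun m => (∫⁻ x in Metric.closedBall 0 (m + 1 : ℕ), W x ^ q) ^ (1 / q)
  have hK : ∀ m, K m ≠ ⊤ := fun m => ENNReal.rpow_ne_top_of_nonneg (by positivity) (hint _)
  set c : ℕ → ℕ → ℝ := fun m k => C * ((1 / 2 : ℝ) ^ k) ^ (1 - d / q) * (K m).toReal
  have hc : ∀ m, Tendsto (c m) atTop (𝓝 0) := fun m => by
    have h1 : Tendsto (fun k : ℕ => ((1 : ℝ) / 2) ^ k) atTop (𝓝 0) :=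
      tendsto_half_pow.mono_right nhdsWithin_le_nhds
    have h2 := (h1.rpow_const (p := 1 - d / q) (Or.inr hα.le))
    rw [Real.zero_rpow hα.ne'] at h2
    simpa only [mul_zero, zero_mul] using (h2.const_mul C).mul_const (K m).toReal
  -- The bound is uniform for `y` in the ball of radius `m`, since balls of radius at most 1 around
  -- such `y` lie in the ball of radius `m + 1`. The mollifications are thus locally uniformly
  -- Cauchy.
  have hest : ∀ m k l : ℕ, k ≤ l → ∀ y ∈ Metric.closedBall (0 : Eucl d) m,
      ‖f k y - f l y‖ ≤ c m k := by
    intro m k l hkl y hy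
    have hle : ((1 : ℝ) / 2) ^ l ≤ (1 / 2) ^ k :=
      pow_le_pow_of_le_one (by norm_num) (by norm_num) hkl
    have hk1 : ((1 : ℝ) / 2) ^ k ≤ 1 := pow_le_one₀ (by norm_num) (by norm_num)
    have h1 := hC v G W (K m) ((1 / 2) ^ k) ((1 / 2) ^ l) y hv hW (by positivity) hle
      (hG.mono fun x hx _ => hx) (by
        simp only [K]
        gcongr
        refine Metric.closedBall_subset_closedBall' ?_
        rw [Metric.mem_closedBall] at hy
        push_cast
        linarith)
    rw [← toReal_enorm]
    refine (ENNReal.toReal_mono (by finiteness [hK m]) h1).trans_eq ?_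
    rw [ENNReal.toReal_mul, ENNReal.toReal_ofReal (by positivity)]
  have hlim : ∀ y, ∃ a, Tendsto (fun k => f k y) atTop (𝓝 a) := by
    intro y
    obtain ⟨m, hm⟩ := exists_nat_ge ‖y‖
    refine cauchySeq_tendsto_of_complete (cauchySeq_of_le_tendsto_0 (fun k => 2 * c m k) ?_ ?_)
    · intro k l N hk hl
      have hy : y ∈ Metric.closedBall (0 : Eucl d) m := by simpa using hm
      have h1 := hest m N k hk y hy
      have h2 := hest m N l hl y hy
      rw [dist_eq_norm, show f k y - f l y = (f N y - f l y) - (f N y - f k y) by abel]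
      linarith [norm_sub_le (f N y - f l y) (f N y - f k y)]
    · simpa using (hc m).const_mul 2
  choose g hg using hlim
  have hunif : TendstoLocallyUniformly f g atTop := by
    rw [Metric.tendstoLocallyUniformly_iff]
    intro ε hε x
    obtain ⟨m, hm⟩ := exists_nat_gt ‖x‖
    refine ⟨Metric.closedBall 0 m, ?_, ?_⟩
    · exact mem_of_superset (Metric.isOpen_ball.mem_nhds (by simpa using hm))
        Metric.ball_subset_closedBall
    · filter_upwards [(hc m).eventually (gt_mem_nhds hε)] with k hk y hy
      refine lt_of_le_of_lt ?_ hk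
      rw [dist_comm, dist_eq_norm]
      refine le_of_tendsto ((hg y).const_sub (f k y)).norm ?_
      filter_upwards [eventually_ge_atTop k] with l hl using hest m k l hl y hy
  have hgc : Continuous g := hunif.continuous (Frequently.of_forall fun k =>
    continuous_mollify hη hv.1 (by positivity))
  refine contRep_spec hgc ?_
  filter_upwards [ae_tendsto_mollify hη hv.1] with x hx using tendsto_nhds_unique (hg x) hx

/-- Convergence at every point, not just almost every one: a node of the Euler scheme is an
arbitrary point. -/
theorem tendsto_mollify_contRep (hη : IsStandardMollifier η) {v : Eucl d → Eucl d}
    (h : Continuous (contRep v) ∧ contRep v =ᵐ[volume] v) (x : Eucl d) :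
    Tendsto (fun k : ℕ => mollify η ((1 / 2) ^ k) v x) atTop (𝓝 (contRep v x)) := by
  refine (tendsto_mollify_of_continuous hη h.1 x).congr fun k => mollify_congr_ae h.2 η _ x

theorem closedBall_subset_closedBall_zero {z : Eucl d} {s ρ : ℝ} (h : ‖z‖ + s ≤ ρ) :
    Metric.closedBall z s ⊆ Metric.closedBall 0 ρ :=
  Metric.closedBall_subset_closedBall' (by rw [dist_zero_right]; linarith)

/-- At a point `z` where the mollifications converge, the value differs from a mollification at
`y` by at most the distance plus the scale times the maximal function at `z`. -/
theorem exists_sub_mollify_le (hη : IsStandardMollifier η) :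
    ∃ C : ℝ, 0 < C ∧ ∀ (v : Eucl d → Eucl d) (G : Eucl d → Eucl d →L[ℝ] Eucl d)
      (W : Eucl d → ℝ≥0∞) (R q r ρ : ℝ) (y z a : Eucl d), HasWeakDeriv v G → Measurable W →
      1 ≤ q → 0 < r → 2 * r ≤ R → dist y z ≤ r → ‖z‖ + 2 * r ≤ ρ →
      (∀ᵐ x, x ∈ Metric.closedBall 0 ρ → ‖G x‖ₑ ≤ W x) →
      Tendsto (fun k : ℕ => mollify η ((1 / 2) ^ k) v z) atTop (𝓝 a) →
      ‖mollify η r v y - a‖ₑ ≤ ENNReal.ofReal (C * r) * maxPow R q W z := by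
  obtain ⟨C, hC0, hC⟩ := exists_mollify_sub_mollify_le hη
  refine ⟨C, hC0, ?_⟩
  intro v G W R q r ρ y z a hv hW hq hr hR hyz hz hG ha
  refine le_of_tendsto ((ha.const_sub (mollify η r v y)).enorm) ?_
  filter_upwards [(tendsto_half_pow.mono_right nhdsWithin_le_nhds).eventually
    (ge_mem_nhds hr)] with k hk
  exact hC v G W R q r _ y z hv hW hq (by positivity) hk hR hyz
    (hG.mono fun x hx hxz => hx (closedBall_subset_closedBall_zero hz hxz))

/-- The two-sided estimate: the difference of a function and a mollification. -/
theorem exists_sub_mollify_le_add (hη : IsStandardMollifier η) :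
    ∃ C : ℝ, 0 < C ∧ ∀ (v : Eucl d → Eucl d) (G : Eucl d → Eucl d →L[ℝ] Eucl d)
      (W : Eucl d → ℝ≥0∞) (R q δ ρ : ℝ) (y z a : Eucl d), HasWeakDeriv v G → Measurable W →
      1 ≤ q → 0 < δ → 2 * (dist y z + δ) ≤ R → ‖z‖ + 2 * (dist y z + δ) ≤ ρ →
      ‖y‖ + 2 * (dist y z + δ) ≤ ρ →
      (∀ᵐ x, x ∈ Metric.closedBall 0 ρ → ‖G x‖ₑ ≤ W x) →
      Tendsto (fun k : ℕ => mollify η ((1 / 2) ^ k) v z) atTop (𝓝 a) →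
      ‖a - mollify η δ v y‖ₑ ≤ ENNReal.ofReal (C * (dist y z + δ)) *
        (maxPow R q W z + maxPow R q W y) := by
  obtain ⟨C₁, hC₁0, hC₁⟩ := exists_sub_mollify_le hη
  obtain ⟨C₂, hC₂0, hC₂⟩ := exists_mollify_sub_mollify_le hη
  refine ⟨C₁ + C₂, by positivity, ?_⟩
  intro v G W R q δ ρ y z a hv hW hq hδ hR hz hy hG ha
  -- Both values are compared with the mollification at `y` at this scale, which dominates both the
  -- distance of the points and `δ`.
  set r := dist y z + δ
  have hd : 0 ≤ dist y z := dist_nonneg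
  have hr : 0 < r := by positivity
  have h1 := hC₁ v G W R q r ρ y z a hv hW hq hr hR (le_add_of_nonneg_right hδ.le) hz hG ha
  have h2 := hC₂ v G W R q r δ y y hv hW hq hδ (le_add_of_nonneg_left hd) hR
    (by rw [dist_self]; exact hr.le)
    (hG.mono fun x hx hxz => hx (closedBall_subset_closedBall_zero hy hxz))
  calc ‖a - mollify η δ v y‖ₑ
      = ‖(mollify η r v y - mollify η δ v y) - (mollify η r v y - a)‖ₑ := by congr 1; abel
    _ ≤ ‖mollify η r v y - mollify η δ v y‖ₑ + ‖mollify η r v y - a‖ₑ := enorm_sub_le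
    _ ≤ ENNReal.ofReal ((C₁ + C₂) * r) * maxPow R q W y +
        ENNReal.ofReal ((C₁ + C₂) * r) * maxPow R q W z := by
        refine add_le_add (h2.trans ?_) (h1.trans ?_) <;> gcongr <;> linarith
    _ = _ := by ring

/-- The one-sided estimate: the difference of two values of the continuous representative. -/
theorem exists_sub_contRep_le (hη : IsStandardMollifier η) {q : ℝ} (hq1 : 1 ≤ q)
    (hqd : (d : ℝ) < q) :
    ∃ C : ℝ, 0 < C ∧ ∀ (v : Eucl d → Eucl d) (G : Eucl d → Eucl d →L[ℝ] Eucl d)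
      (W : Eucl d → ℝ≥0∞) (R δ ρ : ℝ) (y z a : Eucl d), HasWeakDeriv v G → Measurable W →
      0 < δ → 2 * (dist y z + δ) ≤ R → ‖z‖ + 2 * (dist y z + δ) ≤ ρ →
      (∀ᵐ x, x ∈ Metric.closedBall 0 ρ → ‖G x‖ₑ ≤ W x) →
      Tendsto (fun k : ℕ => mollify η ((1 / 2) ^ k) v z) atTop (𝓝 a) →
      (Continuous (contRep v) ∧ contRep v =ᵐ[volume] v) →
      ‖a - contRep v y‖ₑ ≤ ENNReal.ofReal (C * (dist y z + δ)) * maxPow R q W z := by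
  obtain ⟨C₁, hC₁0, hC₁⟩ := exists_sub_mollify_le hη
  obtain ⟨C₂, hC₂0, hC₂⟩ := exists_mollify_scale_le_maxPow hη hq1 hqd
  refine ⟨C₁ + C₂, by positivity, ?_⟩
  intro v G W R δ ρ y z a hv hW hδ hR hz hG ha hrep
  set r := dist y z + δ
  have hd : 0 ≤ dist y z := dist_nonneg
  have hr : 0 < r := by positivity
  have hyz : dist y z ≤ r := le_add_of_nonneg_right hδ.le
  have h1 := hC₁ v G W R q r ρ y z a hv hW hq1 hr hR hyz hz hG ha
  have h2 : ‖mollify η r v y - contRep v y‖ₑ ≤ ENNReal.ofReal (C₂ * r) * maxPow R q W z := by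
    refine le_of_tendsto ((tendsto_mollify_contRep hη hrep y).const_sub (mollify η r v y)).enorm ?_
    filter_upwards [(tendsto_half_pow.mono_right nhdsWithin_le_nhds).eventually
      (ge_mem_nhds hr)] with k hk
    exact hC₂ v G W R r _ y z hv hW (by positivity) hk hR hyz
      (hG.mono fun x hx hxz => hx (closedBall_subset_closedBall_zero hz hxz))
  calc ‖a - contRep v y‖ₑ
      = ‖(mollify η r v y - contRep v y) - (mollify η r v y - a)‖ₑ := by congr 1; abel
    _ ≤ ‖mollify η r v y - contRep v y‖ₑ + ‖mollify η r v y - a‖ₑ := enorm_sub_le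
    _ ≤ ENNReal.ofReal (C₂ * r) * maxPow R q W z + ENNReal.ofReal (C₁ * r) * maxPow R q W z :=
        add_le_add h2 h1
    _ = _ := by
        rw [← add_mul, ← ENNReal.ofReal_add (by positivity) (by positivity)]
        congr 2
        ring

end Convergence

/-! ### Periodic functions and the fundamental domain. -/

section Periodic

variable {d : ℕ}

/-- The vector of `ℝᵈ` with integer coordinates `n`. -/
noncomputable def intVec (n : Fin d → ℤ) : Eucl d := WithLp.toLp 2 fun i => (n i : ℝ)

@[simp] theorem intVec_apply (n : Fin d → ℤ) (i : Fin d) : intVec n i = n i := rfl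

/-- The fundamental domain `[0,1)ᵈ`. -/
def unitCube (d : ℕ) : Set (Eucl d) := {x | ∀ i, x i ∈ Ico (0 : ℝ) 1}

theorem torusMeasure_eq (d : ℕ) : torusMeasure d = volume.restrict (unitCube d) := rfl

theorem measurableSet_unitCube (d : ℕ) : MeasurableSet (unitCube d) := by
  have : unitCube d = ⋂ i, (fun x : Eucl d => x i) ⁻¹' Ico 0 1 := by
    ext x; simp [unitCube]
  rw [this]
  exact MeasurableSet.iInter fun i => (by fun_prop : Measurable fun x : Eucl d => x i)
    measurableSet_Ico

theorem ZPeriodic.periodic_intVec {F : Type*} {f : Eucl d → F} (hf : ZPeriodic f)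
    (n : Fin d → ℤ) : Function.Periodic f (intVec n) := by
  have h1 : intVec n = ∑ i, n i • EuclideanSpace.single i (1 : ℝ) := by
    ext j
    simp [Finset.sum_apply, Pi.single_apply]
  rw [h1]
  refine Finset.sum_induction _ (Function.Periodic f) (fun a b ha hb => ha.add_period hb)
    (fun x => congrArg f (add_zero x)) fun _ _ => (hf _).zsmul (n _)

/-- The coordinatewise fractional part. -/
noncomputable def fractVec (x : Eucl d) : Eucl d := WithLp.toLp 2 fun i => Int.fract (x i)

theorem fractVec_eq_sub (x : Eucl d) : fractVec x = x - intVec fun i => ⌊x i⌋ := by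
  ext i
  simp [fractVec]

theorem fractVec_mem_unitCube (x : Eucl d) : fractVec x ∈ unitCube d := fun _ =>
  ⟨Int.fract_nonneg _, Int.fract_lt_one _⟩

theorem measurable_fractVec : Measurable (fractVec : Eucl d → Eucl d) := by
  refine (WithLp.measurable_toLp 2 _).comp (measurable_pi_lambda _ fun i => ?_)
  exact measurable_fract.comp (by fun_prop)

theorem ZPeriodic.comp_fractVec {F : Type*} {f : Eucl d → F} (hf : ZPeriodic f) (x : Eucl d) :
    f (fractVec x) = f x := by
  rw [fractVec_eq_sub]
  exact (hf.periodic_intVec _).sub_eq x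

/-- The preimage of a set is covered by countably many integer translates of its part in the cube.
So null sets of the torus lift to null sets, and almost everywhere statements and measurability pass
to periodic functions on the whole space. -/
theorem quasiMeasurePreserving_fractVec (d : ℕ) :
    Measure.QuasiMeasurePreserving (fractVec : Eucl d → Eucl d) volume (torusMeasure d) := by
  refine ⟨measurable_fractVec, Measure.AbsolutelyContinuous.mk fun A hA hA0 => ?_⟩
  rw [Measure.map_apply measurable_fractVec hA]
  rw [torusMeasure_eq, Measure.restrict_apply hA] at hA0
  have hsub : fractVec ⁻¹' A ⊆ ⋃ n : Fin d → ℤ, (fun x => x - intVec n) ⁻¹' (A ∩ unitCube d) :=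
    fun x hx => mem_iUnion.2 ⟨fun i => ⌊x i⌋, by
      rw [mem_preimage, ← fractVec_eq_sub]
      exact ⟨hx, fractVec_mem_unitCube x⟩⟩
  refine measure_mono_null hsub (measure_iUnion_null fun n => ?_)
  exact (measurePreserving_sub_right volume (intVec n)).preimage_null hA0

theorem quasiMeasurePreserving_prod_fractVec (d : ℕ) (T : ℝ) :
    Measure.QuasiMeasurePreserving (fun q : ℝ × Eucl d => (q.1, fractVec q.2))
      ((volume.restrict (Ioo 0 T)).prod volume) (timeTorusMeasure d T) := by
  have : SFinite (torusMeasure d) := by rw [torusMeasure_eq]; infer_instance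
  exact QuasiMeasurePreserving.prodMap (Measure.QuasiMeasurePreserving.id (volume.restrict (Ioo 0 T)))
    (quasiMeasurePreserving_fractVec d)

theorem aestronglyMeasurable_uncurry_of_periodic {F : Type*} [TopologicalSpace F] {T : ℝ}
    {f : ℝ → Eucl d → F} (hf : ∀ t, ZPeriodic (f t))
    (h : AEStronglyMeasurable (Function.uncurry f) (timeTorusMeasure d T)) :
    AEStronglyMeasurable (Function.uncurry f) ((volume.restrict (Ioo 0 T)).prod volume) := by
  have := h.comp_quasiMeasurePreserving (quasiMeasurePreserving_prod_fractVec d T)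
  convert this using 1
  ext ⟨t, x⟩
  exact ((hf t).comp_fractVec x).symm

theorem ae_prod_of_periodic {F : Type*} {T : ℝ} {f : ℝ → Eucl d → F} (hf : ∀ t, ZPeriodic (f t))
    {P : F → Prop} (h : ∀ᵐ q ∂timeTorusMeasure d T, P (f q.1 q.2)) :
    ∀ᵐ q ∂(volume.restrict (Ioo 0 T)).prod (volume : Measure (Eucl d)), P (f q.1 q.2) := by
  filter_upwards [(quasiMeasurePreserving_prod_fractVec d T).ae h] with q hq
  rwa [(hf q.1).comp_fractVec] at hq

theorem ae_of_periodic {F : Type*} {f : Eucl d → F} (hf : ZPeriodic f)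
    {P : F → Prop} (h : ∀ᵐ x ∂torusMeasure d, P (f x)) : ∀ᵐ x, P (f x) := by
  filter_upwards [(quasiMeasurePreserving_fractVec d).ae h] with q hq
  rwa [hf.comp_fractVec] at hq

/-- The integral of a periodic function over a ball is at most a multiple of the integral over the
torus. -/
theorem exists_setLIntegral_closedBall_le_torus (d : ℕ) (ρ : ℝ) :
    ∃ N : ℝ≥0∞, N ≠ ⊤ ∧ ∀ f : Eucl d → ℝ≥0∞, ZPeriodic f →
      ∫⁻ x in Metric.closedBall 0 ρ, f x ≤ N * ∫⁻ x, f x ∂torusMeasure d := by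
  obtain ⟨m, hm⟩ := exists_nat_ge (ρ + 1)
  -- Integer translates with coordinates in `[-m, m]`, where `m ≥ ρ + 1`, cover the ball; the extra
  -- 1 absorbs rounding down.
  set S : Finset (Fin d → ℤ) := Fintype.piFinset fun _ => Finset.Icc (-(m : ℤ)) m
  refine ⟨S.card, by simp, fun f hf => ?_⟩
  have hsub : Metric.closedBall (0 : Eucl d) ρ ⊆
      ⋃ n : S, (fun x => x - intVec (n : Fin d → ℤ)) ⁻¹' unitCube d := by
    intro x hx
    rw [mem_closedBall_zero_iff] at hx
    refine mem_iUnion.2 ⟨⟨fun i => ⌊x i⌋, ?_⟩, ?_⟩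
    · rw [Fintype.mem_piFinset]
      intro i
      have h1 : |x i| ≤ ρ := (PiLp.norm_apply_le x i).trans hx
      rw [abs_le] at h1
      rw [Finset.mem_Icc, Int.le_floor]
      refine ⟨by push_cast; linarith, ?_⟩
      have : (⌊x i⌋ : ℝ) ≤ (m : ℤ) := (Int.floor_le _).trans (by push_cast; linarith)
      exact_mod_cast this
    · rw [mem_preimage, ← fractVec_eq_sub]
      exact fractVec_mem_unitCube x
  calc ∫⁻ x in Metric.closedBall 0 ρ, f x
      ≤ ∫⁻ x in ⋃ n : S, (fun x => x - intVec (n : Fin d → ℤ)) ⁻¹' unitCube d, f x :=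
        lintegral_mono_set hsub
    _ ≤ ∑' n : S, ∫⁻ x in (fun x => x - intVec (n : Fin d → ℤ)) ⁻¹' unitCube d, f x :=
        lintegral_iUnion_le _ _
    _ = ∑' n : S, ∫⁻ x, f x ∂torusMeasure d := by
        congr 1 with n
        have h1 := (measurePreserving_sub_right (volume : Measure (Eucl d))
          (intVec (n : Fin d → ℤ))).setLIntegral_comp_preimage_emb
          (MeasurableEquiv.subRight (intVec (n : Fin d → ℤ))).measurableEmbedding f (unitCube d)
        rw [torusMeasure_eq, ← h1]
        refine lintegral_congr fun x => ?_
        exact ((hf.periodic_intVec _).sub_eq x).symm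
    _ = _ := by
        rw [tsum_fintype]
        simp

theorem norm_le_of_mem_unitCube {x : Eucl d} (hx : x ∈ unitCube d) : ‖x‖ ≤ √d := by
  rw [EuclideanSpace.norm_eq]
  refine Real.sqrt_le_sqrt ?_
  calc ∑ i, ‖x i‖ ^ 2 ≤ ∑ _i : Fin d, (1 : ℝ) := by
        refine Finset.sum_le_sum fun i _ => ?_
        rw [Real.norm_of_nonneg (hx i).1]
        exact pow_le_one₀ (hx i).1 (hx i).2.le
    _ = d := by simp

theorem ae_torusMeasure_of_ae {P : Eucl d → Prop} (h : ∀ᵐ x, P x) :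
    ∀ᵐ x ∂torusMeasure d, x ∈ unitCube d ∧ P x := by
  rw [torusMeasure_eq]
  filter_upwards [ae_restrict_of_ae h, ae_restrict_mem (measurableSet_unitCube d)] with x h1 h2
  exact ⟨h2, h1⟩

theorem volume_unitCube_lt_top (d : ℕ) : volume (unitCube d) < ⊤ :=
  (measure_mono fun _ hx => mem_closedBall_zero_iff.2 (norm_le_of_mem_unitCube hx)).trans_lt
    (measure_closedBall_lt_top (x := (0 : Eucl d)) (r := √d))

instance isFiniteMeasure_torusMeasure (d : ℕ) : IsFiniteMeasure (torusMeasure d) :=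
  ⟨by rw [torusMeasure_eq, Measure.restrict_apply_univ]; exact volume_unitCube_lt_top d⟩

end Periodic

/-! ### Time integrals in L^p along compressible families of maps. -/

section TimeIntegrals

variable {d : ℕ}

/-- A bound for `g` in `L¹(0,T; L^p(ℝᵈ))` by a time-dependent majorant. -/
def TimeLpBound (T : ℝ) (p : ℝ≥0∞) (g : ℝ → Eucl d → ℝ≥0∞) : Prop :=
  ∃ β : ℝ → ℝ≥0∞, (∀ t, 1 ≤ β t) ∧ ∫⁻ t in Ioo 0 T, β t ≠ ⊤ ∧
    (p = ⊤ → ∀ᵐ t ∂volume.restrict (Ioo 0 T), ∀ z, g t z ≤ β t) ∧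
    (p ≠ ⊤ → Measurable β ∧ ∀ᵐ t ∂volume.restrict (Ioo 0 T),
      ∫⁻ z, g t z ^ p.toReal ≤ β t ^ p.toReal)

/-- Hölder for the factorization `h = (h * β ^ (-1/s')) * β ^ (1/s')`. With `β` a majorant of the
spatial norm, this does the work of Minkowski's integral inequality; `1 ≤ β` keeps the negative
powers finite. -/
theorem lintegral_rpow_le_mul_lintegral {α : Type*} [MeasurableSpace α] {μ : Measure α}
    {h β : α → ℝ≥0∞} (hh : AEMeasurable h μ) (hβ : Measurable β) (hβ1 : ∀ t, 1 ≤ β t)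
    (hβt : ∀ᵐ t ∂μ, β t ≠ ⊤) {s : ℝ} (hs : 1 < s) :
    (∫⁻ t, h t ∂μ) ^ s ≤ (∫⁻ t, β t ∂μ) ^ (s - 1) * ∫⁻ t, h t ^ s * β t ^ (1 - s) ∂μ := by
  have hs0 : 0 < s := by linarith
  have hpq := Real.HolderConjugate.conjExponent hs
  set s' := s.conjExponent
  have hs' : s' = s / (s - 1) := rfl
  have hs1 : 0 < s - 1 := by linarith
  have hs'0 : 0 < s' := hpq.symm.pos
  have h1 : ∫⁻ t, h t ∂μ = ∫⁻ t, ((fun t => h t * β t ^ (-(1 / s'))) *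
      fun t => β t ^ (1 / s')) t ∂μ := by
    refine lintegral_congr_ae ?_
    filter_upwards [hβt] with t ht
    have h0 : β t ≠ 0 := (zero_lt_one.trans_le (hβ1 t)).ne'
    rw [Pi.mul_apply, mul_assoc, ← ENNReal.rpow_add _ _ h0 ht, neg_add_cancel, ENNReal.rpow_zero,
      mul_one]
  have h2 := ENNReal.lintegral_mul_le_Lp_mul_Lq μ hpq (hh.mul (hβ.pow_const (-(1 / s'))).aemeasurable)
    (hβ.pow_const (1 / s')).aemeasurable
  rw [h1]
  calc _ ≤ ((∫⁻ t, (h t * β t ^ (-(1 / s'))) ^ s ∂μ) ^ (1 / s) *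
        (∫⁻ t, (β t ^ (1 / s')) ^ s' ∂μ) ^ (1 / s')) ^ s := by
        gcongr
        exact h2
    _ = (∫⁻ t, (h t * β t ^ (-(1 / s'))) ^ s ∂μ) *
        (∫⁻ t, (β t ^ (1 / s')) ^ s' ∂μ) ^ (s - 1) := by
        rw [ENNReal.mul_rpow_of_nonneg _ _ hs0.le, ← ENNReal.rpow_mul, ← ENNReal.rpow_mul,
          one_div_mul_cancel hs0.ne', ENNReal.rpow_one]
        congr 2
        rw [hs']
        field_simp
    _ = _ := by
        rw [mul_comm]
        congr 2
        · refine lintegral_congr fun t => ?_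
          rw [← ENNReal.rpow_mul, one_div_mul_cancel hs'0.ne', ENNReal.rpow_one]
        · ext t
          rw [ENNReal.mul_rpow_of_nonneg _ _ hs0.le, ← ENNReal.rpow_mul]
          congr 2
          rw [hs']
          field_simp
          ring

/-- After the weighted Hölder inequality and Tonelli, compression gives `∫ g(t, Y)^s dx ≤ L * β ^
s`. The weight reduces this to `L * β`, integrable in time. The constant does not depend on `Y`,
which matters because the nodes vary with the time step. -/
theorem exists_eLpNorm_lintegral_comp_le {T : ℝ} {p : ℝ≥0∞} (hp : 1 < p)
    {g : ℝ → Eucl d → ℝ≥0∞} (hb : TimeLpBound T p g)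
    (hg : Measurable (Function.uncurry g)) (L : ℝ≥0) :
    ∃ A : ℝ≥0∞, A ≠ ⊤ ∧ ∀ Y : ℝ → Eucl d → Eucl d,
      AEMeasurable (fun q : ℝ × Eucl d => g q.1 (Y q.1 q.2))
        ((volume.restrict (Ioo 0 T)).prod volume) →
      (∀ s ∈ Ioo 0 T, ∀ h : Eucl d → ℝ≥0∞, Measurable h →
        ∫⁻ x, h (Y s x) ≤ L * ∫⁻ x, h x) →
      eLpNorm (fun x => ∫⁻ s in Ioo 0 T, g s (Y s x)) p (torusMeasure d) ≤ A := by
  obtain ⟨β, hβ1, hβ, htop, hfin⟩ := hb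
  rcases eq_or_ne p ⊤ with rfl | hpt
  · refine ⟨_, hβ, fun Y _ _ => ?_⟩
    rw [eLpNorm_exponent_top]
    refine essSup_le_of_ae_le _ (Eventually.of_forall fun x => ?_)
    refine lintegral_mono_ae ?_
    filter_upwards [htop rfl] with t ht using ht _
  obtain ⟨hβm, hgβ⟩ := hfin hpt
  have hp0 : p ≠ 0 := (zero_lt_one.trans hp).ne'
  set s := p.toReal
  have hs : 1 < s := by
    have := (ENNReal.toReal_lt_toReal ENNReal.one_ne_top hpt).2 hp
    simpa using this
  set B := ∫⁻ t in Ioo 0 T, β t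
  refine ⟨(B ^ (s - 1) * (L * B)) ^ (1 / s), ?_, fun Y hY hL => ?_⟩
  · refine ENNReal.rpow_ne_top_of_nonneg (by positivity) (ENNReal.mul_ne_top ?_ ?_)
    · exact ENNReal.rpow_ne_top_of_nonneg (by linarith) hβ
    · exact ENNReal.mul_ne_top ENNReal.coe_ne_top hβ
  rw [eLpNorm_eq_lintegral_rpow_enorm_toReal hp0 hpt]
  simp only [enorm_eq_self]
  gcongr
  have hβt : ∀ᵐ t ∂volume.restrict (Ioo 0 T), β t ≠ ⊤ :=
    (ae_lt_top hβm hβ).mono fun t ht => ht.ne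
  have hslice : ∀ᵐ x : Eucl d, AEMeasurable (fun t => g t (Y t x)) (volume.restrict (Ioo 0 T)) := by
    have h1 : AEStronglyMeasurable (fun q : Eucl d × ℝ => g q.2 (Y q.2 q.1))
        ((volume : Measure (Eucl d)).prod (volume.restrict (Ioo 0 T))) :=
      hY.aestronglyMeasurable.prod_swap
    exact h1.prodMk_left.mono fun x hx => hx.aemeasurable
  have hprod : AEMeasurable (fun q : ℝ × Eucl d => g q.1 (Y q.1 q.2) ^ s * β q.1 ^ (1 - s))
      ((volume.restrict (Ioo 0 T)).prod volume) :=
    (hY.pow_const s).mul ((hβm.comp measurable_fst).pow_const _).aemeasurable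
  calc ∫⁻ x, (∫⁻ t in Ioo 0 T, g t (Y t x)) ^ s ∂torusMeasure d
      ≤ ∫⁻ x, (∫⁻ t in Ioo 0 T, g t (Y t x)) ^ s := by
        rw [torusMeasure_eq]
        exact setLIntegral_le_lintegral _ _
    _ ≤ ∫⁻ x, B ^ (s - 1) * ∫⁻ t in Ioo 0 T, g t (Y t x) ^ s * β t ^ (1 - s) := by
        refine lintegral_mono_ae ?_
        filter_upwards [hslice] with x hx using
          lintegral_rpow_le_mul_lintegral hx hβm hβ1 hβt hs
    _ = B ^ (s - 1) * ∫⁻ t in Ioo 0 T, ∫⁻ x, g t (Y t x) ^ s * β t ^ (1 - s) := by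
        rw [lintegral_const_mul' _ _ (ENNReal.rpow_ne_top_of_nonneg (by linarith) hβ),
          ← lintegral_lintegral_swap
            (f := fun t x => g t (Y t x) ^ s * β t ^ (1 - s)) hprod]
    _ ≤ B ^ (s - 1) * ∫⁻ t in Ioo 0 T, L * β t := by
        gcongr B ^ (s - 1) * ?_
        refine lintegral_mono_ae ?_
        filter_upwards [hgβ, hβt, ae_restrict_mem measurableSet_Ioo] with t ht1 ht2 ht3
        have h0 : β t ≠ 0 := (zero_lt_one.trans_le (hβ1 t)).ne'
        have hgt : Measurable fun z => g t z ^ s :=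
          (hg.comp (measurable_prodMk_left (x := t))).pow_const s
        rw [lintegral_mul_const' _ _ (ENNReal.rpow_ne_top_of_ne_zero h0 ht2)]
        calc (∫⁻ x, g t (Y t x) ^ s) * β t ^ (1 - s)
            ≤ (L * β t ^ s) * β t ^ (1 - s) := by
              gcongr
              exact (hL t ht3 _ hgt).trans (by gcongr)
          _ = L * β t := by
              rw [mul_assoc, ← ENNReal.rpow_add _ _ h0 ht2, add_sub_cancel, ENNReal.rpow_one]
    _ = _ := by rw [lintegral_const_mul _ hβm]

theorem measurable_maxPow {W : ℝ → Eucl d → ℝ≥0∞} (hW : Measurable (Function.uncurry W))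
    (R q : ℝ) : Measurable (Function.uncurry fun t => maxPow R q (W t)) :=
  (measurable_dyadicMax (F := fun t y => W t y ^ q) (hW.pow_const q) R).pow_const _

/-- For finite `p` this is the strong type inequality with exponent `p / q > 1`, applied to `W ^ q`
at almost every time. For `p = ⊤` averages do not exceed the essential supremum. -/
theorem timeLpBound_maxPow {T R q : ℝ} {p : ℝ≥0∞} (hR : 0 < R) (hq : 1 ≤ q)
    (hqp : ENNReal.ofReal q < p) {W : ℝ → Eucl d → ℝ≥0∞} (hW : Measurable (Function.uncurry W))
    {a : ℝ → ℝ≥0∞} (ha : ∫⁻ t in Ioo 0 T, a t ≠ ⊤) {K : ℝ≥0∞} (hK : K ≠ ⊤)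
    (htop : p = ⊤ → ∀ᵐ t ∂volume.restrict (Ioo 0 T), ∀ᵐ z, W t z ≤ a t)
    (hfin : p ≠ ⊤ → ∀ᵐ t ∂volume.restrict (Ioo 0 T),
      ∫⁻ z, W t z ^ p.toReal ≤ K * a t ^ p.toReal) :
    TimeLpBound T p fun t => maxPow R q (W t) := by
  have hq0 : 0 < q := by linarith
  rcases eq_or_ne p ⊤ with rfl | hpt
  · refine ⟨fun t => 1 + a t, fun t => le_self_add, ?_, fun _ => ?_, fun h => absurd rfl h⟩
    · rw [lintegral_add_left measurable_const]
      exact ENNReal.add_ne_top.2 ⟨by simp, ha⟩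
    · filter_upwards [htop rfl] with t ht z
      refine le_trans ?_ (le_add_self (a := a t))
      have h1 : dyadicMax R (fun y => W t y ^ q) z ≤ a t ^ q := by
        refine iSup_le fun k => ?_
        have hV0 := volume_closedBall_ne_zero (0 : Eucl d) (r := R / 2 ^ k) (by positivity)
        have hVt := volume_closedBall_ne_top (0 : Eucl d) (R / 2 ^ k)
        rw [ENNReal.div_le_iff hV0 hVt]
        calc ∫⁻ y in Metric.closedBall z (R / 2 ^ k), W t y ^ q
            ≤ ∫⁻ y in Metric.closedBall z (R / 2 ^ k), a t ^ q := by
              refine lintegral_mono_ae (ae_restrict_of_ae ?_)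
              filter_upwards [ht] with y hy
              gcongr
          _ = _ := by rw [setLIntegral_const, volume_closedBall_eq z]
      calc maxPow R q (W t) z ≤ (a t ^ q) ^ (1 / q) := by
            rw [maxPow]
            gcongr
        _ = a t := by rw [← ENNReal.rpow_mul, mul_one_div_cancel hq0.ne', ENNReal.rpow_one]
  · set s := p.toReal
    have hqs : q < s := by
      have := (ENNReal.toReal_lt_toReal ENNReal.ofReal_ne_top hpt).2 hqp
      rwa [ENNReal.toReal_ofReal hq0.le] at this
    have hs0 : 0 < s := hq0.trans hqs
    obtain ⟨C, hCt, hC⟩ := lintegral_dyadicMax_rpow_le d (s := s / q) ((one_lt_div hq0).2 hqs)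
    have hmeas : Measurable fun t => (∫⁻ z, maxPow R q (W t) z ^ s) ^ (1 / s) :=
      (Measurable.lintegral_prod_right' ((measurable_maxPow hW R q).pow_const s)).pow_const _
    have hbd : ∀ᵐ t ∂volume.restrict (Ioo 0 T),
        (∫⁻ z, maxPow R q (W t) z ^ s) ^ (1 / s) ≤ (C * K) ^ (1 / s) * a t := by
      filter_upwards [hfin hpt] with t ht
      have hWt : Measurable (W t) := hW.comp measurable_prodMk_left
      have h1 : ∫⁻ z, maxPow R q (W t) z ^ s ≤ C * (K * a t ^ s) := by
        calc ∫⁻ z, maxPow R q (W t) z ^ s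
            = ∫⁻ z, dyadicMax R (fun y => W t y ^ q) z ^ (s / q) := by
              refine lintegral_congr fun z => ?_
              rw [maxPow, ← ENNReal.rpow_mul, one_div_mul_eq_div]
          _ ≤ C * ∫⁻ z, (W t z ^ q) ^ (s / q) := hC R hR _ (hWt.pow_const q)
          _ = C * ∫⁻ z, W t z ^ s := by
              congr 1
              refine lintegral_congr fun z => ?_
              rw [← ENNReal.rpow_mul, mul_div_cancel₀ _ hq0.ne']
          _ ≤ _ := by gcongr
      calc (∫⁻ z, maxPow R q (W t) z ^ s) ^ (1 / s) ≤ (C * (K * a t ^ s)) ^ (1 / s) := by gcongr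
        _ = _ := by
            rw [← mul_assoc, ENNReal.mul_rpow_of_nonneg _ _ (by positivity), ← ENNReal.rpow_mul,
              mul_one_div_cancel hs0.ne', ENNReal.rpow_one]
    have hCK : (C * K) ^ (1 / s) ≠ ⊤ :=
      ENNReal.rpow_ne_top_of_nonneg (by positivity) (ENNReal.mul_ne_top hCt hK)
    -- The function `a` need not be measurable, so the majorant is built from the norm of the
    -- maximal function itself.
    refine ⟨fun t => 1 + (∫⁻ z, maxPow R q (W t) z ^ s) ^ (1 / s), fun t => le_self_add, ?_,
      fun h => absurd h hpt, fun _ => ⟨measurable_const.add hmeas, ?_⟩⟩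
    · rw [lintegral_add_left measurable_const]
      refine ENNReal.add_ne_top.2 ⟨by simp, ?_⟩
      refine ((lintegral_mono_ae hbd).trans_lt ?_).ne
      rw [lintegral_const_mul' _ _ hCK]
      exact ENNReal.mul_lt_top hCK.lt_top ha.lt_top
    · filter_upwards with t
      calc ∫⁻ z, maxPow R q (W t) z ^ s
          = ((∫⁻ z, maxPow R q (W t) z ^ s) ^ (1 / s)) ^ s := by
            rw [← ENNReal.rpow_mul, one_div_mul_cancel hs0.ne', ENNReal.rpow_one]
        _ ≤ _ := by gcongr; exact le_add_self

/-- A measurable majorant of the weak derivative of `u`, on a ball. -/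
theorem IsSobolevVelocity.exists_majorant {T : ℝ} {p : ℝ≥0∞} (hp : 1 < p)
    {u : ℝ → Eucl d → Eucl d} {Du : ℝ → Eucl d → Eucl d →L[ℝ] Eucl d}
    (hu : IsSobolevVelocity T p u Du) (ρ : ℝ) :
    ∃ W : ℝ → Eucl d → ℝ≥0∞, Measurable (Function.uncurry W) ∧
      (∀ᵐ t ∂volume.restrict (Ioo 0 T), ∀ᵐ x, x ∈ Metric.closedBall 0 ρ → ‖Du t x‖ₑ ≤ W t x) ∧
      ∀ R q : ℝ, 0 < R → 1 ≤ q → ENNReal.ofReal q < p →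
        TimeLpBound T p fun t => maxPow R q (W t) := by
  have hm := aestronglyMeasurable_uncurry_of_periodic hu.periodic_deriv hu.memLp_deriv.1
  set F := hm.mk _
  have hF : Measurable fun q : ℝ × Eucl d => ‖F q‖ₑ := hm.stronglyMeasurable_mk.enorm
  have hFu : ∀ᵐ t ∂volume.restrict (Ioo 0 T), ∀ᵐ x : Eucl d, Du t x = F (t, x) :=
    Measure.ae_ae_of_ae_prod hm.ae_eq_mk
  -- A periodic derivative is in general not in L^p of the whole space. It is cut off to a ball,
  -- later chosen to contain all trajectories from the unit cube with a margin for the averages.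
  set W : ℝ → Eucl d → ℝ≥0∞ := fun t x =>
    (Metric.closedBall (0 : Eucl d) ρ).indicator (fun x => ‖F (t, x)‖ₑ) x
  have hW : Measurable (Function.uncurry W) := by
    have : Function.uncurry W = (Prod.snd ⁻¹' Metric.closedBall (0 : Eucl d) ρ).indicator
        (fun q : ℝ × Eucl d => ‖F q‖ₑ) := by
      ext ⟨t, x⟩
      by_cases hx : x ∈ Metric.closedBall (0 : Eucl d) ρ
      · simp only [Function.uncurry, W, indicator, hx, if_true, mem_preimage]
      · simp only [Function.uncurry, W, indicator, hx, if_false, mem_preimage]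
    rw [this]
    exact hF.indicator (measurable_snd Metric.isClosed_closedBall.measurableSet)
  obtain ⟨N, hNt, hN⟩ := exists_setLIntegral_closedBall_le_torus d ρ
  refine ⟨W, hW, ?_, ?_⟩
  · filter_upwards [hFu] with t ht
    filter_upwards [ht] with x hx hxρ
    simp only [W, indicator_of_mem hxρ, hx, le_refl]
  intro R q hR hq hqp
  refine timeLpBound_maxPow hR hq hqp hW hu.memLp_deriv.2.ne hNt (fun hpt => ?_) fun hpt => ?_
  · subst hpt
    filter_upwards [hFu] with t ht
    have h1 : ∀ᵐ x ∂torusMeasure d, ‖Du t x‖ₑ ≤ eLpNorm (Du t) ⊤ (torusMeasure d) := by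
      rw [eLpNorm_exponent_top]
      exact enorm_ae_le_eLpNormEssSup (Du t) (torusMeasure d)
    filter_upwards [ht, ae_of_periodic (P := fun a => ‖a‖ₑ ≤ eLpNorm (Du t) ⊤ (torusMeasure d))
      (hu.periodic_deriv t) h1] with x hx hx2
    simp only [W]
    refine (indicator_le_self' (fun _ _ => zero_le) x).trans ?_
    rwa [← hx]
  · have hp0 : p ≠ 0 := (zero_lt_one.trans hp).ne'
    filter_upwards [hFu] with t ht
    have hs0 : 0 < p.toReal := ENNReal.toReal_pos hp0 hpt
    have hper : ZPeriodic fun x => ‖Du t x‖ₑ ^ p.toReal := fun i x => by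
      simp only [hu.periodic_deriv t i x]
    calc ∫⁻ z, W t z ^ p.toReal
        = ∫⁻ z in Metric.closedBall 0 ρ, ‖Du t z‖ₑ ^ p.toReal := by
          rw [← lintegral_indicator Metric.isClosed_closedBall.measurableSet]
          refine lintegral_congr_ae ?_
          filter_upwards [ht] with z hz
          by_cases hzρ : z ∈ Metric.closedBall (0 : Eucl d) ρ
          · simp only [W, indicator_of_mem hzρ, hz]
          · simp only [W, indicator_of_notMem hzρ, ENNReal.zero_rpow_of_pos hs0]
      _ ≤ N * ∫⁻ z, ‖Du t z‖ₑ ^ p.toReal ∂torusMeasure d := hN _ hper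
      _ = _ := by
          rw [eLpNorm_eq_lintegral_rpow_enorm_toReal hp0 hpt, ← ENNReal.rpow_mul,
            one_div_mul_cancel hs0.ne', ENNReal.rpow_one]

end TimeIntegrals

/-! ### Measurability and integral equation of the flow. -/

section Flow

variable {d : ℕ} {T : ℝ}

theorem AbsolutelyContinuousOnInterval.comp_lipschitz {X Y : Type*} [PseudoMetricSpace X]
    [PseudoMetricSpace Y] {f : ℝ → X} {a b : ℝ} (hf : AbsolutelyContinuousOnInterval f a b)
    {φ : X → Y} (hφ : LipschitzWith 1 φ) :
    AbsolutelyContinuousOnInterval (fun t => φ (f t)) a b := by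
  rw [absolutelyContinuousOnInterval_iff] at hf ⊢
  intro ε hε
  obtain ⟨δ, hδ, h⟩ := hf ε hε
  refine ⟨δ, hδ, fun E hE hsum => lt_of_le_of_lt (Finset.sum_le_sum fun i _ => ?_) (h E hE hsum)⟩
  simpa using hφ.dist_le_mul (f (E.2 i).1) (f (E.2 i).2)

/-- The fundamental theorem of calculus for absolutely continuous curves in `ℝᵈ`. -/
theorem AbsolutelyContinuousOnInterval.intervalIntegrable_and_integral_eq {γ w : ℝ → Eucl d}
    {a b : ℝ} (hab : a ≤ b) (hγ : AbsolutelyContinuousOnInterval γ a b)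
    (hw : ∀ᵐ t ∂volume.restrict (Ioc a b), HasDerivAt γ (w t) t) :
    IntervalIntegrable w volume a b ∧ ∫ t in a..b, w t = γ b - γ a := by
  have hi : ∀ i, AbsolutelyContinuousOnInterval (fun t => γ t i) a b := fun i =>
    hγ.comp_lipschitz (φ := fun x : Eucl d => x i) (LipschitzWith.of_dist_le_mul fun x y => by
      rw [NNReal.coe_one, one_mul, dist_eq_norm, dist_eq_norm, ← PiLp.sub_apply]
      exact PiLp.norm_apply_le _ i)
  have hd : ∀ i, ∀ᵐ t ∂volume.restrict (Ioc a b), deriv (fun t => γ t i) t = w t i := fun i => by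
    filter_upwards [hw] with t ht
    have h1 : HasDerivAt (fun t => γ t i) _ t :=
      (EuclideanSpace.proj (𝕜 := ℝ) i).hasFDerivAt.comp_hasDerivAt t ht
    simpa using h1.deriv
  have hint : ∀ i, Integrable (fun t => w t i) (volume.restrict (Ioc a b)) := fun i => by
    have h1 := (hi i).intervalIntegrable_deriv
    rw [intervalIntegrable_iff_integrableOn_Ioc_of_le hab] at h1
    exact h1.congr (hd i)
  refine ⟨?_, ?_⟩
  · rw [intervalIntegrable_iff_integrableOn_Ioc_of_le hab]
    exact integrable_piLp_iff.2 hint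
  · ext i
    rw [intervalIntegral.integral_of_le hab, eval_integral_piLp hint i,
      ← integral_congr_ae (hd i), ← intervalIntegral.integral_of_le hab,
      (hi i).integral_deriv_eq_sub, PiLp.sub_apply]

variable {u Φ : ℝ → Eucl d → Eucl d}

/-- A regular Lagrangian flow is jointly measurable in time and space. -/
theorem IsRegularLagrangianFlow.aemeasurable_uncurry (hT : 0 < T)
    (hΦ : IsRegularLagrangianFlow T u Φ) :
    AEMeasurable (fun q : ℝ × Eucl d => Φ q.1 q.2)
      ((volume.restrict (Ioo 0 T)).prod volume) := by
  classical
  -- A measurable version at each time separately. Joint measurability follows by freezing time at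
  -- the grid point of mesh `1 / (n + 1)` just below it and using continuity of trajectories; only
  -- countably many exceptional null sets arise.
  set Ψ : ℝ → Eucl d → Eucl d := fun t =>
    if h : t ∈ Icc 0 T then (hΦ.aemeasurable t h).mk else fun _ => 0
  have hΨ : ∀ t, Measurable (Ψ t) := fun t => by
    by_cases h : t ∈ Icc 0 T
    · simp only [Ψ, dif_pos h]
      exact (hΦ.aemeasurable t h).measurable_mk
    · simp only [Ψ, dif_neg h]
      exact measurable_const
  have hΨΦ : ∀ t ∈ Icc 0 T, ∀ᵐ x, Φ t x = Ψ t x := fun t h => by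
    simp only [Ψ, dif_pos h]
    exact (hΦ.aemeasurable t h).ae_eq_mk
  set τ : ℕ → ℕ → ℝ := fun n k => k / (n + 1)
  have happrox : ∀ n, Measurable fun q : ℝ × Eucl d => Ψ (τ n ⌊q.1 * (n + 1)⌋₊) q.2 := fun n => by
    have h1 : Measurable fun w : ℕ × Eucl d => Ψ (τ n w.1) w.2 :=
      measurable_from_prod_countable_right fun k => hΨ (τ n k)
    have h2 : Measurable fun q : ℝ × Eucl d => (⌊q.1 * (n + 1)⌋₊, q.2) :=
      (Nat.measurable_floor.comp (measurable_fst.mul_const _)).prodMk measurable_snd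
    exact h1.comp h2
  refine aemeasurable_of_tendsto_metrizable_ae atTop (fun n => (happrox n).aemeasurable) ?_
  have hgood : ∀ᵐ x : Eucl d, (∀ n k, τ n k ∈ Icc 0 T → Φ (τ n k) x = Ψ (τ n k) x) ∧
      ContinuousOn (fun t => Φ t x) (Icc 0 T) := by
    refine Eventually.and ?_ ?_
    · refine ae_all_iff.2 fun n => ae_all_iff.2 fun k => ?_
      by_cases h : τ n k ∈ Icc 0 T
      · filter_upwards [hΨΦ _ h] with x hx _ using hx
      · exact Eventually.of_forall fun x hx => absurd hx h
    · filter_upwards [hΦ.solves] with x hx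
      have := hx.2.1.continuousOn
      rwa [uIcc_of_le hT.le] at this
  have hgood' := (Measure.quasiMeasurePreserving_snd (μ := volume.restrict (Ioo 0 T))
    (ν := (volume : Measure (Eucl d)))).ae hgood
  have htime := (Measure.quasiMeasurePreserving_fst (μ := volume.restrict (Ioo 0 T))
    (ν := (volume : Measure (Eucl d)))).ae (ae_restrict_mem measurableSet_Ioo)
  filter_upwards [hgood', htime] with ⟨t, x⟩ ⟨hx1, hx2⟩ ht
  have ht' : t ∈ Icc 0 T := Ioo_subset_Icc_self ht
  have hτle : ∀ n : ℕ, τ n ⌊t * (n + 1)⌋₊ ≤ t := fun n => by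
    have := Nat.floor_le (a := t * ((n : ℝ) + 1)) (mul_nonneg ht'.1 (by positivity))
    simp only [τ]
    rwa [div_le_iff₀ (by positivity)]
  have hτ0 : ∀ n : ℕ, 0 ≤ τ n ⌊t * (n + 1)⌋₊ := fun n => by positivity
  have hτmem : ∀ n : ℕ, τ n ⌊t * (n + 1)⌋₊ ∈ Icc 0 T := fun n => ⟨hτ0 n, (hτle n).trans ht'.2⟩
  have hτlim : Tendsto (fun n : ℕ => τ n ⌊t * (n + 1)⌋₊) atTop (𝓝[Icc 0 T] t) := by
    refine tendsto_nhdsWithin_iff.2 ⟨?_, Eventually.of_forall hτmem⟩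
    have h1 : Tendsto (fun n : ℕ => t - 1 / ((n : ℝ) + 1)) atTop (𝓝 t) := by
      simpa using tendsto_one_div_add_atTop_nhds_zero_nat.const_sub t
    refine tendsto_of_tendsto_of_tendsto_of_le_of_le h1 tendsto_const_nhds (fun n => ?_) hτle
    have := Nat.lt_floor_add_one (t * ((n : ℝ) + 1))
    simp only [τ]
    rw [sub_le_iff_le_add, ← add_div, le_div_iff₀ (by positivity)]
    exact this.le
  refine Tendsto.congr (fun n => hx1 n _ (hτmem n)) ?_
  exact (hx2 t ht').tendsto.comp hτlim

theorem IsRegularLagrangianFlow.exists_lintegral_comp_le (hΦ : IsRegularLagrangianFlow T u Φ) :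
    ∃ L : ℝ≥0, ∀ t ∈ Icc 0 T, ∀ h : Eucl d → ℝ≥0∞, Measurable h →
      ∫⁻ x, h (Φ t x) ≤ L * ∫⁻ x, h x := by
  obtain ⟨L, hL⟩ := hΦ.compressibility
  refine ⟨L, fun t ht h hh => ?_⟩
  rw [← lintegral_map' hh.aemeasurable (hΦ.aemeasurable t ht)]
  calc ∫⁻ x, h x ∂Measure.map (Φ t) volume ≤ ∫⁻ x, h x ∂(L • volume) :=
        lintegral_mono' (hL t ht) le_rfl
    _ = _ := by rw [lintegral_smul_measure]; rfl

/-- Properties that hold almost everywhere hold along almost every trajectory of the flow. -/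
theorem IsRegularLagrangianFlow.ae_ae_comp (hT : 0 < T) (hΦ : IsRegularLagrangianFlow T u Φ)
    {P : ℝ × Eucl d → Prop} (hP : ∀ᵐ q ∂(volume.restrict (Ioo 0 T)).prod volume, P q) :
    ∀ᵐ x, ∀ᵐ s ∂volume.restrict (Ioo 0 T), P (s, Φ s x) := by
  set μ : Measure (ℝ × Eucl d) := (volume.restrict (Ioo 0 T)).prod volume
  have hΦm := hΦ.aemeasurable_uncurry hT
  obtain ⟨L, hL⟩ := hΦ.exists_lintegral_comp_le
  set N := toMeasurable μ {q | ¬ P q}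
  have hN : MeasurableSet N := measurableSet_toMeasurable _ _
  have hN0 : μ N = 0 := by rw [measure_toMeasurable]; exact hP
  set F := hΦm.mk
  have hF : Measurable F := hΦm.measurable_mk
  have hFm : Measurable fun q : ℝ × Eucl d => (q.1, F q) := measurable_fst.prodMk hF
  -- By Fubini it is enough to look at time slices, where bounded compression pulls null sets back
  -- to null sets.
  have hA : μ ((fun q : ℝ × Eucl d => (q.1, F q)) ⁻¹' N) = 0 := by
    rw [Measure.measure_prod_null (hFm hN)]
    filter_upwards [Measure.measure_ae_null_of_prod_null hN0, Measure.ae_ae_of_ae_prod hΦm.ae_eq_mk,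
      ae_restrict_mem measurableSet_Ioo] with s hs1 hs2 hs3
    have hNs : MeasurableSet (Prod.mk s ⁻¹' N) := measurable_prodMk_left hN
    have h1 := hL s (Ioo_subset_Icc_self hs3) ((Prod.mk s ⁻¹' N).indicator 1)
      (measurable_one.indicator hNs)
    rw [lintegral_indicator_one hNs, hs1, Pi.zero_apply, mul_zero, nonpos_iff_eq_zero] at h1
    have h2 : ∫⁻ x, (Prod.mk s ⁻¹' N).indicator (1 : Eucl d → ℝ≥0∞) (F (s, x)) = 0 := by
      rw [← h1]
      refine lintegral_congr_ae ?_
      filter_upwards [hs2] with x hx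
      rw [show F (s, x) = Φ s x from hx.symm]
    have h3 : MeasurableSet (Prod.mk s ⁻¹' ((fun q : ℝ × Eucl d => (q.1, F q)) ⁻¹' N)) :=
      measurable_prodMk_left (hFm hN)
    rw [Pi.zero_apply, ← lintegral_indicator_one h3, ← h2]
    rfl
  have hall : ∀ᵐ q ∂μ, P (q.1, Φ q.1 q.2) := by
    have hA' : ∀ᵐ q ∂μ, (q.1, F q) ∉ N := measure_eq_zero_iff_ae_notMem.1 hA
    filter_upwards [hA', hΦm.ae_eq_mk] with q hq1 hq2
    by_contra hcon
    rw [hq2] at hcon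
    exact hq1 (subset_toMeasurable μ {q | ¬ P q} hcon)
  have hswap := (Measure.measurePreserving_swap (μ := (volume : Measure (Eucl d)))
    (ν := volume.restrict (Ioo 0 T))).quasiMeasurePreserving.ae hall
  exact Measure.ae_ae_of_ae_prod hswap

/-- The integral form of the differential equation, and the bound on the displacement. -/
theorem IsRegularLagrangianFlow.ae_integral_eq (hT : 0 < T) (hΦ : IsRegularLagrangianFlow T u Φ)
    {U : ℝ} (hU : ∀ᵐ q ∂(volume.restrict (Ioo 0 T)).prod (volume : Measure (Eucl d)),
      ‖u q.1 q.2‖ ≤ U) :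
    ∀ᵐ x, Φ 0 x = x ∧ ∀ a b, 0 ≤ a → a ≤ b → b ≤ T →
      IntervalIntegrable (fun s => u s (Φ s x)) volume a b ∧
      ∫ s in a..b, u s (Φ s x) = Φ b x - Φ a x ∧ ‖Φ b x - Φ a x‖ ≤ U * (b - a) := by
  filter_upwards [hΦ.solves, hΦ.ae_ae_comp hT hU] with x hx hxU
  refine ⟨hx.1, fun a b ha hab hb => ?_⟩
  have hle : volume.restrict (Ioc a b) ≤ volume.restrict (Ioo (0 : ℝ) T) := by
    rw [← restrict_Ioo_eq_restrict_Ioc]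
    exact Measure.restrict_mono (Ioo_subset_Ioo ha hb) le_rfl
  have hac : AbsolutelyContinuousOnInterval (fun t => Φ t x) a b := by
    refine hx.2.1.mono ?_
    rw [uIcc_of_le hab, uIcc_of_le hT.le]
    exact Icc_subset_Icc ha hb
  obtain ⟨h1, h2⟩ := hac.intervalIntegrable_and_integral_eq hab (ae_mono hle hx.2.2)
  refine ⟨h1, h2, ?_⟩
  rw [← h2]
  have h3 := intervalIntegral.norm_integral_le_of_norm_le_const_ae (a := a) (b := b) (C := U)
    (f := fun s => u s (Φ s x)) (by
      rw [uIoc_of_le hab]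
      exact (ae_restrict_iff' measurableSet_Ioc).1 (ae_mono hle hxU))
  rwa [abs_of_nonneg (sub_nonneg.2 hab)] at h3

end Flow

/-! ### Measurability and bounds for the velocities. -/

section Velocity

variable {d : ℕ} {T : ℝ} {p : ℝ≥0∞} {u : ℝ → Eucl d → Eucl d}
  {Du : ℝ → Eucl d → Eucl d →L[ℝ] Eucl d} {η : Eucl d → ℝ}

theorem IsSobolevVelocity.aestronglyMeasurable (hu : IsSobolevVelocity T p u Du) :
    AEStronglyMeasurable (Function.uncurry u) ((volume.restrict (Ioo 0 T)).prod volume) :=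
  aestronglyMeasurable_uncurry_of_periodic hu.periodic hu.memLp.1

theorem IsSobolevVelocity.exists_bound (hu : IsSobolevVelocity T p u Du) :
    ∃ U : ℝ, 0 < U ∧ ∀ᵐ q ∂(volume.restrict (Ioo 0 T)).prod (volume : Measure (Eucl d)),
      ‖u q.1 q.2‖ ≤ U := by
  have hfin : eLpNormEssSup (Function.uncurry u) (timeTorusMeasure d T) < ⊤ := by
    rw [← eLpNorm_exponent_top]; exact hu.bounded.2
  set M := (eLpNormEssSup (Function.uncurry u) (timeTorusMeasure d T)).toReal
  refine ⟨M + 1, by positivity, ae_prod_of_periodic (P := fun a => ‖a‖ ≤ M + 1) hu.periodic ?_⟩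
  filter_upwards [enorm_ae_le_eLpNormEssSup (Function.uncurry u) (timeTorusMeasure d T)] with q hq
  have h1 := ENNReal.toReal_mono hfin.ne hq
  rw [toReal_enorm] at h1
  exact h1.trans (by simp [M])

theorem stronglyMeasurable_mollify (hη : IsStandardMollifier η) {F : ℝ × Eucl d → Eucl d}
    (hF : StronglyMeasurable F) (r : ℝ) :
    StronglyMeasurable fun q : ℝ × Eucl d => mollify η r (fun x => F (q.1, x)) q.2 := by
  have h1 : StronglyMeasurable fun w : (ℝ × Eucl d) × Eucl d =>
      scaledKernel η r w.2 • F (w.1.1, w.1.2 - w.2) := by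
    have h2 : StronglyMeasurable fun w : (ℝ × Eucl d) × Eucl d => scaledKernel η r w.2 :=
      ((contDiff_scaledKernel hη r).continuous.comp continuous_snd).stronglyMeasurable
    have h3 : StronglyMeasurable fun w : (ℝ × Eucl d) × Eucl d => F (w.1.1, w.1.2 - w.2) :=
      hF.comp_measurable (by fun_prop)
    exact h2.smul h3
  exact h1.integral_prod_right

/-- Almost everywhere convergence of the mollifications, jointly in time and space. -/
theorem IsSobolevVelocity.ae_tendsto_mollify (hη : IsStandardMollifier η)
    (hu : IsSobolevVelocity T p u Du) :
    ∀ᵐ q ∂(volume.restrict (Ioo 0 T)).prod (volume : Measure (Eucl d)),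
      Tendsto (fun k : ℕ => mollify η ((1 / 2) ^ k) (u q.1) q.2) atTop (𝓝 (u q.1 q.2)) := by
  have hm := hu.aestronglyMeasurable
  set F := hm.mk _
  have hF : StronglyMeasurable F := hm.stronglyMeasurable_mk
  have hFu : ∀ᵐ t ∂volume.restrict (Ioo 0 T), ∀ᵐ x : Eucl d, u t x = F (t, x) :=
    Measure.ae_ae_of_ae_prod hm.ae_eq_mk
  -- Convergence is known on almost every time slice. Measurability of the convergence set for a
  -- jointly measurable version is what upgrades this to almost every pair.
  have hmeas : MeasurableSet {q : ℝ × Eucl d | Tendsto (fun k : ℕ =>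
      mollify η ((1 / 2) ^ k) (fun x => F (q.1, x)) q.2) atTop (𝓝 (F q))} :=
    measurableSet_tendsto_fun (fun k => (stronglyMeasurable_mollify hη hF _).measurable)
      hF.measurable
  have h1 : ∀ᵐ q ∂(volume.restrict (Ioo 0 T)).prod (volume : Measure (Eucl d)),
      Tendsto (fun k : ℕ => mollify η ((1 / 2) ^ k) (fun x => F (q.1, x)) q.2) atTop
        (𝓝 (F q)) := by
    rw [Measure.ae_prod_iff_ae_ae hmeas]
    filter_upwards [hFu, hu.weakDeriv] with t ht hd
    filter_upwards [_root_.ae_tendsto_mollify hη hd.1, ht] with x hx hx2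
    rw [← hx2]
    exact hx.congr fun k => mollify_congr_ae ht η _ x
  have h2 := (Measure.quasiMeasurePreserving_fst (μ := volume.restrict (Ioo 0 T))
    (ν := (volume : Measure (Eucl d)))).ae hFu
  filter_upwards [h1, h2, hm.ae_eq_mk] with q hq1 hq2 hq3
  have hq3' : u q.1 q.2 = F q := hq3
  rw [hq3']
  exact hq1.congr fun k => (mollify_congr_ae hq2 η _ q.2).symm

theorem IsSobolevVelocity.aestronglyMeasurable_mollify (hη : IsStandardMollifier η)
    (hu : IsSobolevVelocity T p u Du) (r : ℝ) (y : Eucl d) :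
    AEStronglyMeasurable (fun s => mollify η r (u s) y) (volume.restrict (Ioo 0 T)) := by
  have hm := hu.aestronglyMeasurable
  set F := hm.mk _
  have hF : StronglyMeasurable F := hm.stronglyMeasurable_mk
  have hFu : ∀ᵐ t ∂volume.restrict (Ioo 0 T), ∀ᵐ x : Eucl d, u t x = F (t, x) :=
    Measure.ae_ae_of_ae_prod hm.ae_eq_mk
  refine ⟨fun s => mollify η r (fun x => F (s, x)) y,
    (stronglyMeasurable_mollify hη hF r).comp_measurable (measurable_prodMk_right (y := y)), ?_⟩
  filter_upwards [hFu] with s hs using mollify_congr_ae hs η r y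

theorem IsSobolevVelocity.ae_bound {U : ℝ}
    (hU : ∀ᵐ q ∂(volume.restrict (Ioo 0 T)).prod (volume : Measure (Eucl d)), ‖u q.1 q.2‖ ≤ U) :
    ∀ᵐ s ∂volume.restrict (Ioo 0 T), ∀ᵐ x : Eucl d, ‖u s x‖ ≤ U :=
  Measure.ae_ae_of_ae_prod hU

/-- An exponent strictly between: `q > d` serves Morrey's inequality, `q < p` the strong type
inequality for the maximal function of order `q`. -/
theorem exists_exponent {d : ℕ} {p : ℝ≥0∞} (hd : 1 ≤ d) (hdp : (d : ℝ≥0∞) < p) :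
    ∃ q : ℝ, 1 ≤ q ∧ (d : ℝ) < q ∧ ENNReal.ofReal q < p := by
  obtain ⟨q, hq1, hq2⟩ := ENNReal.lt_iff_exists_nnreal_btwn.1 hdp
  have h1 : (d : ℝ) < q := by
    have : ((d : ℝ≥0) : ℝ≥0∞) < q := by simpa using hq1
    exact_mod_cast ENNReal.coe_lt_coe.1 this
  have h2 : (1 : ℝ) ≤ d := by exact_mod_cast hd
  exact ⟨q, by linarith, h1, by rwa [ENNReal.ofReal_coe_nnreal]⟩

/-- For `p > d`, almost every `u(t,·)` has a continuous representative. -/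
theorem IsSobolevVelocity.ae_contRep_spec (hd : 1 ≤ d) (hη : IsStandardMollifier η)
    (hu : IsSobolevVelocity T p u Du) (hdp : (d : ℝ≥0∞) < p) :
    ∀ᵐ t ∂volume.restrict (Ioo 0 T), Continuous (contRep (u t)) ∧
      contRep (u t) =ᵐ[volume] u t := by
  obtain ⟨q, hq1, hqd, hqp⟩ := exists_exponent hd hdp
  have hm := aestronglyMeasurable_uncurry_of_periodic hu.periodic_deriv hu.memLp_deriv.1
  set F := hm.mk _
  have hF : StronglyMeasurable F := hm.stronglyMeasurable_mk
  have hFu : ∀ᵐ t ∂volume.restrict (Ioo 0 T), ∀ᵐ x : Eucl d, Du t x = F (t, x) :=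
    Measure.ae_ae_of_ae_prod hm.ae_eq_mk
  have hmt : ∀ᵐ t ∂volume.restrict (Ioo 0 T),
      AEStronglyMeasurable (Du t) (torusMeasure d) := by
    exact hu.memLp_deriv.1.prodMk_left
  -- The torus has finite measure, so the `q`-norm is controlled by the `p`-norm. As `q` is finite,
  -- the norm is a power of an integral and hence measurable in time, also when `p = ⊤`.
  have hfin : ∀ᵐ t ∂volume.restrict (Ioo 0 T), eLpNorm (Du t) (ENNReal.ofReal q)
      (torusMeasure d) < ⊤ := by
    have h1 : ∫⁻ t in Ioo 0 T, eLpNorm (Du t) (ENNReal.ofReal q) (torusMeasure d) ≠ ⊤ := by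
      have hle : ∀ᵐ t ∂volume.restrict (Ioo 0 T),
          eLpNorm (Du t) (ENNReal.ofReal q) (torusMeasure d) ≤
          eLpNorm (Du t) p (torusMeasure d) *
            torusMeasure d univ ^ (1 / (ENNReal.ofReal q).toReal - 1 / p.toReal) := by
        filter_upwards [hmt] with t ht using
          eLpNorm_le_eLpNorm_mul_rpow_measure_univ hqp.le ht
      refine ((lintegral_mono_ae hle).trans_lt ?_).ne
      have hc : torusMeasure d univ ^ (1 / (ENNReal.ofReal q).toReal - 1 / p.toReal) ≠ ⊤ := by
        refine ENNReal.rpow_ne_top_of_nonneg ?_ (measure_ne_top _ _)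
        rw [ENNReal.toReal_ofReal (by linarith), sub_nonneg]
        rcases eq_or_ne p ⊤ with rfl | hp
        · simp; linarith
        · have := (ENNReal.toReal_lt_toReal ENNReal.ofReal_ne_top hp).2 hqp
          rw [ENNReal.toReal_ofReal (by linarith)] at this
          exact one_div_le_one_div_of_le (by linarith) this.le
      rw [lintegral_mul_const' _ _ hc]
      exact ENNReal.mul_lt_top hu.memLp_deriv.2 hc.lt_top
    have hmeas : AEMeasurable (fun t => eLpNorm (Du t) (ENNReal.ofReal q) (torusMeasure d))
        (volume.restrict (Ioo 0 T)) := by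
      have h2 : ∀ t, eLpNorm (Du t) (ENNReal.ofReal q) (torusMeasure d) =
          (∫⁻ x, ‖Du t x‖ₑ ^ q ∂torusMeasure d) ^ (1 / q) := fun t => by
        rw [eLpNorm_eq_lintegral_rpow_enorm_toReal (by simp; linarith) ENNReal.ofReal_ne_top,
          ENNReal.toReal_ofReal (by linarith)]
      simp_rw [h2]
      exact ((hu.memLp_deriv.1.enorm.pow_const q).lintegral_prod_right').pow_const _
    exact ae_lt_top' hmeas h1
  filter_upwards [hFu, hfin, hu.weakDeriv] with t ht1 ht2 ht3
  refine contRep_spec_of_hasWeakDeriv hη hq1 hqd ht3 (W := fun x => ‖F (t, x)‖ₑ)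
    (hF.enorm.comp measurable_prodMk_left) (ht1.mono fun x hx => by rw [hx]) fun m => ?_
  obtain ⟨N, hNt, hN⟩ := exists_setLIntegral_closedBall_le_torus d (m : ℝ)
  have hper : ZPeriodic fun x => ‖Du t x‖ₑ ^ q := fun i x => by
    simp only [hu.periodic_deriv t i x]
  have h1 : ∫⁻ x in Metric.closedBall 0 (m : ℝ), ‖F (t, x)‖ₑ ^ q =
      ∫⁻ x in Metric.closedBall 0 (m : ℝ), ‖Du t x‖ₑ ^ q := by
    refine lintegral_congr_ae (ae_restrict_of_ae ?_)
    filter_upwards [ht1] with x hx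
    rw [hx]
  rw [h1]
  refine ((hN _ hper).trans_lt (ENNReal.mul_lt_top hNt.lt_top ?_)).ne
  have h3 := lintegral_rpow_enorm_lt_top_of_eLpNorm_lt_top (by simp; linarith)
    ENNReal.ofReal_ne_top ht2
  rwa [ENNReal.toReal_ofReal (by linarith)] at h3

/-- The velocity of the Euler scheme is measurable in time and bounded. -/
theorem IsSobolevVelocity.eulerVelocity_spec (hd : 1 ≤ d) (hη : IsStandardMollifier η)
    (hu : IsSobolevVelocity T p u Du) {U : ℝ}
    (hU : ∀ᵐ q ∂(volume.restrict (Ioo 0 T)).prod (volume : Measure (Eucl d)), ‖u q.1 q.2‖ ≤ U)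
    {δ : ℝ} (hδ : 0 < δ) :
    (∀ y, AEStronglyMeasurable (fun s => eulerVelocity p η δ u s y) (volume.restrict (Ioo 0 T))) ∧
    ∀ᵐ s ∂volume.restrict (Ioo 0 T), ∀ y, ‖eulerVelocity p η δ u s y‖ ≤ U := by
  by_cases hpd : p ≤ (d : ℝ≥0∞)
  · simp only [eulerVelocity, if_pos hpd]
    refine ⟨fun y => hu.aestronglyMeasurable_mollify hη δ y, ?_⟩
    filter_upwards [IsSobolevVelocity.ae_bound hU] with s hs y using norm_mollify_le hη hδ hs y
  · simp only [eulerVelocity, if_neg hpd]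
    have hrep := hu.ae_contRep_spec hd hη (not_le.1 hpd)
    refine ⟨fun y => ?_, ?_⟩
    · refine aestronglyMeasurable_of_tendsto_ae atTop
        (fun k : ℕ => hu.aestronglyMeasurable_mollify hη ((1 / 2) ^ k) y) ?_
      filter_upwards [hrep] with s hs using tendsto_mollify_contRep hη hs y
    · filter_upwards [hrep, IsSobolevVelocity.ae_bound hU] with s hs1 hs2 y
      refine le_of_tendsto (tendsto_mollify_contRep hη hs1 y).norm (Eventually.of_forall fun k => ?_)
      exact norm_mollify_le hη (by positivity) hs2 y

end Velocity

/-! ### Expansion of the determinant at the identity. -/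

section Determinant

variable {d : ℕ}

/-- The sum of the diagonal entries of an endomorphism of `ℝᵈ`. -/
noncomputable def diagSum (A : Eucl d →L[ℝ] Eucl d) : ℝ :=
  ∑ i, (A (EuclideanSpace.single i (1 : ℝ))) i

theorem det_one_add_eq (A : Eucl d →L[ℝ] Eucl d) :
    (ContinuousLinearMap.id ℝ (Eucl d) + A).det =
      (1 + Matrix.of fun i j => (A (EuclideanSpace.single j (1 : ℝ))) i).det := by
  rw [ContinuousLinearMap.det, ← LinearMap.det_toMatrix (EuclideanSpace.basisFun (Fin d) ℝ).toBasis]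
  congr 1
  ext i j
  simp [LinearMap.toMatrix_apply, Matrix.one_apply]

/-- The determinant is polynomial in the entries, its derivative at the identity is the trace, and a
locally Lipschitz derivative makes the first-order remainder quadratic. -/
theorem exists_det_one_add_ge (d : ℕ) :
    ∃ ε K : ℝ, 0 < ε ∧ 0 ≤ K ∧ ∀ A : Eucl d →L[ℝ] Eucl d, ‖A‖ ≤ ε →
      1 + diagSum A - K * ‖A‖ ^ 2 ≤ (ContinuousLinearMap.id ℝ (Eucl d) + A).det := by
  set f : (Eucl d →L[ℝ] Eucl d) → ℝ := fun A => (ContinuousLinearMap.id ℝ (Eucl d) + A).det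
  have hf : ContDiff ℝ 2 f := by
    have h1 : f = fun A => ∑ σ : Equiv.Perm (Fin d), ((Equiv.Perm.sign σ : ℤ) : ℝ) *
        ∏ i, ((1 : Matrix (Fin d) (Fin d) ℝ) (σ i) i +
          (A (EuclideanSpace.single i (1 : ℝ))) (σ i)) := by
      ext A
      simp only [f, det_one_add_eq, Matrix.det_apply', Matrix.add_apply, Matrix.of_apply]
    rw [h1]
    refine ContDiff.sum fun σ _ => contDiff_const.mul (contDiff_prod fun i _ => ?_)
    refine contDiff_const.add ?_
    exact (EuclideanSpace.proj (𝕜 := ℝ) (σ i)).contDiff.comp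
      (ContinuousLinearMap.apply ℝ (Eucl d) (EuclideanSpace.single i (1 : ℝ))).contDiff
  have hf0 : f 0 = 1 := by simp [f, ContinuousLinearMap.det]
  have hd : Differentiable ℝ f := hf.differentiable (by norm_num)
  have htr : ∀ A, fderiv ℝ f 0 A = diagSum A := by
    intro A
    have h1 : HasDerivAt (fun t : ℝ => f (t • A)) (fderiv ℝ f 0 A) 0 := by
      have := (hd 0).hasFDerivAt.hasLineDerivAt A
      simpa [HasLineDerivAt] using this
    set M : Matrix (Fin d) (Fin d) ℝ :=
      Matrix.of fun i j => (A (EuclideanSpace.single j (1 : ℝ))) i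
    -- The quotient in `det (1 + t M) = 1 + t tr M + t² P(t)`, which shows that the derivative at `t
    -- = 0` is the trace.
    set P := (Matrix.det (1 + (Polynomial.X : Polynomial ℝ) • M.map Polynomial.C)).divX.divX
    have h2 : (fun t : ℝ => f (t • A)) = fun t => 1 + M.trace * t + P.eval t * t ^ 2 := by
      ext t
      rw [← Matrix.det_one_add_smul]
      simp only [f, det_one_add_eq]
      congr 1
    have h3 : HasDerivAt (fun t : ℝ => 1 + M.trace * t + P.eval t * t ^ 2) M.trace 0 := by
      have h4 := (((hasDerivAt_id (0 : ℝ)).const_mul M.trace).const_add 1).add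
        ((P.hasDerivAt 0).mul ((hasDerivAt_id (0 : ℝ)).pow 2))
      refine h4.congr_deriv ?_
      simp
    rw [h2] at h1
    rw [h1.unique h3]
    rfl
  obtain ⟨K, s, hs, hK⟩ := (hf.fderiv_right (m := 1) (by norm_num)).contDiffAt
    (x := (0 : Eucl d →L[ℝ] Eucl d)).exists_lipschitzOnWith
  obtain ⟨ε, hε, hεs⟩ := Metric.nhds_basis_closedBall.mem_iff.1 hs
  refine ⟨ε, K, hε, K.2, fun A hA => ?_⟩
  have hmain := (convex_closedBall (0 : Eucl d →L[ℝ] Eucl d) ‖A‖).norm_image_sub_le_of_norm_hasFDerivWithin_le'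
    (f := f) (f' := fun B => fderiv ℝ f B) (φ := fderiv ℝ f 0) (C := K * ‖A‖)
    (x := 0) (y := A)
    (fun B _ => (hd B).hasFDerivAt.hasFDerivWithinAt) (fun B hB => by
      rw [mem_closedBall_zero_iff] at hB
      have := hK.norm_sub_le (hεs (mem_closedBall_zero_iff.2 (hB.trans hA)))
        (hεs (Metric.mem_closedBall_self hε.le))
      rw [sub_zero] at this
      exact this.trans (mul_le_mul_of_nonneg_left hB K.2))
    (Metric.mem_closedBall_self (norm_nonneg _)) (by simp)
  rw [sub_zero, htr, hf0, Real.norm_eq_abs] at hmain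
  have := (abs_le.1 hmain).1
  simp only [f] at this
  nlinarith

end Determinant

/-! ### Volume compression by perturbations of the identity. -/

section StepMap

variable {d : ℕ}

/-- A map close to the identity with Jacobian bounded below compresses volume by at most a constant
factor. -/
theorem lintegral_comp_id_add_le {g : Eucl d → Eucl d} {A : Eucl d → Eucl d →L[ℝ] Eucl d}
    (hg : ∀ y, HasFDerivAt g (A y) y) (hA : ∀ y, ‖A y‖ ≤ 1 / 2) {c : ℝ} (hc : 0 < c)
    (hdet : ∀ y, c ≤ (ContinuousLinearMap.id ℝ (Eucl d) + A y).det) (f : Eucl d → ℝ≥0∞) :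
    ∫⁻ y, f (y + g y) ≤ ENNReal.ofReal c⁻¹ * ∫⁻ y, f y := by
  -- The perturbation is 1/2-Lipschitz, so the map is injective and the change of variables formula
  -- applies.
  have hinj : InjOn (fun y => y + g y) univ := by
    intro y _ z _ hyz
    have h1 : y - z = g z - g y := by
      have : y + g y = z + g z := hyz
      rw [sub_eq_sub_iff_add_eq_add, this, add_comm]
    have h2 : ‖g z - g y‖ ≤ 1 / 2 * ‖z - y‖ :=
      convex_univ.norm_image_sub_le_of_norm_hasFDerivWithin_le
        (fun x _ => (hg x).hasFDerivWithinAt) (fun x _ => hA x) (mem_univ _) (mem_univ _)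
    rw [← h1, norm_sub_rev z y] at h2
    have h3 : ‖y - z‖ = 0 := by linarith [norm_nonneg (y - z)]
    exact sub_eq_zero.1 (norm_eq_zero.1 h3)
  have hcv := lintegral_image_eq_lintegral_abs_det_fderiv_mul volume MeasurableSet.univ
    (fun y _ => ((hasFDerivAt_id y).add (hg y)).hasFDerivWithinAt) hinj f
  calc ∫⁻ y, f (y + g y) ≤ ∫⁻ y, ENNReal.ofReal c⁻¹ *
        (ENNReal.ofReal |(ContinuousLinearMap.id ℝ (Eucl d) + A y).det| * f (y + g y)) := by
        refine lintegral_mono fun y => ?_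
        rw [← mul_assoc, ← ENNReal.ofReal_mul (by positivity)]
        refine le_mul_of_one_le_left' ?_
        rw [ENNReal.one_le_ofReal, ← div_eq_inv_mul, one_le_div hc]
        exact (hdet y).trans (le_abs_self _)
    _ = ENNReal.ofReal c⁻¹ *
        ∫⁻ x in (fun y => y + g y) '' univ, f x := by
        rw [lintegral_const_mul' _ _ ENNReal.ofReal_ne_top]
        congr 1
        rw [← setLIntegral_univ]
        exact hcv.symm
    _ ≤ _ := by gcongr; exact Measure.restrict_le_self

end StepMap

/-! ### Gradient and divergence of the mollified velocity. -/

section MollifiedDerivative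

variable {d : ℕ} {η : Eucl d → ℝ}

/-- Two formulas for one derivative. With the weak derivative inside, the lower bound on the
divergence is inherited; with the derivative on the kernel, boundedness of `v` gives a gradient of
order `1 / r`. -/
theorem hasFDerivAt_mollify (hη : IsStandardMollifier η) {v : Eucl d → Eucl d}
    {G : Eucl d → Eucl d →L[ℝ] Eucl d} (hv : HasWeakDeriv v G) {r : ℝ} (hr : 0 < r)
    (x : Eucl d) :
    HasFDerivAt (mollify η r v) (fderiv ℝ (mollify η r v) x) x ∧
      ∀ a, fderiv ℝ (mollify η r v) x a = ∫ y, scaledKernel η r (x - y) • G y a ∧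
        fderiv ℝ (mollify η r v) x a = ∫ y, (fderiv ℝ (scaledKernel η r) (x - y) a) • v y := by
  obtain ⟨D, hD, hD'⟩ := exists_hasFDerivAt_mollify hη hv.1 hr x
  have h1 : HasFDerivAt (mollify η r v) (D.comp (ContinuousLinearMap.inr ℝ ℝ (Eucl d))) x :=
    HasFDerivAt.comp (g := fun q : ℝ × Eucl d => mollify η q.1 v q.2) x hD
      (hasFDerivAt_prodMk_right r x)
  refine ⟨h1.differentiableAt.hasFDerivAt, fun a => ?_⟩
  have h2 : fderiv ℝ (mollify η r v) x a = D (0, a) := by rw [h1.fderiv]; rfl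
  refine ⟨?_, ?_⟩
  · rw [h2, hD', integral_fderiv_uncurry_scaledKernel hη hv hr]
    simp
  · rw [h2, hD']
    refine integral_congr_ae (Eventually.of_forall fun y => ?_)
    simp only [fderiv_uncurry_scaledKernel hη hr]
    simp

/-- The gradient of a mollified bounded function is of the order of the inverse scale. -/
theorem exists_norm_fderiv_mollify_le (hη : IsStandardMollifier η) :
    ∃ C : ℝ, 0 ≤ C ∧ ∀ (v : Eucl d → Eucl d) (G : Eucl d → Eucl d →L[ℝ] Eucl d) (r U : ℝ)
      (x : Eucl d), HasWeakDeriv v G → 0 < r → 0 ≤ U → (∀ᵐ y, ‖v y‖ ≤ U) →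
      ‖fderiv ℝ (mollify η r v) x‖ ≤ C * U / r := by
  have hc : HasCompactSupport η :=
    (isCompact_closedBall (0 : Eucl d) 1).of_isClosed_subset (isClosed_tsupport η) hη.support
  have hint : Integrable fun z => ‖fderiv ℝ η z‖ :=
    ((hη.smooth.continuous_fderiv (by simp)).norm).integrable_of_hasCompactSupport
      (hc.fderiv ℝ).norm
  refine ⟨∫ z, ‖fderiv ℝ η z‖, integral_nonneg fun _ => norm_nonneg _, ?_⟩
  intro v G r U x hv hr hU0 hU
  have hK : ∀ z, fderiv ℝ (scaledKernel η r) z = ((r ^ d)⁻¹ * r⁻¹) • fderiv ℝ η (r⁻¹ • z) := by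
    intro z
    have hd : Differentiable ℝ η := hη.smooth.differentiable (by simp)
    have h := ((hd (r⁻¹ • z)).hasFDerivAt.comp z
      ((hasFDerivAt_id z).const_smul r⁻¹)).const_mul (r ^ d)⁻¹
    have h' : HasFDerivAt (scaledKernel η r) _ z := h
    rw [h'.fderiv]
    ext w
    simp [mul_assoc]
  have hKn : ∀ z, ‖fderiv ℝ (scaledKernel η r) z‖ =
      ((r ^ d)⁻¹ * r⁻¹) * ‖fderiv ℝ η (r⁻¹ • z)‖ := fun z => by
    rw [hK, norm_smul, Real.norm_of_nonneg (by positivity)]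
  have hKint : Integrable fun z => ‖fderiv ℝ (scaledKernel η r) z‖ := by
    simp_rw [hKn]
    exact (hint.comp_smul (by positivity)).const_mul _
  have hKval : ∫ z, ‖fderiv ℝ (scaledKernel η r) z‖ = r⁻¹ * ∫ z, ‖fderiv ℝ η z‖ := by
    simp_rw [hKn]
    rw [integral_const_mul, Measure.integral_comp_inv_smul volume (fun z => ‖fderiv ℝ η z‖) r]
    simp [abs_of_pos hr]
    field_simp
  refine ContinuousLinearMap.opNorm_le_bound _ (by positivity) fun a => ?_
  rw [((hasFDerivAt_mollify hη hv hr x).2 a).2]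
  have h1 := norm_integral_le_of_norm_le
    (f := fun y => (fderiv ℝ (scaledKernel η r) (x - y) a) • v y)
    (((hKint.comp_sub_left x).mul_const (‖a‖ * U))) (by
      filter_upwards [hU] with y hy
      rw [norm_smul, ← mul_assoc]
      exact mul_le_mul (ContinuousLinearMap.le_opNorm _ _) hy (norm_nonneg _) (by positivity))
  refine h1.trans_eq ?_
  rw [integral_mul_const,
    integral_sub_left_eq_self (fun z => ‖fderiv ℝ (scaledKernel η r) z‖) volume x, hKval]
  field_simp

/-- The divergence of a mollification is bounded below by the lower bound of the weak divergence. -/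
theorem diagSum_fderiv_mollify_ge (hη : IsStandardMollifier η) {v : Eucl d → Eucl d}
    {G : Eucl d → Eucl d →L[ℝ] Eucl d} (hv : HasWeakDeriv v G) {r : ℝ} (hr : 0 < r)
    {D : ℝ} (hD : ∀ᵐ y, -D ≤ diagSum (G y)) (x : Eucl d) :
    -D ≤ diagSum (fderiv ℝ (mollify η r v) x) := by
  have hint : ∀ a, Integrable fun y => scaledKernel η r (x - y) • G y a := fun a => by
    have h1 : Integrable fun y => scaledKernel η r (x - y) • G y := by
      refine hv.2.1.integrable_smul_left_of_hasCompactSupport ?_ ?_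
      · exact (contDiff_scaledKernel hη r).continuous.comp (continuous_const.sub continuous_id)
      · exact (hasCompactSupport_scaledKernel hη hr).comp_homeomorph (Homeomorph.subLeft x)
    exact h1.apply_continuousLinearMap a
  have hinti : ∀ i, Integrable fun y =>
      scaledKernel η r (x - y) * (G y (EuclideanSpace.single i (1 : ℝ))) i := fun i =>
    (EuclideanSpace.proj (𝕜 := ℝ) i).integrable_comp (hint (EuclideanSpace.single i (1 : ℝ)))
  have h1 : diagSum (fderiv ℝ (mollify η r v) x) =
      ∫ y, scaledKernel η r (x - y) * diagSum (G y) := by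
    simp only [diagSum, Finset.mul_sum]
    rw [integral_finsetSum _ fun i _ => hinti i]
    refine Finset.sum_congr rfl fun i _ => ?_
    rw [((hasFDerivAt_mollify hη hv hr x).2 _).1]
    exact ((EuclideanSpace.proj (𝕜 := ℝ) i).integral_comp_comm
      (hint (EuclideanSpace.single i (1 : ℝ)))).symm
  have h2 : ∫ y, scaledKernel η r (x - y) * (-D) = -D := by
    rw [integral_mul_const, integral_scaledKernel_sub hη hr, one_mul]
  rw [h1, ← h2]
  refine integral_mono_ae ((integrable_scaledKernel_sub hη hr x).mul_const _) ?_ ?_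
  · simp only [diagSum, Finset.mul_sum]
    exact integrable_finsetSum _ fun i _ => hinti i
  · filter_upwards [hD] with y hy
    exact mul_le_mul_of_nonneg_left hy (scaledKernel_nonneg hη hr _)

end MollifiedDerivative

/-! ### Differential of one Euler step. -/

section EulerStep

variable {d : ℕ} {T : ℝ} {p : ℝ≥0∞} {u : ℝ → Eucl d → Eucl d}
  {Du : ℝ → Eucl d → Eucl d →L[ℝ] Eucl d} {η : Eucl d → ℝ}

theorem eulerStep_eq (v : ℝ → Eucl d → Eucl d) {h : ℝ} (hh : 0 < h) (n : ℕ) (y : Eucl d) :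
    eulerStep v h n h y = y + ∫ s in ((n : ℝ) * h)..(((n : ℝ) + 1) * h), v s y := by
  rw [eulerStep, interval_average_eq, smul_smul]
  congr 1
  rw [show ((n : ℝ) + 1) * h - n * h = h by ring, mul_inv_cancel₀ hh.ne', one_smul]

theorem restrict_uIoc_le {a b : ℝ} (ha : 0 ≤ a) (hab : a ≤ b) (hb : b ≤ T) :
    (volume : Measure ℝ).restrict (uIoc a b) ≤ volume.restrict (Ioo 0 T) := by
  rw [uIoc_of_le hab, ← restrict_Ioo_eq_restrict_Ioc]
  exact Measure.restrict_mono (Ioo_subset_Ioo ha hb) le_rfl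

theorem IsSobolevVelocity.exists_diagSum_ge (hu : IsSobolevVelocity T p u Du)
    (hdiv : MemLinfty T (negDiv Du)) :
    ∃ D : ℝ, 0 ≤ D ∧ ∀ᵐ s ∂volume.restrict (Ioo 0 T), ∀ᵐ x, -D ≤ diagSum (Du s x) := by
  have hfin : eLpNormEssSup (Function.uncurry (negDiv Du)) (timeTorusMeasure d T) < ⊤ := by
    rw [← eLpNorm_exponent_top]; exact hdiv.2
  set M := (eLpNormEssSup (Function.uncurry (negDiv Du)) (timeTorusMeasure d T)).toReal
  refine ⟨M, by positivity, ?_⟩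
  have h1 := ae_prod_of_periodic (T := T) (P := fun A => -M ≤ diagSum A) hu.periodic_deriv (by
    filter_upwards [enorm_ae_le_eLpNormEssSup (Function.uncurry (negDiv Du))
      (timeTorusMeasure d T)] with q hq
    have h1 := ENNReal.toReal_mono hfin.ne hq
    rw [toReal_enorm] at h1
    have h2 : -diagSum (Du q.1 q.2) ≤ Function.uncurry (negDiv Du) q := le_max_left _ _
    linarith [Real.le_norm_self (Function.uncurry (negDiv Du) q)])
  exact Measure.ae_ae_of_ae_prod h1

theorem IsSobolevVelocity.aestronglyMeasurable_fderiv_mollify (hη : IsStandardMollifier η)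
    (hu : IsSobolevVelocity T p u Du) {r : ℝ} (hr : 0 < r) (y : Eucl d) :
    AEStronglyMeasurable (fun s => fderiv ℝ (mollify η r (u s)) y)
      (volume.restrict (Ioo 0 T)) := by
  have hcol : ∀ a : Eucl d, AEStronglyMeasurable (fun s => fderiv ℝ (mollify η r (u s)) y a)
      (volume.restrict (Ioo 0 T)) := by
    intro a
    have hm := aestronglyMeasurable_uncurry_of_periodic hu.periodic_deriv hu.memLp_deriv.1
    set F := hm.mk _
    have hF : StronglyMeasurable F := hm.stronglyMeasurable_mk
    have hFu : ∀ᵐ t ∂volume.restrict (Ioo 0 T), ∀ᵐ x : Eucl d, Du t x = F (t, x) :=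
      Measure.ae_ae_of_ae_prod hm.ae_eq_mk
    have hFa : StronglyMeasurable fun q => F q a := (ContinuousLinearMap.apply ℝ (Eucl d) a).continuous.comp_stronglyMeasurable hF
    refine ⟨fun s => mollify η r (fun x => F (s, x) a) y,
      (stronglyMeasurable_mollify hη hFa r).comp_measurable (measurable_prodMk_right (y := y)), ?_⟩
    filter_upwards [hFu, hu.weakDeriv] with s hs1 hs2
    rw [((hasFDerivAt_mollify hη hs2 hr y).2 a).1, mollify_eq_integral_sub]
    refine integral_congr_ae ?_
    filter_upwards [hs1] with x hx
    rw [hx]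
  have hrepr : ∀ A : Eucl d →L[ℝ] Eucl d, A = ∑ i : Fin d,
      (EuclideanSpace.proj (𝕜 := ℝ) i : Eucl d →L[ℝ] ℝ).smulRight
        (A (EuclideanSpace.single i (1 : ℝ))) := by
    intro A
    ext1 w
    have := (EuclideanSpace.basisFun (Fin d) ℝ).sum_repr w
    conv_lhs => rw [← this]
    simp
  have h2 : (fun s => fderiv ℝ (mollify η r (u s)) y) = fun s => ∑ i : Fin d,
      (EuclideanSpace.proj (𝕜 := ℝ) i : Eucl d →L[ℝ] ℝ).smulRight
        (fderiv ℝ (mollify η r (u s)) y (EuclideanSpace.single i (1 : ℝ))) :=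
    funext fun s => hrepr _
  rw [h2]
  refine Finset.aestronglyMeasurable_fun_sum _ fun i _ => ?_
  exact (ContinuousLinearMap.smulRightL ℝ (Eucl d) (Eucl d)
    (EuclideanSpace.proj (𝕜 := ℝ) i)).continuous.comp_aestronglyMeasurable
    (hcol (EuclideanSpace.single i (1 : ℝ)))

/-- The derivative of the time integral of the mollified velocity. -/
theorem IsSobolevVelocity.exists_hasFDerivAt_integral (hη : IsStandardMollifier η)
    (hu : IsSobolevVelocity T p u Du) {U : ℝ} (hU0 : 0 < U)
    (hU : ∀ᵐ q ∂(volume.restrict (Ioo 0 T)).prod (volume : Measure (Eucl d)), ‖u q.1 q.2‖ ≤ U)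
    {D : ℝ} (hD : ∀ᵐ s ∂volume.restrict (Ioo 0 T), ∀ᵐ x, -D ≤ diagSum (Du s x)) :
    ∃ C : ℝ, 0 ≤ C ∧ ∀ r a b : ℝ, 0 < r → 0 ≤ a → a ≤ b → b ≤ T →
      ∃ A : Eucl d → Eucl d →L[ℝ] Eucl d, ∀ y,
        HasFDerivAt (fun y => ∫ s in a..b, mollify η r (u s) y) (A y) y ∧
        ‖A y‖ ≤ C / r * (b - a) ∧ -D * (b - a) ≤ diagSum (A y) := by
  obtain ⟨C, hC0, hC⟩ := exists_norm_fderiv_mollify_le hη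
  refine ⟨C * U, by positivity, fun r a b hr ha hab hb => ?_⟩
  have hle := restrict_uIoc_le (T := T) ha hab hb
  have hae : ∀ᵐ s ∂volume.restrict (Ioo 0 T), HasWeakDeriv (u s) (Du s) ∧
      (∀ᵐ x, ‖u s x‖ ≤ U) ∧ ∀ᵐ x, -D ≤ diagSum (Du s x) :=
    hu.weakDeriv.and ((IsSobolevVelocity.ae_bound hU).and hD)
  have hae' : ∀ᵐ s, s ∈ uIoc a b → HasWeakDeriv (u s) (Du s) ∧
      (∀ᵐ x, ‖u s x‖ ≤ U) ∧ ∀ᵐ x, -D ≤ diagSum (Du s x) :=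
    (ae_restrict_iff' measurableSet_uIoc).1 (ae_mono hle hae)
  have hnorm : ∀ᵐ s, s ∈ uIoc a b → ∀ y, ‖fderiv ℝ (mollify η r (u s)) y‖ ≤ C * U / r := by
    filter_upwards [hae'] with s hs hsm y
    exact hC _ _ r U y (hs hsm).1 hr hU0.le (hs hsm).2.1
  have hintD : ∀ y, IntervalIntegrable (fun s => fderiv ℝ (mollify η r (u s)) y) volume a b := by
    intro y
    refine (intervalIntegrable_const (c := C * U / r)).mono_fun
      ((hu.aestronglyMeasurable_fderiv_mollify hη hr y).mono_measure hle) ?_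
    refine (ae_restrict_iff' measurableSet_uIoc).2 ?_
    filter_upwards [hnorm] with s hs hsm
    exact (hs hsm y).trans (Real.le_norm_self _)
  refine ⟨fun y => ∫ s in a..b, fderiv ℝ (mollify η r (u s)) y, fun y => ⟨?_, ?_, ?_⟩⟩
  · refine (intervalIntegral.hasFDerivAt_integral_of_dominated_of_fderiv_le
      (bound := fun _ => C * U / r) (F := fun y s => mollify η r (u s) y)
      (F' := fun y s => fderiv ℝ (mollify η r (u s)) y) (s := univ) univ_mem ?_ ?_ ?_ ?_
      intervalIntegrable_const ?_)
    · exact Eventually.of_forall fun z =>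
        (hu.aestronglyMeasurable_mollify hη r z).mono_measure hle
    · refine (intervalIntegrable_const (c := U)).mono_fun
        ((hu.aestronglyMeasurable_mollify hη r y).mono_measure hle) ?_
      refine (ae_restrict_iff' measurableSet_uIoc).2 ?_
      filter_upwards [hae'] with s hs hsm
      exact (norm_mollify_le hη hr (hs hsm).2.1 y).trans (Real.le_norm_self _)
    · exact (hu.aestronglyMeasurable_fderiv_mollify hη hr y).mono_measure hle
    · filter_upwards [hnorm] with s hs hsm z _ using hs hsm z
    · filter_upwards [hae'] with s hs hsm z _
      exact (hasFDerivAt_mollify hη (hs hsm).1 hr z).1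
  · have h1 := intervalIntegral.norm_integral_le_of_norm_le_const_ae
      (f := fun s => fderiv ℝ (mollify η r (u s)) y) (a := a) (b := b) (C := C * U / r)
      (hnorm.mono fun s hs hsm => hs hsm y)
    rwa [abs_of_nonneg (sub_nonneg.2 hab)] at h1
  -- The divergence is a continuous linear functional of the gradient, hence commutes with the time
  -- integral.
  · let Λ : (Eucl d →L[ℝ] Eucl d) →L[ℝ] ℝ := ∑ i,
      (EuclideanSpace.proj (𝕜 := ℝ) i : Eucl d →L[ℝ] ℝ).comp
        (ContinuousLinearMap.apply ℝ (Eucl d) (EuclideanSpace.single i (1 : ℝ)))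
    have hΛ : ∀ B, diagSum B = Λ B := fun B => by simp [diagSum, Λ]
    have h1 : diagSum (∫ s in a..b, fderiv ℝ (mollify η r (u s)) y) =
        ∫ s in a..b, diagSum (fderiv ℝ (mollify η r (u s)) y) := by
      simp only [hΛ]
      exact (Λ.intervalIntegral_comp_comm (hintD y)).symm
    have h2 : ∫ _s in a..b, -D = -D * (b - a) := by
      rw [intervalIntegral.integral_const, smul_eq_mul, mul_comm]
    rw [h1, ← h2]
    refine intervalIntegral.integral_mono_ae_restrict hab intervalIntegrable_const ?_ ?_
    · simp only [hΛ]
      have h3 := hintD y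
      rw [intervalIntegrable_iff] at h3 ⊢
      exact Λ.integrable_comp h3
    · refine (ae_restrict_iff' measurableSet_Icc).2 ?_
      filter_upwards [hae', (measure_eq_zero_iff_ae_notMem.1 (Real.volume_singleton (a := a)))]
        with s hs hsa hsm
      have hsm' : s ∈ uIoc a b := by
        rw [uIoc_of_le hab]
        exact ⟨lt_of_le_of_ne hsm.1 fun h => hsa h.symm, hsm.2⟩
      exact diagSum_fderiv_mollify_ge hη (hs hsm').1 hr (hs hsm').2.2 y

end EulerStep

/-! ### Volume compression by the Euler nodes. -/

section NodeCompressibility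

variable {d : ℕ} {T : ℝ} {p : ℝ≥0∞} {u : ℝ → Eucl d → Eucl d}
  {Du : ℝ → Eucl d → Eucl d →L[ℝ] Eucl d} {η : Eucl d → ℝ}

/-- `exp (-2t) ≤ 1 / (1 + 2t)`, and `(1 - t)(1 + 2t) ≥ 1` exactly for `t` in `[0, 1/2]`. An
exponential lower bound for the Jacobian multiplies cleanly over the steps. -/
theorem exp_neg_two_mul_le {t : ℝ} (ht0 : 0 ≤ t) (ht : t ≤ 1 / 2) :
    Real.exp (-(2 * t)) ≤ 1 - t := by
  have h1 := Real.add_one_le_exp (2 * t)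
  have h2 : Real.exp (-(2 * t)) * Real.exp (2 * t) = 1 := by
    rw [← Real.exp_add, neg_add_cancel, Real.exp_zero]
  have h3 : Real.exp (-(2 * t)) * (2 * t + 1) ≤ 1 := by
    exact (mul_le_mul_of_nonneg_left h1 (Real.exp_pos _).le).trans_eq h2
  have h4 : 1 ≤ (1 - t) * (2 * t + 1) := by nlinarith
  nlinarith

/-- If the divergence is bounded below, then the nodes of the Euler approximation for the velocity
mollified at scale `√h` are uniformly nearly incompressible. -/
theorem IsSobolevVelocity.exists_lintegral_comp_eulerNode_le (hη : IsStandardMollifier η)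
    (hu : IsSobolevVelocity T p u Du) (hpd : p ≤ (d : ℝ≥0∞)) (hdiv : MemLinfty T (negDiv Du)) :
    ∃ h₀ : ℝ, 0 < h₀ ∧ ∃ L : ℝ≥0, ∀ h : ℝ, 0 < h → h ≤ h₀ → ∀ n : ℕ, n * h ≤ T →
      Measurable (eulerNode (eulerVelocity p η (√h) u) h n) ∧
      ∀ f : Eucl d → ℝ≥0∞, Measurable f →
        ∫⁻ x, f (eulerNode (eulerVelocity p η (√h) u) h n x) ≤ L * ∫⁻ x, f x := by
  obtain ⟨U, hU0, hU⟩ := hu.exists_bound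
  obtain ⟨D, hD0, hD⟩ := hu.exists_diagSum_ge hdiv
  obtain ⟨C, hC0, hC⟩ := hu.exists_hasFDerivAt_integral hη hU0 hU hD
  obtain ⟨ε, K, hε, hK, hdet⟩ := exists_det_one_add_ge d
  set m := min ε (1 / 2)
  have hm : 0 < m := lt_min hε (by norm_num)
  -- The Jacobian of a step is at least `1 - B * h`: `D` comes from the divergence, `K * C ^ 2` from
  -- the quadratic remainder with `‖A y‖ ≤ C * √h`.
  set B := D + K * C ^ 2
  have hB : 0 ≤ B := by positivity
  -- The first bound on `h` gives `C * √h ≤ m`, as needed for the determinant expansion and for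
  -- injectivity; the second gives `B * h ≤ 1 / 2`.
  refine ⟨min ((m / (C + 1)) ^ 2) (1 / (2 * (B + 1))), by positivity,
    (Real.exp (2 * B * T)).toNNReal, fun h hh hh0 => ?_⟩
  have hs : √h ≤ m / (C + 1) := Real.sqrt_le_iff.2 ⟨by positivity, hh0.trans (min_le_left _ _)⟩
  have hs0 : 0 < √h := Real.sqrt_pos.2 hh
  have hCs : C * √h ≤ m := by
    calc C * √h ≤ (C + 1) * (m / (C + 1)) := by gcongr; linarith
      _ = m := by field_simp
  have hBh : B * h ≤ 1 / 2 := by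
    have h1 := hh0.trans (min_le_right _ _)
    rw [le_div_iff₀ (by positivity)] at h1
    nlinarith
  have hv : eulerVelocity p η (√h) u = fun t => mollify η (√h) (u t) := by
    ext1 t; rw [eulerVelocity, if_pos hpd]
  have key : ∀ n : ℕ, n * h ≤ T →
      Measurable (eulerNode (eulerVelocity p η (√h) u) h n) ∧
      ∀ f : Eucl d → ℝ≥0∞, Measurable f →
        ∫⁻ x, f (eulerNode (eulerVelocity p η (√h) u) h n x) ≤
          ENNReal.ofReal (Real.exp (2 * B * (n * h))) * ∫⁻ x, f x := by
    intro n
    induction n with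
    | zero => exact fun _ => ⟨measurable_id, fun f _ => by simp [eulerNode]⟩
    | succ n ih =>
      intro hn
      push_cast at hn
      obtain ⟨ih1, ih2⟩ := ih (by nlinarith)
      obtain ⟨A, hA⟩ := hC (√h) (n * h) ((n + 1) * h) hs0 (by positivity) (by nlinarith) hn
      set g : Eucl d → Eucl d := fun y =>
        ∫ s in ((n : ℝ) * h)..(((n : ℝ) + 1) * h), mollify η (√h) (u s) y with hg
      have hstep : ∀ y, eulerStep (eulerVelocity p η (√h) u) h n h y = y + g y := fun y => by
        rw [eulerStep_eq _ hh, hv]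
      have hlen : ((n : ℝ) + 1) * h - n * h = h := by ring
      -- A gradient of order `1 / √h` acts for a time `h`. The square of the result is of order `h`,
      -- summable over the steps.
      have hAn : ∀ y, ‖A y‖ ≤ C * √h := fun y => by
        refine (hA y).2.1.trans_eq ?_
        rw [hlen, div_mul_eq_mul_div, mul_div_assoc, Real.div_sqrt]
      have hgm : Measurable fun y => y + g y := by
        have : Continuous g := continuous_iff_continuousAt.2 fun y => (hA y).1.continuousAt
        fun_prop
      have hdetA : ∀ y, Real.exp (-(2 * (B * h))) ≤
          (ContinuousLinearMap.id ℝ (Eucl d) + A y).det := fun y => by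
        refine le_trans ?_ (hdet (A y) ((hAn y).trans (hCs.trans (min_le_left _ _))))
        refine (exp_neg_two_mul_le (by positivity) hBh).trans ?_
        have h1 := (hA y).2.2
        rw [hlen] at h1
        have h2 : ‖A y‖ ^ 2 ≤ C ^ 2 * h := by
          calc ‖A y‖ ^ 2 ≤ (C * √h) ^ 2 := by gcongr; exact hAn y
            _ = C ^ 2 * h := by rw [mul_pow, Real.sq_sqrt hh.le]
        have h3 := mul_le_mul_of_nonneg_left h2 hK
        simp only [B]
        linarith
      refine ⟨?_, fun f hf => ?_⟩
      · have : eulerNode (eulerVelocity p η (√h) u) h (n + 1) =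
            (fun y => y + g y) ∘ eulerNode (eulerVelocity p η (√h) u) h n := by
          ext1 x; exact hstep _
        rw [this]
        exact hgm.comp ih1
      · have h1 := lintegral_comp_id_add_le (fun y => (hA y).1)
          (fun y => (hAn y).trans (hCs.trans (min_le_right _ _))) (Real.exp_pos _) hdetA f
        have h2 := ih2 (fun y => f (y + g y)) (hf.comp hgm)
        calc ∫⁻ x, f (eulerNode (eulerVelocity p η (√h) u) h (n + 1) x)
            = ∫⁻ x, f (eulerNode (eulerVelocity p η (√h) u) h n x +
                g (eulerNode (eulerVelocity p η (√h) u) h n x)) :=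
              lintegral_congr fun x => by rw [← hstep]; rfl
          _ ≤ _ := h2
          _ ≤ ENNReal.ofReal (Real.exp (2 * B * (n * h))) *
              (ENNReal.ofReal (Real.exp (-(2 * (B * h))))⁻¹ * ∫⁻ x, f x) := by gcongr
          _ = _ := by
            rw [← mul_assoc, ← ENNReal.ofReal_mul (by positivity), ← Real.exp_neg,
              ← Real.exp_add]
            congr 4
            push_cast
            ring
  intro n hn
  refine ⟨(key n hn).1, fun f hf => ((key n hn).2 f hf).trans ?_⟩
  refine mul_le_mul_left (ENNReal.ofReal_le_ofReal (Real.exp_le_exp.2 ?_)) _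
  exact mul_le_mul_of_nonneg_left hn (by positivity)

end NodeCompressibility

/-! ### Discrete logarithmic Gronwall estimate. -/

section NodeDistance

variable {d : ℕ} {T U : ℝ} {v : ℝ → Eucl d → Eucl d}

/-- From `log x ≤ x - 1` at `x = (δ + b) / (δ + a)`. The increment is measured relative to the old
distance `a`, the only one at which the velocity difference of a step is controlled. -/
theorem log_one_add_div_le {a b δ : ℝ} (ha : 0 ≤ a) (hb : 0 ≤ b) (hδ : 0 < δ) :
    Real.log (1 + b / δ) ≤ Real.log (1 + a / δ) + |b - a| / (δ + a) := by
  have h1 : Real.log (1 + b / δ) - Real.log (1 + a / δ) = Real.log ((δ + b) / (δ + a)) := by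
    rw [← Real.log_div (by positivity) (by positivity)]
    congr 1
    field_simp
  have h2 : Real.log ((δ + b) / (δ + a)) ≤ (b - a) / (δ + a) := by
    refine (Real.log_le_sub_one_of_pos (by positivity)).trans_eq ?_
    field_simp
    ring
  have h3 : (b - a) / (δ + a) ≤ |b - a| / (δ + a) := by
    gcongr
    exact le_abs_self _
  linarith

theorem intervalIntegrable_of_ae_bound
    (hm : ∀ y, AEStronglyMeasurable (fun s => v s y) (volume.restrict (Ioo 0 T)))
    (hU : ∀ᵐ s ∂volume.restrict (Ioo 0 T), ∀ y, ‖v s y‖ ≤ U) (y : Eucl d) {a b : ℝ}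
    (ha : 0 ≤ a) (hab : a ≤ b) (hb : b ≤ T) :
    IntervalIntegrable (fun s => v s y) volume a b ∧ ‖∫ s in a..b, v s y‖ ≤ U * (b - a) := by
  have hle := restrict_uIoc_le (T := T) ha hab hb
  have hae : ∀ᵐ s, s ∈ uIoc a b → ‖v s y‖ ≤ U :=
    (ae_restrict_iff' measurableSet_uIoc).1 (ae_mono hle (hU.mono fun s hs => hs y))
  refine ⟨(intervalIntegrable_const (c := U)).mono_fun ((hm y).mono_measure hle) ?_, ?_⟩
  · refine (ae_restrict_iff' measurableSet_uIoc).2 ?_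
    filter_upwards [hae] with s hs hsm
    exact (hs hsm).trans (Real.le_norm_self _)
  · have := intervalIntegral.norm_integral_le_of_norm_le_const_ae hae
    rwa [abs_of_nonneg (sub_nonneg.2 hab)] at this

theorem norm_eulerStep_sub_le
    (hm : ∀ y, AEStronglyMeasurable (fun s => v s y) (volume.restrict (Ioo 0 T)))
    (hU : ∀ᵐ s ∂volume.restrict (Ioo 0 T), ∀ y, ‖v s y‖ ≤ U) {h τ : ℝ} (hh : 0 < h)
    (hτ : 0 ≤ τ) {n : ℕ} (hn : (n + 1) * h ≤ T) (y : Eucl d) :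
    ‖eulerStep v h n τ y - y‖ ≤ U * τ := by
  have h1 := (intervalIntegrable_of_ae_bound hm hU y (a := n * h) (b := (n + 1) * h)
    (by positivity) (by nlinarith) hn).2
  have h2 : ((n : ℝ) + 1) * h - n * h = h := by ring
  rw [eulerStep, add_sub_cancel_left, norm_smul, interval_average_eq, norm_smul, norm_inv,
    Real.norm_of_nonneg hτ, h2, Real.norm_of_nonneg hh.le, mul_comm U]
  rw [h2] at h1
  gcongr
  rwa [inv_mul_le_iff₀ hh, mul_comm h]

theorem norm_eulerNode_sub_le
    (hm : ∀ y, AEStronglyMeasurable (fun s => v s y) (volume.restrict (Ioo 0 T)))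
    (hU : ∀ᵐ s ∂volume.restrict (Ioo 0 T), ∀ y, ‖v s y‖ ≤ U) {h : ℝ} (hh : 0 < h) {n : ℕ}
    (hn : n * h ≤ T) (x : Eucl d) :
    ‖eulerNode v h n x - x‖ ≤ U * (n * h) := by
  induction n with
  | zero => simp [eulerNode]
  | succ n ih =>
    push_cast at hn
    have h1 := ih (by nlinarith)
    have h2 := norm_eulerStep_sub_le hm hU hh hh.le hn (eulerNode v h n x)
    have h3 := norm_sub_le_norm_sub_add_norm_sub (eulerNode v h (n + 1) x) (eulerNode v h n x) x
    rw [eulerNode] at h3 ⊢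
    push_cast
    linarith

theorem floor_div_eq {h s : ℝ} (hh : 0 < h) {n : ℕ} (h1 : n * h ≤ s) (h2 : s < (n + 1) * h) :
    ⌊s / h⌋₊ = n := by
  rw [Nat.floor_eq_iff (div_nonneg ((by positivity : (0 : ℝ) ≤ n * h).trans h1) hh.le),
    le_div_iff₀ hh, div_lt_iff₀ hh]
  exact ⟨h1, h2⟩

theorem floor_div_mul_le {h s : ℝ} (hh : 0 < h) (hs : 0 ≤ s) : (⌊s / h⌋₊ : ℝ) * h ≤ s := by
  rw [← le_div_iff₀ hh]
  exact Nat.floor_le (div_nonneg hs hh.le)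

/-- The logarithmic distance between a curve and the nodes of its Euler approximation is bounded
by the time integral of a majorant of the difference quotients of the velocity. -/
theorem log_dist_eulerNode_le {X w : ℝ → Eucl d} (hU0 : 0 ≤ U)
    (hX : ∀ a b, 0 ≤ a → a ≤ b → b ≤ T → IntervalIntegrable w volume a b ∧
      ∫ s in a..b, w s = X b - X a ∧ ‖X b - X a‖ ≤ U * (b - a))
    (hm : ∀ y, AEStronglyMeasurable (fun s => v s y) (volume.restrict (Ioo 0 T)))
    (hU : ∀ᵐ s ∂volume.restrict (Ioo 0 T), ∀ y, ‖v s y‖ ≤ U)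
    {h δ C : ℝ} (hh : 0 < h) (hδ : h ≤ δ) (hC : 0 ≤ C) {G : ℝ → ℝ≥0∞}
    (hG : ∀ᵐ s ∂volume.restrict (Ioo 0 T), ‖w s - v s (eulerNode v h ⌊s / h⌋₊ (X 0))‖ₑ ≤
      ENNReal.ofReal (C * (‖X s - eulerNode v h ⌊s / h⌋₊ (X 0)‖ + δ)) * G s)
    {n : ℕ} (hn : n * h ≤ T) :
    ENNReal.ofReal (Real.log (1 + ‖X (n * h) - eulerNode v h n (X 0)‖ / δ)) ≤
      ENNReal.ofReal (C * (1 + U)) * ∫⁻ s in Ioo 0 T, G s := by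
  have hδ0 : 0 < δ := hh.trans_le hδ
  -- The integral is taken only up to the current node, so that the induction can add one step at a
  -- time.
  suffices H : ENNReal.ofReal (Real.log (1 + ‖X (n * h) - eulerNode v h n (X 0)‖ / δ)) ≤
      ENNReal.ofReal (C * (1 + U)) * ∫⁻ s in Ioo 0 (n * h), G s by
    refine H.trans ?_
    gcongr
  induction n with
  | zero => simp [eulerNode]
  | succ n ih =>
    push_cast at hn ⊢
    have hlt : (n : ℝ) * h < (n + 1) * h := by nlinarith
    have h0 : (0 : ℝ) ≤ n * h := by positivity
    specialize ih (hlt.le.trans hn)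
    set y := eulerNode v h n (X 0)
    set D := ‖X (n * h) - y‖
    obtain ⟨hX1, hX2, -⟩ := hX (n * h) ((n + 1) * h) h0 hlt.le hn
    obtain ⟨hv1, -⟩ := intervalIntegrable_of_ae_bound hm hU y h0 hlt.le hn
    have hdiff : (X ((n + 1) * h) - eulerNode v h (n + 1) (X 0)) - (X (n * h) - y) =
        ∫ s in (n * h)..((n + 1) * h), (w s - v s y) := by
      rw [intervalIntegral.integral_sub hX1 hv1, hX2, eulerNode, eulerStep_eq v hh]
      abel
    -- Within a step the curve moves by at most `U * h ≤ U * δ`. So the distance at time `s` plus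
    -- `δ` is at most `(1 + U) * (δ + D)`, with `D` the distance at the node.
    have hpt : ∀ᵐ s ∂volume.restrict (Ioo (n * h) ((n + 1) * h)), ‖w s - v s y‖ₑ ≤
        ENNReal.ofReal (C * (1 + U) * (δ + D)) * G s := by
      have h1 := ae_mono (Measure.restrict_mono (Ioo_subset_Ioo h0 hn) le_rfl) hG
      filter_upwards [h1, ae_restrict_mem measurableSet_Ioo] with s hs hsm
      rw [floor_div_eq hh hsm.1.le hsm.2] at hs
      refine hs.trans ?_
      gcongr ENNReal.ofReal ?_ * _
      rw [mul_assoc]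
      gcongr
      have h2 := (hX (n * h) s h0 hsm.1.le (hsm.2.le.trans hn)).2.2
      have h3 : ‖X s - y‖ ≤ ‖X s - X (n * h)‖ + D := norm_sub_le_norm_sub_add_norm_sub _ _ _
      have h4 : U * (s - n * h) ≤ U * δ := by
        gcongr
        linarith [hsm.2]
      have h5 : 0 ≤ U * D := mul_nonneg hU0 (norm_nonneg _)
      nlinarith
    have hmain : ‖(X ((n + 1) * h) - eulerNode v h (n + 1) (X 0)) - (X (n * h) - y)‖ₑ ≤
        (ENNReal.ofReal (C * (1 + U)) * ∫⁻ s in Ioo (n * h) ((n + 1) * h), G s) *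
          ENNReal.ofReal (δ + D) := by
      rw [hdiff, intervalIntegral.integral_of_le hlt.le, integral_Ioc_eq_integral_Ioo]
      refine (enorm_integral_le_lintegral_enorm _).trans ((lintegral_mono_ae hpt).trans_eq ?_)
      rw [lintegral_const_mul' _ _ ENNReal.ofReal_ne_top, ENNReal.ofReal_mul (by positivity)]
      ring
    have hlog := log_one_add_div_le (norm_nonneg (X (n * h) - y))
      (norm_nonneg (X ((n + 1) * h) - eulerNode v h (n + 1) (X 0))) hδ0
    have hquot : ENNReal.ofReal (|‖X ((n + 1) * h) - eulerNode v h (n + 1) (X 0)‖ - D| / (δ + D)) ≤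
        ENNReal.ofReal (C * (1 + U)) * ∫⁻ s in Ioo (n * h) ((n + 1) * h), G s := by
      have hpos : 0 < δ + D := by positivity
      rw [ENNReal.ofReal_div_of_pos hpos]
      refine ENNReal.div_le_of_le_mul (le_trans ?_ hmain)
      rw [← ofReal_norm]
      exact ENNReal.ofReal_le_ofReal (abs_norm_sub_norm_le _ _)
    calc _ ≤ _ := ENNReal.ofReal_le_ofReal hlog
      _ ≤ _ := ENNReal.ofReal_add_le
      _ ≤ _ := add_le_add ih hquot
      _ = ENNReal.ofReal (C * (1 + U)) * ((∫⁻ s in Ioo 0 (n * h), G s) +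
          ∫⁻ s in Ioo (n * h) ((n + 1) * h), G s) := (mul_add _ _ _).symm
      _ ≤ _ := by
        gcongr
        rw [← lintegral_union measurableSet_Ioo (by
          rw [Set.disjoint_left]
          exact fun s hs hs' => (hs.2.trans hs'.1).false)]
        exact lintegral_mono_set (union_subset (Ioo_subset_Ioo le_rfl hlt.le)
          (Ioo_subset_Ioo h0 le_rfl))

end NodeDistance

/-! ### Logarithmic estimate for the flow, with a bound in L^p. -/

section NodeEstimate

variable {d : ℕ} {T U : ℝ} {p : ℝ≥0∞} {u Φ : ℝ → Eucl d → Eucl d}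
  {Du : ℝ → Eucl d → Eucl d →L[ℝ] Eucl d} {η : Eucl d → ℝ}

/-- The majorant holds for almost every `(s, z)` but for every `y`: compression of the flow allows
`z = Φ s x`, while the node enters as an arbitrary point. From the unit cube both move by at most `U
* T`, so bounded regions suffice. -/
theorem IsRegularLagrangianFlow.ae_log_dist_eulerNode_le (hT : 0 < T)
    (hΦ : IsRegularLagrangianFlow T u Φ) (hU0 : 0 ≤ U)
    (hU : ∀ᵐ q ∂(volume.restrict (Ioo 0 T)).prod (volume : Measure (Eucl d)), ‖u q.1 q.2‖ ≤ U)
    {v : ℝ → Eucl d → Eucl d}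
    (hm : ∀ y, AEStronglyMeasurable (fun s => v s y) (volume.restrict (Ioo 0 T)))
    (hvU : ∀ᵐ s ∂volume.restrict (Ioo 0 T), ∀ y, ‖v s y‖ ≤ U)
    {h C : ℝ} (hh : 0 < h) (hh1 : h ≤ 1) (hC : 0 ≤ C) {g : ℝ → Eucl d → Eucl d → ℝ≥0∞}
    (hg : ∀ᵐ q ∂(volume.restrict (Ioo 0 T)).prod (volume : Measure (Eucl d)), ∀ y : Eucl d,
      ‖q.2‖ ≤ √d + U * T → ‖y‖ ≤ √d + U * T → dist y q.2 + √h ≤ 2 * (U * T) + 1 →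
      ‖u q.1 q.2 - v q.1 y‖ₑ ≤ ENNReal.ofReal (C * (dist y q.2 + √h)) * g q.1 q.2 y) :
    ∀ᵐ x ∂torusMeasure d, ∀ n : ℕ, n * h ≤ T →
      ENNReal.ofReal (Real.log (1 + ‖Φ (n * h) x - eulerNode v h n x‖ / √h)) ≤
        ENNReal.ofReal (C * (1 + U)) *
          ∫⁻ s in Ioo 0 T, g s (Φ s x) (eulerNode v h ⌊s / h⌋₊ x) := by
  have hs1 : √h ≤ 1 := Real.sqrt_le_one.2 hh1
  have hs : h ≤ √h := Real.le_sqrt_of_sq_le (by nlinarith)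
  filter_upwards [ae_torusMeasure_of_ae (hΦ.ae_ae_comp hT hg),
    ae_torusMeasure_of_ae (hΦ.ae_integral_eq hT hU)] with x hx1 hx2 n hn
  obtain ⟨hx, hx1⟩ := hx1
  obtain ⟨-, hx0, hx2⟩ := hx2
  have hxn := norm_le_of_mem_unitCube hx
  have key := log_dist_eulerNode_le (X := fun s => Φ s x) (w := fun s => u s (Φ s x)) (δ := √h)
    (C := C) (G := fun s => g s (Φ s x) (eulerNode v h ⌊s / h⌋₊ x)) hU0 hx2 hm hvU hh hs hC
    ?_ hn
  · simpa only [hx0] using key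
  · filter_upwards [hx1, ae_restrict_mem measurableSet_Ioo] with s hs1' hsm
    simp only [hx0]
    have hfl := floor_div_mul_le hh hsm.1.le
    have h1 : ‖Φ s x - x‖ ≤ U * T := by
      have := (hx2 0 s le_rfl hsm.1.le hsm.2.le).2.2
      rw [hx0, sub_zero] at this
      exact this.trans (by gcongr; exact hsm.2.le)
    have h2 : ‖eulerNode v h ⌊s / h⌋₊ x - x‖ ≤ U * T :=
      (norm_eulerNode_sub_le hm hvU hh (hfl.trans hsm.2.le) x).trans
        (by gcongr; exact hfl.trans hsm.2.le)
    have h3 : dist (eulerNode v h ⌊s / h⌋₊ x) (Φ s x) ≤ 2 * (U * T) := by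
      refine (dist_triangle_right _ _ x).trans ?_
      rw [dist_eq_norm, dist_eq_norm]
      linarith
    have h4 := hs1' (eulerNode v h ⌊s / h⌋₊ x)
      (by linarith [norm_le_norm_add_norm_sub' (Φ s x) x])
      (by linarith [norm_le_norm_add_norm_sub' (eulerNode v h ⌊s / h⌋₊ x) x]) (by linarith)
    rwa [dist_comm, dist_eq_norm] at h4

theorem aemeasurable_lintegral_comp {g : ℝ → Eucl d → ℝ≥0∞} (hg : Measurable (Function.uncurry g))
    {Y : ℝ → Eucl d → Eucl d} (hY : AEMeasurable (fun q : ℝ × Eucl d => Y q.1 q.2)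
      ((volume.restrict (Ioo 0 T)).prod volume)) :
    AEMeasurable (fun q : ℝ × Eucl d => g q.1 (Y q.1 q.2))
        ((volume.restrict (Ioo 0 T)).prod volume) ∧
      AEStronglyMeasurable (fun x => ∫⁻ s in Ioo 0 T, g s (Y s x)) (torusMeasure d) := by
  have h1 : AEMeasurable (fun q : ℝ × Eucl d => g q.1 (Y q.1 q.2))
      ((volume.restrict (Ioo 0 T)).prod volume) :=
    hg.comp_aemeasurable (measurable_fst.aemeasurable.prodMk hY)
  refine ⟨h1, ?_⟩
  rw [torusMeasure_eq]
  exact (h1.lintegral_prod_left'.mono_measure Measure.restrict_le_self).aestronglyMeasurable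

theorem measurable_comp_section {g : ℝ → Eucl d → ℝ≥0∞} (hg : Measurable (Function.uncurry g))
    {Y : ℝ → Eucl d → Eucl d} (hY : Measurable fun q : ℝ × Eucl d => Y q.1 q.2) (x : Eucl d) :
    Measurable fun s => g s (Y s x) := by
  have h1 : Measurable fun s : ℝ => (s, Y s x) :=
    measurable_id.prodMk (hY.comp (measurable_prodMk_right (y := x)))
  exact hg.comp h1

/-- Adding 1 secures `1 ≤ ψ`, which later absorbs the points where the error is already small. -/
theorem exists_eLpNorm_one_add_le (hp : 1 < p) (d : ℕ) : ∃ B : ℝ≥0∞, B ≠ ⊤ ∧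
    ∀ ψ : Eucl d → ℝ≥0∞, AEStronglyMeasurable ψ (torusMeasure d) →
      eLpNorm (fun x => 1 + ψ x) p (torusMeasure d) ≤ B + eLpNorm ψ p (torusMeasure d) := by
  refine ⟨(1 : ℝ≥0∞) • torusMeasure d univ ^ p.toReal⁻¹, ?_, fun ψ hψ => ?_⟩
  · rw [one_smul]
    exact ENNReal.rpow_ne_top_of_nonneg (by positivity) (measure_ne_top _ _)
  · refine (eLpNorm_add_le (f := fun _ => (1 : ℝ≥0∞)) aestronglyMeasurable_const hψ hp.le).trans ?_
    gcongr
    exact eLpNorm_le_of_ae_enorm_bound (Eventually.of_forall fun x => le_of_eq rfl)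

/-- The one-sided Morrey estimate places the maximal function on the trajectory of `Φ` only, so the
L^p bound follows from the compression of `Φ`. -/
theorem IsSobolevVelocity.exists_log_dist_eulerNode_le_of_lt (hd : 1 ≤ d) (hT : 0 < T)
    (hp : 1 < p) (hη : IsStandardMollifier η) (hu : IsSobolevVelocity T p u Du)
    (hΦ : IsRegularLagrangianFlow T u Φ) (hdp : (d : ℝ≥0∞) < p) :
    ∃ h₀ : ℝ, 0 < h₀ ∧ ∃ K : ℝ, 0 ≤ K ∧ ∃ A : ℝ≥0∞, A ≠ ⊤ ∧ ∀ h : ℝ, 0 < h → h ≤ h₀ →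
      ∃ ψ : Eucl d → ℝ≥0∞, (∀ x, 1 ≤ ψ x) ∧ eLpNorm ψ p (torusMeasure d) ≤ A ∧
        ∀ᵐ x ∂torusMeasure d, ∀ n : ℕ, n * h ≤ T → ENNReal.ofReal (Real.log (1 +
          ‖Φ (n * h) x - eulerNode (eulerVelocity p η (√h) u) h n x‖ / √h)) ≤
            ENNReal.ofReal K * ψ x := by
  obtain ⟨U, hU0, hU⟩ := hu.exists_bound
  obtain ⟨q, hq1, hqd, hqp⟩ := exists_exponent hd hdp
  obtain ⟨C, hC0, hC⟩ := exists_sub_contRep_le hη hq1 hqd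
  -- Flow and node are at most `2 * (U * T)` apart and `√h ≤ 1`. So `R` bounds twice the comparison
  -- scale, and the ball of radius `√d + U * T + R` contains every ball over which an average is
  -- taken.
  set R := 2 * (2 * (U * T) + 1)
  obtain ⟨W, hW, hDW, hWb⟩ := hu.exists_majorant hp (√d + U * T + R)
  obtain ⟨L, hL⟩ := hΦ.exists_lintegral_comp_le
  obtain ⟨A, hA, hA'⟩ := exists_eLpNorm_lintegral_comp_le hp
    (hWb R q (by positivity) hq1 hqp) (measurable_maxPow hW R q) L
  obtain ⟨B, hB, hB'⟩ := exists_eLpNorm_one_add_le hp d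
  refine ⟨1, one_pos, C * (1 + U), by positivity, B + A, ENNReal.add_ne_top.2 ⟨hB, hA⟩,
    fun h hh hh1 => ?_⟩
  have hΦm := aemeasurable_lintegral_comp (measurable_maxPow hW R q) (hΦ.aemeasurable_uncurry hT)
  refine ⟨fun x => 1 + ∫⁻ s in Ioo 0 T, maxPow R q (W s) (Φ s x), fun x => le_self_add, ?_, ?_⟩
  · refine (hB' _ hΦm.2).trans ?_
    gcongr
    exact hA' Φ hΦm.1 fun s hs => hL s ⟨hs.1.le, hs.2.le⟩
  · have hs0 : 0 < √h := Real.sqrt_pos.2 hh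
    obtain ⟨hvm, hvU⟩ := hu.eulerVelocity_spec hd hη hU hs0
    have h1 := hΦ.ae_log_dist_eulerNode_le hT hU0.le hU hvm hvU hh hh1 hC0.le
      (g := fun s z _ => maxPow R q (W s) z) (by
        have hfst : ∀ {P : ℝ → Prop}, (∀ᵐ s ∂volume.restrict (Ioo 0 T), P s) →
            ∀ᵐ q ∂(volume.restrict (Ioo 0 T)).prod (volume : Measure (Eucl d)), P q.1 :=
          fun h => Measure.quasiMeasurePreserving_fst.ae h
        filter_upwards [hu.ae_tendsto_mollify hη, hfst hu.weakDeriv, hfst hDW,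
          hfst (hu.ae_contRep_spec hd hη hdp)] with z hz1 hz2 hz3 hz4 y hz hy hyz
        rw [eulerVelocity, if_neg (not_le.2 hdp)]
        exact hC (u z.1) (Du z.1) (W z.1) R (√h) (√d + U * T + R) y z.2 (u z.1 z.2) hz2
          (hW.comp measurable_prodMk_left) hs0 (by simp only [R]; linarith)
          (by simp only [R]; linarith) hz3 hz1 hz4)
    filter_upwards [h1] with x hx n hn
    refine (hx n hn).trans ?_
    gcongr
    exact le_add_self

/-- The two-sided estimate also places the maximal function at the nodes; their compression, uniform
for small `h`, bounds that term like the one along the flow. -/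
theorem IsSobolevVelocity.exists_log_dist_eulerNode_le_of_le (hd : 1 ≤ d) (hT : 0 < T)
    (hp : 1 < p) (hη : IsStandardMollifier η) (hu : IsSobolevVelocity T p u Du)
    (hΦ : IsRegularLagrangianFlow T u Φ) (hpd : p ≤ (d : ℝ≥0∞))
    (hdiv : MemLinfty T (negDiv Du)) :
    ∃ h₀ : ℝ, 0 < h₀ ∧ ∃ K : ℝ, 0 ≤ K ∧ ∃ A : ℝ≥0∞, A ≠ ⊤ ∧ ∀ h : ℝ, 0 < h → h ≤ h₀ →
      ∃ ψ : Eucl d → ℝ≥0∞, (∀ x, 1 ≤ ψ x) ∧ eLpNorm ψ p (torusMeasure d) ≤ A ∧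
        ∀ᵐ x ∂torusMeasure d, ∀ n : ℕ, n * h ≤ T → ENNReal.ofReal (Real.log (1 +
          ‖Φ (n * h) x - eulerNode (eulerVelocity p η (√h) u) h n x‖ / √h)) ≤
            ENNReal.ofReal K * ψ x := by
  classical
  obtain ⟨U, hU0, hU⟩ := hu.exists_bound
  obtain ⟨C, hC0, hC⟩ := exists_sub_mollify_le_add hη
  set R := 2 * (2 * (U * T) + 1)
  obtain ⟨W, hW, hDW, hWb⟩ := hu.exists_majorant hp (√d + U * T + R)
  have hM := measurable_maxPow hW R 1
  have hMb := hWb R 1 (by positivity) le_rfl (by simpa using hp)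
  obtain ⟨L, hL⟩ := hΦ.exists_lintegral_comp_le
  obtain ⟨h₀, hh₀, L', hL'⟩ := hu.exists_lintegral_comp_eulerNode_le hη hpd hdiv
  obtain ⟨A, hA, hA'⟩ := exists_eLpNorm_lintegral_comp_le hp hMb hM L
  obtain ⟨A₂, hA₂, hA₂'⟩ := exists_eLpNorm_lintegral_comp_le hp hMb hM L'
  obtain ⟨B, hB, hB'⟩ := exists_eLpNorm_one_add_le hp d
  refine ⟨min h₀ 1, by positivity, C * (1 + U), by positivity, B + (A + A₂),
    ENNReal.add_ne_top.2 ⟨hB, ENNReal.add_ne_top.2 ⟨hA, hA₂⟩⟩, fun h hh hhm => ?_⟩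
  have hh1 : h ≤ 1 := hhm.trans (min_le_right _ _)
  have hhh₀ : h ≤ h₀ := hhm.trans (min_le_left _ _)
  set v := eulerVelocity p η (√h) u with hv
  -- Measurability of the nodes is known only up to time `T`. Later ones are replaced by the
  -- identity, which makes the piecewise constant family `Y` jointly measurable.
  set F : ℕ → Eucl d → Eucl d := fun n => if n * h ≤ T then eulerNode v h n else id
  have hF : ∀ n, Measurable (F n) := fun n => by
    by_cases hn : n * h ≤ T
    · simp only [F, if_pos hn]
      exact (hL' h hh hhh₀ n hn).1
    · simp only [F, if_neg hn]
      exact measurable_id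
  obtain ⟨Y, hYs, hYm⟩ : ∃ Y : ℝ → Eucl d → Eucl d,
      (∀ s ∈ Ioo 0 T, Y s = eulerNode v h ⌊s / h⌋₊) ∧
        Measurable fun q : ℝ × Eucl d => Y q.1 q.2 := by
    refine ⟨fun s => F ⌊s / h⌋₊, fun s hs =>
      if_pos ((floor_div_mul_le hh hs.1.le).trans hs.2.le), ?_⟩
    have h1 : Measurable fun q : ℕ × Eucl d => F q.1 q.2 :=
      measurable_from_prod_countable_right hF
    exact h1.comp ((Nat.measurable_floor.comp (measurable_fst.div_const h)).prodMk measurable_snd)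
  have hΦm := aemeasurable_lintegral_comp hM (hΦ.aemeasurable_uncurry hT)
  have hYm' := aemeasurable_lintegral_comp (T := T) hM hYm.aemeasurable
  refine ⟨fun x => 1 + ((∫⁻ s in Ioo 0 T, maxPow R 1 (W s) (Φ s x)) +
    ∫⁻ s in Ioo 0 T, maxPow R 1 (W s) (Y s x)), fun x => le_self_add, ?_, ?_⟩
  · refine (hB' _ (hΦm.2.add hYm'.2)).trans ?_
    gcongr
    refine (eLpNorm_add_le hΦm.2 hYm'.2 hp.le).trans ?_
    gcongr
    · exact hA' Φ hΦm.1 fun s hs => hL s ⟨hs.1.le, hs.2.le⟩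
    · refine hA₂' Y hYm'.1 fun s hs f hf => ?_
      rw [hYs s hs]
      exact (hL' h hh hhh₀ _ ((floor_div_mul_le hh hs.1.le).trans hs.2.le)).2 f hf
  · have hs0 : 0 < √h := Real.sqrt_pos.2 hh
    obtain ⟨hvm, hvU⟩ := hu.eulerVelocity_spec hd hη hU hs0
    have h1 := hΦ.ae_log_dist_eulerNode_le hT hU0.le hU hvm hvU hh hh1 hC0.le
      (g := fun s z y => maxPow R 1 (W s) z + maxPow R 1 (W s) y) (by
        have hfst : ∀ {P : ℝ → Prop}, (∀ᵐ s ∂volume.restrict (Ioo 0 T), P s) →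
            ∀ᵐ q ∂(volume.restrict (Ioo 0 T)).prod (volume : Measure (Eucl d)), P q.1 :=
          fun h => Measure.quasiMeasurePreserving_fst.ae h
        filter_upwards [hu.ae_tendsto_mollify hη, hfst hu.weakDeriv, hfst hDW]
          with z hz1 hz2 hz3 y hz hy hyz
        rw [eulerVelocity, if_pos hpd]
        exact hC (u z.1) (Du z.1) (W z.1) R 1 (√h) (√d + U * T + R) y z.2 (u z.1 z.2) hz2
          (hW.comp measurable_prodMk_left) le_rfl hs0 (by simp only [R]; linarith)
          (by simp only [R]; linarith) (by simp only [R]; linarith) hz3 hz1)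
    filter_upwards [h1] with x hx n hn
    refine (hx n hn).trans ?_
    gcongr
    refine le_trans (le_of_eq ?_) le_add_self
    have hYx : Measurable fun s => maxPow R 1 (W s) (Y s x) := measurable_comp_section hM hYm x
    rw [← lintegral_add_right _ hYx]
    exact setLIntegral_congr_fun measurableSet_Ioo fun s hs => by rw [hYs s hs]

end NodeEstimate

/-! ### From the logarithmic estimate to the rate. -/

section Stability

variable {d : ℕ} {T U : ℝ} {p : ℝ≥0∞} {u Φ : ℝ → Eucl d → Eucl d}
  {Du : ℝ → Eucl d → Eucl d →L[ℝ] Eucl d} {η : Eucl d → ℝ}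

/-- `F` is the error at time `t` and `D` the error at the preceding node. The split is at `D = h ^
(1/4)`: below it the error is small outright, above it the logarithm is at least `|log h| / 4`. The
bound `2 * (U * t)` supplies decay as `t → 0` in both cases. -/
theorem ofReal_le_of_log_le {U t h K D F : ℝ} {ψ : ℝ≥0∞} (hU : 0 ≤ U) (ht : 0 ≤ t) (hh0 : 0 < h)
    (hh1 : h < 1) (hK : 0 ≤ K) (hψ : 1 ≤ ψ) (hF0 : 0 ≤ F) (hF1 : F ≤ 2 * (U * t))
    (hF2 : F ≤ D + 2 * (U * h))
    (hlog : ENNReal.ofReal (Real.log (1 + D / √h)) ≤ ENNReal.ofReal K * ψ) :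
    ENNReal.ofReal F ≤ ENNReal.ofReal
      ((8 * √(2 * U * (1 + 2 * U)) * √t + 8 * U * K * t) * |Real.log h|⁻¹) * ψ := by
  have hl : 0 < |Real.log h| := abs_pos.2 (Real.log_neg hh0 hh1).ne
  -- With `a = h ^ (1/8)` the threshold is `a ^ 2` and `√h = a ^ 4`.
  obtain ⟨a, ha0, ha⟩ : ∃ a : ℝ, 0 < a ∧ h = a ^ 8 := by
    refine ⟨√√√h, by positivity, ?_⟩
    rw [show 8 = 2 * 2 * 2 by rfl, pow_mul, pow_mul, Real.sq_sqrt (by positivity),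
      Real.sq_sqrt (by positivity), Real.sq_sqrt hh0.le]
  have ha1 : a < 1 := by
    by_contra! hc
    exact absurd (one_le_pow₀ hc (n := 8)) (by rw [← ha]; exact not_le.2 hh1)
  have hsq : √h = a ^ 4 := by
    rw [ha, show a ^ 8 = (a ^ 4) ^ 2 by ring, Real.sqrt_sq (by positivity)]
  have hlh : |Real.log h| = 8 * |Real.log a| := by
    rw [ha, Real.log_pow, abs_mul]
    norm_num
  rcases le_or_gt D (a ^ 2) with hD | hD
  -- The geometric mean of `2 * (U * t)` and `(1 + 2 * U) * a ^ 2` keeps a factor `√t`. The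
  -- remaining `a` is at most `8 / |log h|` because `a * |log a| ≤ 1`.
  · have h1 : F ^ 2 ≤ (√(2 * U * (1 + 2 * U)) * √t * a) ^ 2 := by
      have h2 : F ≤ (1 + 2 * U) * a ^ 2 := by
        have : h ≤ a ^ 2 := by
          rw [ha]
          exact pow_le_pow_of_le_one ha0.le ha1.le (by norm_num)
        nlinarith
      calc F ^ 2 = F * F := sq F
        _ ≤ (2 * (U * t)) * ((1 + 2 * U) * a ^ 2) := by gcongr
        _ = _ := by
          rw [mul_pow, mul_pow, Real.sq_sqrt (by positivity), Real.sq_sqrt ht]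
          ring
    have h2 := (sq_le_sq₀ hF0 (by positivity)).1 h1
    have h3 : a ≤ 8 * |Real.log h|⁻¹ := by
      have := (Real.abs_log_mul_self_lt a ha0 ha1.le).le
      rw [abs_mul, abs_of_pos ha0] at this
      rw [← div_eq_mul_inv, le_div_iff₀ hl, hlh]
      linarith
    have h4 : F ≤ (8 * √(2 * U * (1 + 2 * U)) * √t + 8 * U * K * t) * |Real.log h|⁻¹ := by
      have h5 : 0 ≤ 8 * U * K * t * |Real.log h|⁻¹ := by positivity
      have h6 : √(2 * U * (1 + 2 * U)) * √t * a ≤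
          √(2 * U * (1 + 2 * U)) * √t * (8 * |Real.log h|⁻¹) := by gcongr
      nlinarith
    exact (ENNReal.ofReal_le_ofReal h4).trans (le_mul_of_one_le_right' hψ)
  · have h1 : |Real.log h| / 4 ≤ Real.log (1 + D / √h) := by
      have h2 : a⁻¹ ^ 2 ≤ 1 + D / √h := by
        rw [hsq]
        have : a⁻¹ ^ 2 ≤ D / a ^ 4 := by
          rw [le_div_iff₀ (by positivity)]
          field_simp
          exact hD.le
        linarith
      have h3 := Real.log_le_log (by positivity) h2
      rw [Real.log_pow, Real.log_inv] at h3
      rw [hlh, abs_of_neg (Real.log_neg ha0 ha1)]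
      push_cast at h3
      linarith
    have h2 : F ≤ 8 * U * t * |Real.log h|⁻¹ * (|Real.log h| / 4) := by
      refine hF1.trans_eq ?_
      field_simp
      ring
    calc ENNReal.ofReal F ≤ ENNReal.ofReal (8 * U * t * |Real.log h|⁻¹) *
          ENNReal.ofReal (|Real.log h| / 4) := by
          rw [← ENNReal.ofReal_mul (by positivity)]
          exact ENNReal.ofReal_le_ofReal h2
      _ ≤ ENNReal.ofReal (8 * U * t * |Real.log h|⁻¹) * (ENNReal.ofReal K * ψ) := by
          gcongr
          exact (ENNReal.ofReal_le_ofReal h1).trans hlog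
      _ ≤ _ := by
          rw [← mul_assoc, ← ENNReal.ofReal_mul (by positivity)]
          refine mul_le_mul_left (ENNReal.ofReal_le_ofReal ?_) _
          have : 0 ≤ 8 * √(2 * U * (1 + 2 * U)) * √t * |Real.log h|⁻¹ := by positivity
          linarith

/-- Displacements of the continuous-time Euler approximation. -/
theorem norm_eulerFlow_sub_le {v : ℝ → Eucl d → Eucl d}
    (hm : ∀ y, AEStronglyMeasurable (fun s => v s y) (volume.restrict (Ioo 0 T)))
    (hU : ∀ᵐ s ∂volume.restrict (Ioo 0 T), ∀ y, ‖v s y‖ ≤ U) {h t : ℝ} (hh : 0 < h)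
    {M : ℕ} (hM : M * h = T) (ht : t ∈ Icc 0 T) (x : Eucl d) :
    ‖eulerFlow v h t x - eulerNode v h ⌊t / h⌋₊ x‖ ≤ U * (t - ⌊t / h⌋₊ * h) ∧
      ‖eulerFlow v h t x - x‖ ≤ U * t := by
  set n := ⌊t / h⌋₊
  have hn : (n : ℝ) * h ≤ t := floor_div_mul_le hh ht.1
  have h1 : ‖eulerFlow v h t x - eulerNode v h n x‖ ≤ U * (t - n * h) := by
    rcases lt_or_ge n M with hnM | hnM
    · refine norm_eulerStep_sub_le hm hU hh (by linarith) ?_ _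
      rw [← hM]
      gcongr
      exact_mod_cast hnM
    -- At the final time the floor is `M`, whose step would use the velocity beyond `T`; that step
    -- has length zero.
    · have h2 : (M : ℝ) * h ≤ n * h := by gcongr
      have h3 : t - n * h = 0 := by linarith [ht.2]
      simp [eulerFlow, eulerStep, n, h3]
  refine ⟨h1, ?_⟩
  have h2 := norm_eulerNode_sub_le hm hU hh (hn.trans ht.2) x
  have h3 := norm_sub_le_norm_sub_add_norm_sub (eulerFlow v h t x) (eulerNode v h n x) x
  linarith

/-- Small time steps use the logarithmic bound. For the others `|log h|` is bounded, so the trivial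
error `2 * (U * t)` already has the required form. -/
theorem eulerStabilityEstimate_of_log_dist_le (hd : 1 ≤ d) (hT : 0 < T)
    (hη : IsStandardMollifier η) (hu : IsSobolevVelocity T p u Du)
    (hΦ : IsRegularLagrangianFlow T u Φ)
    (H : ∃ h₀ : ℝ, 0 < h₀ ∧ ∃ K : ℝ, 0 ≤ K ∧ ∃ A : ℝ≥0∞, A ≠ ⊤ ∧ ∀ h : ℝ, 0 < h → h ≤ h₀ →
      ∃ ψ : Eucl d → ℝ≥0∞, (∀ x, 1 ≤ ψ x) ∧ eLpNorm ψ p (torusMeasure d) ≤ A ∧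
        ∀ᵐ x ∂torusMeasure d, ∀ n : ℕ, n * h ≤ T → ENNReal.ofReal (Real.log (1 +
          ‖Φ (n * h) x - eulerNode (eulerVelocity p η (√h) u) h n x‖ / √h)) ≤
            ENNReal.ofReal K * ψ x) :
    EulerStabilityEstimate T p η u Φ := by
  obtain ⟨U, hU0, hU⟩ := hu.exists_bound
  obtain ⟨h₀, hh₀, K, hK, A, hA, H⟩ := H
  set B : ℝ≥0∞ := torusMeasure d univ ^ p.toReal⁻¹
  have hB : B ≠ ⊤ := ENNReal.rpow_ne_top_of_nonneg (by positivity) (measure_ne_top _ _)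
  set h₁ := min h₀ (1 / 2)
  have hh₁ : 0 < h₁ := lt_min hh₀ (by norm_num)
  -- A bound for `|log h|` when `h₁ < h ≤ T`.
  set Q := |Real.log h₁| + |Real.log T|
  set c : ℝ → ℝ := fun t => 8 * √(2 * U * (1 + 2 * U)) * √t + 8 * U * K * t
  have hc : ∀ t, 0 ≤ t → 0 ≤ c t := fun t ht => by positivity
  -- The first summand covers small steps, with `A` bounding the norm of `ψ`; the second covers
  -- large ones, with `B` the norm of the constant 1.
  refine ⟨fun t => A.toReal * c t + B.toReal * (2 * (U * t)) * Q, ?_, ?_⟩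
  · have h1 : Continuous fun t => A.toReal * c t + B.toReal * (2 * (U * t)) * Q := by fun_prop
    have h2 := h1.tendsto 0
    simp only [c, Real.sqrt_zero, mul_zero, add_zero, zero_mul] at h2
    exact h2.mono_left nhdsWithin_le_nhds
  intro M h hh hM hne t ht
  have hhT : h ≤ T := by
    rcases Nat.eq_zero_or_pos M with h0 | h0
    · simp [h0] at hM
      linarith
    · have : (1 : ℝ) ≤ M := by exact_mod_cast h0
      nlinarith
  have hl : 0 < |Real.log h| :=
    abs_pos.2 (Real.log_ne_zero_of_pos_of_ne_one hh hne)
  obtain ⟨hvm, hvU⟩ := hu.eulerVelocity_spec hd hη hU (Real.sqrt_pos.2 hh)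
  set v := eulerVelocity p η (√h) u
  set n := ⌊t / h⌋₊
  have hn : (n : ℝ) * h ≤ t := floor_div_mul_le hh ht.1
  have hn' : t - n * h ≤ h := by
    have := (div_lt_iff₀ hh).1 (Nat.lt_floor_add_one (t / h))
    linarith
  have hflow : ∀ᵐ x ∂torusMeasure d, ‖Φ t x - eulerFlow v h t x‖ ≤ 2 * (U * t) ∧
      ‖Φ t x - eulerFlow v h t x‖ ≤ ‖Φ (n * h) x - eulerNode v h n x‖ + 2 * (U * h) := by
    filter_upwards [ae_torusMeasure_of_ae (hΦ.ae_integral_eq hT hU)] with x hx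
    obtain ⟨-, hx0, hx⟩ := hx
    obtain ⟨h1, h2⟩ := norm_eulerFlow_sub_le hvm hvU hh hM ht x
    have h3 := (hx 0 t le_rfl ht.1 ht.2).2.2
    have h4 := (hx (n * h) t (by positivity) hn ht.2).2.2
    rw [hx0, sub_zero] at h3
    have h5 : U * (t - n * h) ≤ U * h := by gcongr
    constructor
    · have := norm_sub_le_norm_sub_add_norm_sub (Φ t x) x (eulerFlow v h t x)
      rw [norm_sub_rev x] at this
      linarith
    · have h6 := norm_sub_le_norm_sub_add_norm_sub (Φ t x) (Φ (n * h) x) (eulerFlow v h t x)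
      have h7 := norm_sub_le_norm_sub_add_norm_sub (Φ (n * h) x) (eulerNode v h n x)
        (eulerFlow v h t x)
      rw [norm_sub_rev (eulerNode v h n x)] at h7
      linarith
  have hQ : 0 ≤ Q := by positivity
  have hUt : 0 ≤ U * t := mul_nonneg hU0.le ht.1
  have hct := hc t ht.1
  rcases le_or_gt h h₁ with hle | hgt
  · obtain ⟨ψ, hψ1, hψA, hψ⟩ := H h hh (hle.trans (min_le_left _ _))
    have hlt : h < 1 := (hle.trans (min_le_right _ _)).trans_lt (by norm_num)
    have hcl : 0 ≤ c t * |Real.log h|⁻¹ := by positivity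
    have h1 : eLpNorm (fun x => Φ t x - eulerFlow v h t x) p (torusMeasure d) ≤
        ENNReal.ofReal (c t * |Real.log h|⁻¹) * eLpNorm ψ p (torusMeasure d) := by
      refine eLpNorm_le_mul_eLpNorm_of_ae_le_mul' (c := (c t * |Real.log h|⁻¹).toNNReal) ?_ p
      filter_upwards [hflow, hψ] with x hx1 hx2
      rw [← ofReal_norm]
      exact ofReal_le_of_log_le hU0.le ht.1 hh hlt hK (hψ1 x) (norm_nonneg _) hx1.1 hx1.2
        (hx2 n (hn.trans ht.2))
    calc _ ≤ ENNReal.ofReal (c t * |Real.log h|⁻¹) * A := h1.trans (by gcongr)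
      _ = ENNReal.ofReal (c t * |Real.log h|⁻¹ * A.toReal) := by
        rw [ENNReal.ofReal_mul hcl, ENNReal.ofReal_toReal hA]
      _ ≤ _ := by
        refine ENNReal.ofReal_le_ofReal ?_
        have : 0 ≤ B.toReal * (2 * (U * t)) * Q * |Real.log h|⁻¹ := by positivity
        linarith
  · have hlQ : |Real.log h| ≤ Q := by
      have h1 := Real.log_le_log hh₁ hgt.le
      have h2 := Real.log_le_log hh hhT
      rw [abs_le]
      constructor
      · linarith [neg_abs_le (Real.log h₁), abs_nonneg (Real.log T)]
      · linarith [le_abs_self (Real.log T), abs_nonneg (Real.log h₁)]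
    calc _ ≤ B * ENNReal.ofReal (2 * (U * t)) :=
          eLpNorm_le_of_ae_bound (hflow.mono fun x hx => hx.1)
      _ = ENNReal.ofReal (B.toReal * (2 * (U * t))) := by
        rw [ENNReal.ofReal_mul ENNReal.toReal_nonneg, ENNReal.ofReal_toReal hB]
      _ ≤ _ := by
        refine ENNReal.ofReal_le_ofReal ?_
        rw [← div_eq_mul_inv, le_div_iff₀ hl]
        have h1 : B.toReal * (2 * (U * t)) * |Real.log h| ≤ B.toReal * (2 * (U * t)) * Q := by
          gcongr
        have h2 : 0 ≤ A.toReal * c t := by positivity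
        linarith

end Stability

/-! ### The theorem. -/

theorem mainTheorem1 {d : ℕ} (hd : 1 ≤ d) (T : ℝ) (hT : 0 < T) (p : ℝ≥0∞) (hp : 1 < p)
    (η : Eucl d → ℝ) (hη : IsStandardMollifier η)
    (u : ℝ → Eucl d → Eucl d) (Du : ℝ → Eucl d → Eucl d →L[ℝ] Eucl d)
    (hu : IsSobolevVelocity T p u Du)
    (Φ : ℝ → Eucl d → Eucl d) (hΦ : IsRegularLagrangianFlow T u Φ) :
    (DivergenceAssumption T p Du → EulerStabilityEstimate T p η u Φ) ∧
    ((d : ℝ≥0∞) < p → MemL1Lq T p (negDiv Du) → EulerStabilityEstimate T p η u Φ) := by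
  have hlt : (d : ℝ≥0∞) < p → EulerStabilityEstimate T p η u Φ := fun hdp =>
    eulerStabilityEstimate_of_log_dist_le hd hT hη hu hΦ
      (hu.exists_log_dist_eulerNode_le_of_lt hd hT hp hη hΦ hdp)
  refine ⟨fun hdiv => ?_, fun hdp _ => hlt hdp⟩
  rcases le_or_gt p (d : ℝ≥0∞) with hpd | hdp
  · exact eulerStabilityEstimate_of_log_dist_le hd hT hη hu hΦ
      (hu.exists_log_dist_eulerNode_le_of_le hd hT hp hη hΦ hpd (hdiv.1 hpd))
  · exact hlt hdp
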